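/- Let $K$ be an algebraically closed field and let $\Lambda$ be a finite dimensional $K$-algebra which is symmetric (i.e. there is a $K$-linear form $\varphi:\Lambda\to K$ with $\varphi(ab)=\varphi(ba)$ whose bilinear form $(a,b)\mapsto\varphi(ab)$ is non-degenerate) and whose Jacobson radical $J$ satisfies $J^3=0$. Let $\mathcal K_\Lambda=\mathsf K^{\rm b}(\operatorname{proj}\Lambda)$ be the homotopy category of bounded complexes of finitely generated projective $\Lambda$-modules. An object $T$ of $\mathcal K_\Lambda$ is silting if $\operatorname{Hom}(T,T[i])=0$ for all $i>0$ and the smallest thick subcategory containing $T$ is $\mathcal K_\Lambda$; write $T\geq U$ if $\operatorname{Hom}(T,U[i])=0$ for all $i>0$. Let $\mathsf{2silt}\,\Lambda$ be the set of isomorphism classes of basic silting objects $T$ with $\Lambda\geq T\geq\Lambda[1]$. For an indecomposable projective $\Lambda$-module $P$ put $$\mathcal T_P^-=\{T\in\mathsf{2silt}\,\Lambda\mid \mu_P^-(\Lambda)\geq T\geq\Lambda[1]\},\qquad \mathcal T_P^+=\{T\in\mathsf{2silt}\,\Lambda\mid \Lambda\geq T\geq\mu_{P[1]}^+(\Lambda[1])\}.$$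 Here $\Lambda$ and $\Lambda[1]$ are replaced by basic objects with the same additive closure before mutating. For a basic silting object $T\cong X\oplus M$, the left mutation is $\mu_X^-(T)=Y\oplus M$ with $Y$ the cone of a minimal left $\operatorname{add}M$-approximation $X\to M'$, and the right mutation is $\mu_X^+(T)=Y\oplus M$ with $Y\to M'\to X\to Y[1]$ a triangle whose map $M'\to X$ is a minimal right $\operatorname{add}M$-approximation. Then for every indecomposable projective $\Lambda$-module $P$ there is a bijection $\mathcal T_P^-\to\mathcal T_P^+$, which moreover can be chosen to reverse the relation $\geq$. In particular $|\mathsf{2silt}\,\Lambda|=2\cdot|\mathcal T_P^-|$ (an equality of cardinals, without any finiteness assumption). -/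

import Mathlib

open CategoryTheory Limits Pretriangulated ZeroObject

universe v u w

noncomputable section

namespace Silting

/-! ### Silting theory in a triangulated category -/

section Order

variable {C : Type u} [Category.{v} C] [Preadditive C] [HasShift C ℤ]

/-- `T ≥ U`, i.e. `Hom(T, U[i]) = 0` for all `i > 0`. -/
def Geq (T U : C) : Prop :=
  ∀ i : ℤ, 0 < i → ∀ f : T ⟶ (shiftFunctor C i).obj U, f = 0

lemma Geq.of_iso {T T' U U' : C} (e : T ≅ T') (e' : U ≅ U') (h : Geq T U) : Geq T' U' := by
  intro i hi f
  have h0 := h i hi (e.hom ≫ f ≫ (shiftFunctor C i).map e'.inv)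
  have h1 : e.inv ≫ (e.hom ≫ f ≫ (shiftFunctor C i).map e'.inv) ≫
      (shiftFunctor C i).map e'.hom = f := by
    simp [← Functor.map_comp]
  rw [← h1, h0]
  simp

end Order

section Triangulated

variable {C : Type u} [Category.{v} C] [Preadditive C] [HasZeroObject C] [HasShift C ℤ]
  [∀ n : ℤ, (shiftFunctor C n).Additive] [Pretriangulated C]

/-- `thick T` is the whole category: every full triangulated subcategory closed under direct
summands that contains `T` contains all objects. -/
def ThickGenerates (T : C) : Prop :=
  ∀ Q : ObjectProperty C, Q.IsTriangulated → Q.IsStableUnderRetracts → Q T → ∀ X : C, Q X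

/-- Silting objects. -/
def IsSilting (T : C) : Prop :=
  Geq T T ∧ ThickGenerates T

/-- `T` is basic: a finite direct sum of pairwise non-isomorphic indecomposable objects. -/
def IsBasic (T : C) : Prop :=
  ∃ (n : ℕ) (Z : Fin n → C), (∀ i, Indecomposable (Z i)) ∧
    (∀ i j, Nonempty (Z i ≅ Z j) → i = j) ∧ Nonempty (T ≅ ⨁ Z)

/-- `add M`: the direct summands of finite direct sums of copies of `M`. -/
def addHull (M : C) : ObjectProperty C :=
  fun X => ∃ n : ℕ, Nonempty (Retract X (⨁ fun _ : Fin n => M))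

/-- `B` is the basic version of `T`: it is basic and `add B = add T`. It is unique up to
isomorphism in a Krull-Schmidt category. -/
def IsBasicVersion (T B : C) : Prop :=
  IsBasic B ∧ addHull B = addHull T

/-- `f : X ⟶ M'` is a minimal left `add M`-approximation of `X`. -/
def IsMinimalLeftApprox (M : C) {X M' : C} (f : X ⟶ M') : Prop :=
  addHull M M' ∧
  (∀ N : C, addHull M N → ∀ g : X ⟶ N, ∃ h : M' ⟶ N, f ≫ h = g) ∧
  ∀ h : M' ⟶ M', f ≫ h = f → IsIso h

/-- `f : M' ⟶ X` is a minimal right `add M`-approximation of `X`. -/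
def IsMinimalRightApprox (M : C) {X M' : C} (f : M' ⟶ X) : Prop :=
  addHull M M' ∧
  (∀ N : C, addHull M N → ∀ g : N ⟶ X, ∃ h : N ⟶ M', h ≫ f = g) ∧
  ∀ h : M' ⟶ M', h ≫ f = f → IsIso h

/-- `U` is the left mutation `μ_X⁻(T)`: there is a decomposition `T ≅ X ⊕ M`, and `U ≅ Y ⊕ M` with
`Y` the cone of a minimal left `add M`-approximation `X ⟶ M'`. -/
def IsLeftMutation (T X U : C) : Prop :=
  ∃ (M M' Y : C) (f : X ⟶ M') (g : M' ⟶ Y) (h : Y ⟶ (shiftFunctor C (1 : ℤ)).obj X),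
    Nonempty (T ≅ X ⊞ M) ∧ IsMinimalLeftApprox M f ∧
    Triangle.mk f g h ∈ distTriang C ∧ Nonempty (U ≅ Y ⊞ M)

/-- `U` is the right mutation `μ_X⁺(T)`: there is a decomposition `T ≅ X ⊕ M`, and `U ≅ Y ⊕ M` with
`Y ⟶ M' ⟶ X ⟶ Y[1]` a triangle whose second map is a minimal right `add M`-approximation. -/
def IsRightMutation (T X U : C) : Prop :=
  ∃ (M M' Y : C) (g : Y ⟶ M') (f : M' ⟶ X) (h : X ⟶ (shiftFunctor C (1 : ℤ)).obj Y),
    Nonempty (T ≅ X ⊞ M) ∧ IsMinimalRightApprox M f ∧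
    Triangle.mk g f h ∈ distTriang C ∧ Nonempty (U ≅ Y ⊞ M)

variable (C) in
/-- Isomorphism classes of objects. -/
abbrev IsoClass : Type _ := Quotient (isIsomorphicSetoid C)

/-- The relation `≥` on isomorphism classes. -/
def IsoClass.Geq (x y : IsoClass C) : Prop :=
  Quotient.liftOn₂ x y (fun T U => Silting.Geq T U) (by
    rintro T U T' U' ⟨e⟩ ⟨e'⟩
    exact propext ⟨fun h => h.of_iso e e', fun h => h.of_iso e.symm e'.symm⟩)

/-- The isomorphism class of an object. -/
def IsoClass.of (T : C) : IsoClass C := Quotient.mk (isIsomorphicSetoid C) T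

variable (C) in
/-- The set `silt` of isomorphism classes of basic silting objects. -/
def silt : Set (IsoClass C) :=
  {x | ∃ T : C, IsoClass.of T = x ∧ IsBasic T ∧ IsSilting T}

end Triangulated

/-! ### The perfect derived category of a ring -/

section Perfect

variable (Λ : Type w) [Ring Λ]

/-- Finitely generated projective modules. -/
def proj : ObjectProperty (ModuleCat.{w} Λ) :=
  fun M => Module.Finite Λ M ∧ Module.Projective Λ M

variable {Λ} in
lemma proj_of_iso {M N : ModuleCat.{w} Λ} (e : M ≅ N) (h : proj Λ M) : proj Λ N := by
  obtain ⟨h1, h2⟩ := h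
  have h3 : Module.Finite Λ N := Module.Finite.equiv e.toLinearEquiv
  have h4 : Module.Projective Λ N := Module.Projective.of_equiv e.toLinearEquiv
  exact ⟨h3, h4⟩

variable {Λ} in
lemma proj_of_isZero {M : ModuleCat.{w} Λ} (h : IsZero M) : proj Λ M := by
  have := ModuleCat.subsingleton_of_isZero h
  have h1 : Module.Finite Λ M := inferInstance
  have h2 : Module.Projective Λ M := Module.Projective.of_free
  exact ⟨h1, h2⟩

variable {Λ} in
lemma proj_biprod {M N : ModuleCat.{w} Λ} (hM : proj Λ M) (hN : proj Λ N) :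
    proj Λ (M ⊞ N) := by
  obtain ⟨h1, h2⟩ := hM
  obtain ⟨h3, h4⟩ := hN
  exact proj_of_iso (ModuleCat.biprodIsoProd M N).symm
    ⟨inferInstanceAs (Module.Finite Λ (M × N)), inferInstanceAs (Module.Projective Λ (M × N))⟩

/-- Bounded complexes of finitely generated projective modules. -/
def perfComplex : ObjectProperty (CochainComplex (ModuleCat.{w} Λ) ℤ) :=
  fun X => (∀ n : ℤ, proj Λ (X.X n)) ∧ ∃ N : ℤ, ∀ n : ℤ, N < |n| → IsZero (X.X n)

/-- The objects of the homotopy category that are bounded complexes of finitely generated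
projective modules. -/
def perf : ObjectProperty (HomotopyCategory (ModuleCat.{w} Λ) (ComplexShape.up ℤ)) :=
  fun X => perfComplex Λ X.as

instance : (perf Λ).ContainsZero where
  exists_zero :=
    ⟨(HomotopyCategory.quotient _ _).obj 0, Functor.map_isZero _ (isZero_zero _), by
      have h : ∀ n : ℤ, IsZero ((0 : CochainComplex (ModuleCat.{w} Λ) ℤ).X n) := fun n =>
        Functor.map_isZero (HomologicalComplex.eval _ _ n) (isZero_zero _)
      exact ⟨fun n => proj_of_isZero (h n), 0, fun n _ => h n⟩⟩

instance : (perf Λ).IsStableUnderShift ℤ where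
  isStableUnderShiftBy a :=
    { le_shift X hX := by
        obtain ⟨X : CochainComplex _ _, rfl⟩ := X.quotient_obj_surjective
        obtain ⟨h1, N, h2⟩ := hX
        have key : perfComplex Λ ((shiftFunctor (CochainComplex (ModuleCat.{w} Λ) ℤ) a).obj X) := by
          refine ⟨fun n => h1 (n + a), N + |a|, fun n hn => h2 (n + a) ?_⟩
          have h3 : |n| ≤ |n + a| + |a| := by
            simpa using abs_sub (n + a) a
          linarith
        rw [ObjectProperty.prop_shift_iff, HomotopyCategory.shift_quotient_obj]
        exact key }

lemma perfComplex_mappingCone {X Y : CochainComplex (ModuleCat.{w} Λ) ℤ} (f : X ⟶ Y)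
    (hX : perfComplex Λ X) (hY : perfComplex Λ Y) :
    perfComplex Λ (CochainComplex.mappingCone f) := by
  obtain ⟨h1, N, h2⟩ := hX
  obtain ⟨h3, N', h4⟩ := hY
  refine ⟨fun n => ?_, max (N + 1) N', fun n hn => ?_⟩
  · exact proj_of_iso (HomologicalComplex.homotopyCofiber.XIsoBiprod f n (n + 1) rfl).symm
      (proj_biprod (h1 _) (h3 _))
  · rw [CochainComplex.mappingCone.isZero_X_iff]
    have h5 : |n| ≤ |n + 1| + 1 := by
      simpa using abs_sub (n + 1) 1
    exact ⟨h2 _ (by have := (max_lt_iff.1 hn).1; linarith), h4 _ (max_lt_iff.1 hn).2⟩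

instance : (perf Λ).IsTriangulatedClosed₃ where
  ext₃' T hT h₁ h₂ := by
    obtain ⟨f : T.obj₁.as ⟶ T.obj₂.as, hf⟩ :=
      (HomotopyCategory.quotient _ _).map_surjective T.mor₁
    refine ⟨_, ?_, ⟨Triangle.π₃.mapIso (isoTriangleOfIso₁₂ T _ hT
      (HomotopyCategory.mappingCone_triangleh_distinguished f)
      (Iso.refl _) (Iso.refl _) ?_)⟩⟩
    · exact perfComplex_mappingCone Λ f h₁ h₂
    · exact (Category.comp_id _).trans (hf.symm.trans (Category.id_comp _).symm)

instance : (perf Λ).IsTriangulated where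
  toIsTriangulatedClosed₂ := .of_isTriangulatedClosed₃

/-- `𝒦_Λ = K^b(proj Λ)`: bounded complexes of finitely generated projective modules, with
homotopy classes of chain maps, as a triangulated category. -/
abbrev KbProj := (perf Λ).FullSubcategory

variable {Λ} in
/-- A finitely generated projective module as a complex concentrated in degree `0`. -/
def stalk (P : ModuleCat.{w} Λ) [hf : Module.Finite Λ P] [hp : Module.Projective Λ P] :
    KbProj Λ where
  obj := (HomotopyCategory.quotient _ _).obj
    ((HomologicalComplex.single (ModuleCat.{w} Λ) (ComplexShape.up ℤ) 0).obj P)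
  property := by
    have h : ∀ n : ℤ, n ≠ 0 → IsZero
        (((HomologicalComplex.single (ModuleCat.{w} Λ) (ComplexShape.up ℤ) 0).obj P).X n) :=
      fun n hn => HomologicalComplex.isZero_single_obj_X _ _ _ _ hn
    refine ⟨fun n => ?_, 0, fun n hn => h n (abs_pos.1 hn)⟩
    by_cases hn : n = 0
    · subst hn
      exact proj_of_iso (HomologicalComplex.singleObjXSelf (ComplexShape.up ℤ) 0 P).symm ⟨hf, hp⟩
    · exact proj_of_isZero (h n hn)

/-- `Λ` as an object of `K^b(proj Λ)`. -/
def regular : KbProj Λ :=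
  stalk (ModuleCat.of Λ Λ)

/-- `Λ[1]`. -/
def regularShift : KbProj Λ :=
  (shiftFunctor (KbProj Λ) (1 : ℤ)).obj (regular Λ)

/-- The set `2silt Λ` of isomorphism classes of basic silting objects `T` with
`Λ ≥ T ≥ Λ[1]`. -/
def twoSilt : Set (IsoClass (KbProj Λ)) :=
  {x | x ∈ silt (KbProj Λ) ∧ (IsoClass.of (regular Λ)).Geq x ∧
    x.Geq (IsoClass.of (regularShift Λ))}

variable {Λ}
variable (P : ModuleCat.{w} Λ) [Module.Finite Λ P] [Module.Projective Λ P]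

/-- `U` is `μ_P⁻(Λ)`, where `Λ` is replaced by its basic version. -/
def IsLeftMutationOfRegular (U : KbProj Λ) : Prop :=
  ∃ B : KbProj Λ, IsBasicVersion (regular Λ) B ∧ IsLeftMutation B (stalk P) U

/-- `U` is `μ_{P[1]}⁺(Λ[1])`, where `Λ[1]` is replaced by its basic version. -/
def IsRightMutationOfRegularShift (U : KbProj Λ) : Prop :=
  ∃ B : KbProj Λ, IsBasicVersion (regularShift Λ) B ∧
    IsRightMutation B ((shiftFunctor (KbProj Λ) (1 : ℤ)).obj (stalk P)) U

/-- `𝒯_P⁻`: the `T` in `2silt Λ` with `μ_P⁻(Λ) ≥ T ≥ Λ[1]`. -/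
def TMinus : Set (IsoClass (KbProj Λ)) :=
  {x | x ∈ twoSilt Λ ∧ (∃ U : KbProj Λ, IsLeftMutationOfRegular P U ∧ (IsoClass.of U).Geq x) ∧
    x.Geq (IsoClass.of (regularShift Λ))}

/-- `𝒯_P⁺`: the `T` in `2silt Λ` with `Λ ≥ T ≥ μ_{P[1]}⁺(Λ[1])`. -/
def TPlus : Set (IsoClass (KbProj Λ)) :=
  {x | x ∈ twoSilt Λ ∧ (IsoClass.of (regular Λ)).Geq x ∧
    ∃ U : KbProj Λ, IsRightMutationOfRegularShift P U ∧ x.Geq (IsoClass.of U)}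

end Perfect

/-- `Λ` is a symmetric `K`-algebra: it has a linear form `φ` with `φ(ab) = φ(ba)` whose associated
bilinear form is non-degenerate; for `Λ` finite dimensional this says `Λ ≅ Hom_K(Λ, K)` as
bimodules. -/
def IsSymmetricAlgebra (K : Type v) (Λ : Type w) [Field K] [Ring Λ] [Algebra K Λ] : Prop :=
  ∃ φ : Λ →ₗ[K] K, (∀ a b : Λ, φ (a * b) = φ (b * a)) ∧
    ∀ a : Λ, (∀ b : Λ, φ (a * b) = 0) → a = 0

end Silting

end

set_option linter.unusedSectionVars false

noncomputable section

namespace Silting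

/-! ### Sums of maps and additive hulls -/

section AddHull

variable {C : Type u} [Category.{v} C] [Preadditive C] [HasFiniteBiproducts C]

/-! A two-term silting object is the cone of a radical map `a : Q₁ ⟶ Q₀` between finitely generated
projectives. The maps `Q₁ ⟶ Q₀'` modulo those of the form `a ≫ s + t ≫ b` compute `Hom(T, T'[1])`.
If that group vanishes, every map `Q₁ ⟶ Q₀'` is radical, so `Q₁` and `Q₀'` have no common summand
(`disjoint_of_homVanishes_one`).

Symmetry and `J³ = 0` make the remaining condition linear algebra. Let `X ⟶ Y ⟶ Z` be radical maps,
where `X` and `Z` have no common summand. If the composite were nonzero, the symmetrising form would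
detect it after closing up by some `Z ⟶ X`. That map is radical too, so a product of three radical
maps would have nonzero trace, which is impossible (`rad_comp_rad_eq_zero`). Hence only the residues
of `s` and `t` modulo the radical matter, and these are matrices over `K` because `K` is
algebraically closed (`geq_obj_iff`).

Symmetry also gives `dim Hom(i, j) = dim Hom(j, i)` for indecomposable projectives. Choose mutually
inverse linear bijections for `i ≠ j` and transpose `a` entrywise. No algebra anti-automorphism is
needed, since linearity already makes transposition compatible with scalar matrices. The result is
an involution `dual` that exchanges the two degrees and reverses `≥` (`geq_dual`). Morphisms can be
transposed up to radical error, so `dual` respects isomorphism, direct sums, indecomposability and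
additive hulls. It respects silting because silting is a maximality condition phrased by `≥` and
additive hulls (`isSilting_iff`).

Finally `μ_P⁻(Λ) ≥ T` says that `P` is absent from degree `0` of `T`, and `T ≥ μ_{P[1]}⁺(Λ[1])` says
that `P` is absent from degree `-1` (`exists_leftMutation_geq_iff`, `exists_rightMutation_geq_iff`).
So `dual` exchanges the two sets. They cover everything because the degrees share no summand, and
they are disjoint because every indecomposable projective occurs in a silting object
(`exists_eq_of_isSilting`). -/

lemma biproduct_hom_ext_comp_desc {J : Type} [Fintype J] {F : J → C} {X : C}
    (f : X ⟶ ⨁ F) : f = ∑ j, (f ≫ biproduct.π F j) ≫ biproduct.ι F j := by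
  simp only [Category.assoc, ← Preadditive.comp_sum, biproduct.total, Category.comp_id]

end AddHull

section Triangulated

variable {C : Type u} [Category.{v} C] [Preadditive C] [HasZeroObject C] [HasShift C ℤ]
  [∀ n : ℤ, (shiftFunctor C n).Additive] [Pretriangulated C]

/-- The working form of the definition: a finite decomposition of the identity through `M` is
carried along by additive functors and by scalar parts, without comparing biproducts. -/
lemma addHull_iff_exists_sum {M X : C} : addHull M X ↔
    ∃ (n : ℕ) (i : Fin n → (X ⟶ M)) (p : Fin n → (M ⟶ X)), ∑ k, i k ≫ p k = 𝟙 X := by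
  constructor
  · rintro ⟨n, ⟨r⟩⟩
    refine ⟨n, fun k => r.i ≫ biproduct.π _ k, fun k => biproduct.ι (fun _ : Fin n => M) k ≫ r.r, ?_⟩
    have h := r.retract
    rw [biproduct_hom_ext_comp_desc r.i, Preadditive.sum_comp] at h
    simpa using h
  · rintro ⟨n, i, p, h⟩
    exact ⟨n, ⟨⟨biproduct.lift i, biproduct.desc p, by rw [biproduct.lift_desc, h]⟩⟩⟩

lemma addHull_of_sum {M X : C} {J : Type} [Fintype J] (i : J → (X ⟶ M)) (p : J → (M ⟶ X))
    (h : ∑ k, i k ≫ p k = 𝟙 X) : addHull M X := by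
  refine addHull_iff_exists_sum.2 ⟨Fintype.card J, fun k => i ((Fintype.equivFin J).symm k),
    fun k => p ((Fintype.equivFin J).symm k), ?_⟩
  rw [← h]
  exact Equiv.sum_comp (Fintype.equivFin J).symm (fun k => i k ≫ p k)

lemma addHull_self (M : C) : addHull M M :=
  addHull_of_sum (J := Unit) (fun _ => 𝟙 M) (fun _ => 𝟙 M) (by simp)

lemma addHull.of_retract {M X Y : C} (r : Retract X Y) (h : addHull M Y) : addHull M X := by
  obtain ⟨n, ⟨s⟩⟩ := h
  exact ⟨n, ⟨r.trans s⟩⟩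

lemma addHull.of_iso {M X Y : C} (e : X ≅ Y) (h : addHull M Y) : addHull M X :=
  h.of_retract e.retract

lemma addHull.trans {M N X : C} (h : addHull N X) (h' : addHull M N) : addHull M X := by
  obtain ⟨n, i, p, hip⟩ := addHull_iff_exists_sum.1 h
  obtain ⟨m, j, q, hjq⟩ := addHull_iff_exists_sum.1 h'
  refine addHull_of_sum (J := Fin n × Fin m) (fun k => i k.1 ≫ j k.2) (fun k => q k.2 ≫ p k.1) ?_
  rw [Fintype.sum_prod_type, ← hip]
  refine Finset.sum_congr rfl fun k _ => ?_
  have : ∀ l, (i k ≫ j l) ≫ q l ≫ p k = i k ≫ (j l ≫ q l) ≫ p k := by simp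
  simp only [this]
  rw [← Preadditive.comp_sum, ← Preadditive.sum_comp, hjq, Category.id_comp]

lemma addHull_biproduct {M : C} {J : Type} [Fintype J] {F : J → C}
    (h : ∀ j, addHull M (F j)) : addHull M (⨁ F) := by
  choose n i p hip using fun j => addHull_iff_exists_sum.1 (h j)
  refine addHull_of_sum (J := Σ j, Fin (n j)) (fun k => biproduct.π F k.1 ≫ i k.1 k.2)
    (fun k => p k.1 k.2 ≫ biproduct.ι F k.1) ?_
  rw [Fintype.sum_sigma, ← biproduct.total]
  refine Finset.sum_congr rfl fun j _ => ?_
  have : ∀ l, (biproduct.π F j ≫ i j l) ≫ p j l ≫ biproduct.ι F j =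
      biproduct.π F j ≫ (i j l ≫ p j l) ≫ biproduct.ι F j := by simp
  simp only [this]
  rw [← Preadditive.comp_sum, ← Preadditive.sum_comp, hip, Category.id_comp]

lemma addHull_biprod {M X Y : C} (hX : addHull M X) (hY : addHull M Y) : addHull M (X ⊞ Y) := by
  obtain ⟨n, i, p, hip⟩ := addHull_iff_exists_sum.1 hX
  obtain ⟨m, j, q, hjq⟩ := addHull_iff_exists_sum.1 hY
  refine addHull_of_sum (J := Fin n ⊕ Fin m)
    (Sum.elim (fun k => biprod.fst ≫ i k) (fun k => biprod.snd ≫ j k))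
    (Sum.elim (fun k => p k ≫ biprod.inl) (fun k => q k ≫ biprod.inr)) ?_
  rw [Fintype.sum_sum_type, ← biprod.total]
  congr 1
  · have : ∀ l, ((biprod.fst : X ⊞ Y ⟶ X) ≫ i l) ≫ p l ≫ (biprod.inl : X ⟶ X ⊞ Y) =
      biprod.fst ≫ (i l ≫ p l) ≫ biprod.inl := by simp
    simp only [Sum.elim_inl, this]
    rw [← Preadditive.comp_sum, ← Preadditive.sum_comp, hip, Category.id_comp]
  · have : ∀ l, ((biprod.snd : X ⊞ Y ⟶ Y) ≫ j l) ≫ q l ≫ (biprod.inr : Y ⟶ X ⊞ Y) =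
      biprod.snd ≫ (j l ≫ q l) ≫ biprod.inr := by simp
    simp only [Sum.elim_inr, this]
    rw [← Preadditive.comp_sum, ← Preadditive.sum_comp, hjq, Category.id_comp]

/-! ### Exactness for triangles given by three morphisms -/

section Exactness

variable {X Y Z W : C} {f : X ⟶ Y} {g : Y ⟶ Z} {h : Z ⟶ (shiftFunctor C (1 : ℤ)).obj X}
  (T : Triangle.mk f g h ∈ distTriang C)
include T

lemma distTriang_comp₁₂ : f ≫ g = 0 := comp_distTriang_mor_zero₁₂ _ T

lemma distTriang_comp₂₃ : g ≫ h = 0 := comp_distTriang_mor_zero₂₃ _ T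

lemma distTriang_comp₃₁ : h ≫ (shiftFunctor C (1 : ℤ)).map f = 0 :=
  comp_distTriang_mor_zero₃₁ _ T

lemma distTriang_lift₂ (φ : W ⟶ Y) (hφ : φ ≫ g = 0) : ∃ ψ : W ⟶ X, φ = ψ ≫ f :=
  Triangle.coyoneda_exact₂ _ T φ hφ

lemma distTriang_lift₃ (φ : W ⟶ Z) (hφ : φ ≫ h = 0) : ∃ ψ : W ⟶ Y, φ = ψ ≫ g :=
  Triangle.coyoneda_exact₃ _ T φ hφ

lemma distTriang_lift₁ (φ : W ⟶ (shiftFunctor C (1 : ℤ)).obj X)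
    (hφ : φ ≫ (shiftFunctor C (1 : ℤ)).map f = 0) : ∃ ψ : W ⟶ Z, φ = ψ ≫ h :=
  Triangle.coyoneda_exact₁ _ T φ hφ

lemma distTriang_desc₃ (φ : Z ⟶ W) (hφ : g ≫ φ = 0) :
    ∃ ψ : (shiftFunctor C (1 : ℤ)).obj X ⟶ W, φ = h ≫ ψ :=
  Triangle.yoneda_exact₃ _ T φ hφ

lemma distTriang_desc₁ (φ : (shiftFunctor C (1 : ℤ)).obj X ⟶ W) (hφ : h ≫ φ = 0) :
    ∃ ψ : (shiftFunctor C (1 : ℤ)).obj Y ⟶ W, φ = (shiftFunctor C (1 : ℤ)).map f ≫ ψ := by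
  obtain ⟨ψ, hψ⟩ := Triangle.yoneda_exact₃ _ (rot_of_distTriang _ T) φ hφ
  exact ⟨-ψ, by rw [hψ]; exact (Preadditive.neg_comp _ _).trans (Preadditive.comp_neg _ _).symm⟩

end Exactness

/-! ### Vanishing of shifted morphism groups -/

/-- `Hom(X, Y[n]) = 0`. -/
def HomVanishes (X Y : C) (n : ℤ) : Prop :=
  ∀ f : X ⟶ (shiftFunctor C n).obj Y, f = 0

namespace HomVanishes

lemma zero_iff {X Y : C} : HomVanishes X Y 0 ↔ ∀ f : X ⟶ Y, f = 0 := by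
  constructor
  · intro h f
    rw [← cancel_mono ((shiftFunctorZero C ℤ).app Y).inv, zero_comp]
    exact h _
  · intro h f
    rw [← cancel_mono ((shiftFunctorZero C ℤ).app Y).hom, zero_comp]
    exact h _

lemma of_retract_left {X X' Y : C} {n : ℤ} (r : Retract X' X) (h : HomVanishes X Y n) :
    HomVanishes X' Y n := fun f => by
  have := h (r.r ≫ f)
  rw [← Category.id_comp f, ← r.retract, Category.assoc, this, comp_zero]

lemma addHull_left {X T Y : C} {n : ℤ} (hX : addHull T X) (h : HomVanishes T Y n) :
    HomVanishes X Y n := fun f => by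
  obtain ⟨m, i, p, hip⟩ := addHull_iff_exists_sum.1 hX
  rw [← Category.id_comp f, ← hip, Preadditive.sum_comp]
  refine Finset.sum_eq_zero fun k _ => ?_
  rw [Category.assoc, h (p k ≫ f), comp_zero]

lemma addHull_right {X T Y : C} {n : ℤ} (hY : addHull T Y) (h : HomVanishes X T n) :
    HomVanishes X Y n := fun f => by
  obtain ⟨m, i, p, hip⟩ := addHull_iff_exists_sum.1 hY
  rw [← Category.comp_id f, ← CategoryTheory.Functor.map_id, ← hip, Functor.map_sum, Preadditive.comp_sum]
  refine Finset.sum_eq_zero fun k _ => ?_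
  rw [Functor.map_comp, ← Category.assoc, h (f ≫ (shiftFunctor C n).map (i k)), zero_comp]

lemma addHull {X X' Y Y' : C} {n : ℤ} (hX : addHull X X') (hY : Silting.addHull Y Y')
    (h : HomVanishes X Y n) : HomVanishes X' Y' n :=
  (h.addHull_left hX).addHull_right hY

lemma shift_right_iff {X Y : C} (a n m : ℤ) (h : a + n = m) :
    HomVanishes X ((shiftFunctor C a).obj Y) n ↔ HomVanishes X Y m := by
  constructor
  · intro H f
    rw [← cancel_mono ((shiftFunctorAdd' C a n m h).app Y).hom, zero_comp]
    exact H _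
  · intro H f
    rw [← cancel_mono ((shiftFunctorAdd' C a n m h).app Y).inv, zero_comp]
    exact H _

lemma shift_left_iff {X Y : C} (a n m : ℤ) (h : m + a = n) :
    HomVanishes ((shiftFunctor C a).obj X) Y n ↔ HomVanishes X Y m := by
  constructor
  · intro H f
    apply (shiftFunctor C a).map_injective
    rw [← cancel_mono ((shiftFunctorAdd' C m a n h).app Y).inv, Functor.map_zero, zero_comp]
    exact H _
  · intro H f
    obtain ⟨g, hg⟩ := (shiftFunctor C a).map_surjective
      (f ≫ ((shiftFunctorAdd' C m a n h).app Y).hom)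
    rw [H g, Functor.map_zero] at hg
    rw [← cancel_mono ((shiftFunctorAdd' C m a n h).app Y).hom, zero_comp, ← hg]

variable {T : Triangle C} (hT : T ∈ distTriang C)
include hT

/-- Exactness at the middle term of the long exact `Hom` sequence; the variants for the other two
positions follow by rotating the triangle. -/
lemma right₂ {X : C} {n : ℤ} (h₁ : HomVanishes X T.obj₁ n) (h₃ : HomVanishes X T.obj₃ n) :
    HomVanishes X T.obj₂ n := fun f => by
  obtain ⟨g, rfl⟩ := Triangle.coyoneda_exact₂ _ (Triangle.shift_distinguished T hT n) f (h₃ _)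
  rw [h₁ g]
  exact zero_comp

lemma right₃ {X : C} {n : ℤ} (h₂ : HomVanishes X T.obj₂ n) (h₁ : HomVanishes X T.obj₁ (n + 1)) :
    HomVanishes X T.obj₃ n :=
  right₂ (rot_of_distTriang _ hT) h₂ ((shift_right_iff 1 n (n + 1) (add_comm _ _)).2 h₁)

lemma right₁ {X : C} {n : ℤ} (h₃ : HomVanishes X T.obj₃ (n - 1)) (h₂ : HomVanishes X T.obj₂ n) :
    HomVanishes X T.obj₁ n :=
  right₂ (inv_rot_of_distTriang _ hT) ((shift_right_iff (-1) n (n - 1) (by ring)).2 h₃) h₂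

lemma left₂ {Y : C} {n : ℤ} (h₁ : HomVanishes T.obj₁ Y n) (h₃ : HomVanishes T.obj₃ Y n) :
    HomVanishes T.obj₂ Y n := fun f => by
  obtain ⟨g, rfl⟩ := Triangle.yoneda_exact₂ _ hT f (h₁ _)
  rw [h₃ g, comp_zero]

lemma left₃ {Y : C} {n : ℤ} (h₂ : HomVanishes T.obj₂ Y n) (h₁ : HomVanishes T.obj₁ Y (n - 1)) :
    HomVanishes T.obj₃ Y n :=
  left₂ (rot_of_distTriang _ hT) h₂ ((shift_left_iff 1 n (n - 1) (by ring)).2 h₁)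

lemma left₁ {Y : C} {n : ℤ} (h₃ : HomVanishes T.obj₃ Y (n + 1)) (h₂ : HomVanishes T.obj₂ Y n) :
    HomVanishes T.obj₁ Y n :=
  left₂ (inv_rot_of_distTriang _ hT) ((shift_left_iff (-1) n (n + 1) (by ring)).2 h₃) h₂

end HomVanishes

lemma Geq.homVanishes {X Y : C} (h : Geq X Y) {n : ℤ} (hn : 0 < n) : HomVanishes X Y n := h n hn

lemma Geq.addHull {X X' Y Y' : C} (hX : addHull X X') (hY : Silting.addHull Y Y') (h : Geq X Y) :
    Geq X' Y' := fun _ hn => (h.homVanishes hn).addHull hX hY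

/-! ### Approximations -/

/-- `Q ⟶ X` is a right approximation by `addHull T`. -/
def IsRightApprox (T : C) {Q X : C} (π : Q ⟶ X) : Prop :=
  addHull T Q ∧ ∀ N : C, addHull T N → ∀ g : N ⟶ X, ∃ h : N ⟶ Q, h ≫ π = g

/-- `X ⟶ Q` is a left approximation by `addHull T`. -/
def IsLeftApprox (T : C) {X Q : C} (π : X ⟶ Q) : Prop :=
  addHull T Q ∧ ∀ N : C, addHull T N → ∀ g : X ⟶ N, ∃ h : Q ⟶ N, π ≫ h = g

lemma IsRightApprox.of_self {T Q X : C} {π : Q ⟶ X} (hQ : addHull T Q)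
    (h : ∀ g : T ⟶ X, ∃ h : T ⟶ Q, h ≫ π = g) : IsRightApprox T π := by
  refine ⟨hQ, fun N hN g => ?_⟩
  obtain ⟨m, i, p, hip⟩ := addHull_iff_exists_sum.1 hN
  choose l hl using fun k => h (p k ≫ g)
  refine ⟨∑ k, i k ≫ l k, ?_⟩
  rw [← Category.id_comp g, ← hip]
  simp [Preadditive.sum_comp, hl]

lemma IsLeftApprox.of_self {T Q X : C} {π : X ⟶ Q} (hQ : addHull T Q)
    (h : ∀ g : X ⟶ T, ∃ h : Q ⟶ T, π ≫ h = g) : IsLeftApprox T π := by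
  refine ⟨hQ, fun N hN g => ?_⟩
  obtain ⟨m, i, p, hip⟩ := addHull_iff_exists_sum.1 hN
  choose l hl using fun k => h (g ≫ i k)
  refine ⟨∑ k, l k ≫ p k, ?_⟩
  rw [← Category.comp_id g, ← hip]
  simp only [Preadditive.comp_sum, ← Category.assoc, hl]

section Linear

variable (K : Type*) [Field K] [Linear K C] [∀ X Y : C, Module.Finite K (X ⟶ Y)]
include K

/-- A finite spanning family of `Hom(T, X)`, assembled into one map out of copies of `T`, reaches
every map `T ⟶ X` through a column of scalars. -/
lemma exists_rightApprox (T X : C) : ∃ (n : ℕ) (π : (⨁ fun _ : Fin n => T) ⟶ X),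
    IsRightApprox T π := by
  obtain ⟨n, s, hs⟩ := Module.Finite.exists_fin (R := K) (M := T ⟶ X)
  refine ⟨n, biproduct.desc s, .of_self (addHull_biproduct fun _ => addHull_self T) fun g => ?_⟩
  have hg : g ∈ Submodule.span K (Set.range s) := hs ▸ Submodule.mem_top
  obtain ⟨c, hc⟩ := (Submodule.mem_span_range_iff_exists_fun K).1 hg
  refine ⟨biproduct.lift fun k => c k • 𝟙 T, ?_⟩
  rw [biproduct.lift_desc, ← hc]
  simp

lemma exists_leftApprox (T X : C) : ∃ (n : ℕ) (π : X ⟶ (⨁ fun _ : Fin n => T)),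
    IsLeftApprox T π := by
  obtain ⟨n, s, hs⟩ := Module.Finite.exists_fin (R := K) (M := X ⟶ T)
  refine ⟨n, biproduct.lift s, .of_self (addHull_biproduct fun _ => addHull_self T) fun g => ?_⟩
  have hg : g ∈ Submodule.span K (Set.range s) := hs ▸ Submodule.mem_top
  obtain ⟨c, hc⟩ := (Submodule.mem_span_range_iff_exists_fun K).1 hg
  refine ⟨biproduct.desc fun k => c k • 𝟙 T, ?_⟩
  rw [biproduct.lift_desc, ← hc]
  simp

end Linear

/-! ### Objects between `T` and `T` lie in `addHull T` -/

/-- Objects from which there are no maps to objects that are sufficiently far `T`-acyclic. -/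
def boundedFor (T : C) : ObjectProperty C := fun X =>
  ∃ N : ℤ, ∀ Z : C, (∀ i : ℤ, -N ≤ i → HomVanishes T Z i) → HomVanishes X Z 0

lemma boundedFor_self (T : C) : boundedFor T T := ⟨0, fun _ h => h 0 (by simp)⟩

/-- This class is thick and contains `T`, so for silting `T` it contains every object; the resulting
bound stops the induction in `homVanishes_of_acyclic`. -/
instance (T : C) : (boundedFor T).IsTriangulated where
  exists_zero := ⟨0, isZero_zero C, 0, fun _ _ _ => (isZero_zero C).eq_of_src _ _⟩
  isStableUnderShiftBy a :=
    { le_shift X hX := by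
        obtain ⟨N, hN⟩ := hX
        refine ⟨N + a, fun Z hZ => ?_⟩
        rw [HomVanishes.shift_left_iff a 0 (-a) (by ring),
          ← HomVanishes.shift_right_iff (-a) 0 (-a) (by ring)]
        refine hN _ fun i hi => ?_
        rw [HomVanishes.shift_right_iff (-a) i (i - a) (by ring)]
        exact hZ _ (by linarith) }
  toIsTriangulatedClosed₂ := .mk fun S hS h₁ h₃ => by
    obtain ⟨N₁, h₁⟩ := h₁
    obtain ⟨N₃, h₃⟩ := h₃
    refine ObjectProperty.le_isoClosure _ _ ⟨max N₁ N₃, fun Z hZ => HomVanishes.left₂ hS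
      (h₁ Z fun i hi => hZ i ?_) (h₃ Z fun i hi => hZ i ?_)⟩
    · exact (neg_le_neg (le_max_left _ _)).trans hi
    · exact (neg_le_neg (le_max_right _ _)).trans hi

instance (T : C) : (boundedFor T).IsStableUnderRetracts where
  of_retract r h := by
    obtain ⟨N, hN⟩ := h
    exact ⟨N, fun Z hZ => (hN Z hZ).of_retract_left r⟩

section Linear

variable (K : Type*) [Field K] [Linear K C] [∀ X Y : C, Module.Finite K (X ⟶ Y)]
include K

lemma exists_approx_triangle (T X : C) : ∃ (Q Z : C) (π : Q ⟶ X) (p : X ⟶ Z)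
    (δ : Z ⟶ (shiftFunctor C (1 : ℤ)).obj Q),
    IsRightApprox T π ∧ Triangle.mk π p δ ∈ distTriang C := by
  obtain ⟨n, π, hπ⟩ := exists_rightApprox K T X
  obtain ⟨Z, p, δ, h⟩ := Pretriangulated.distinguished_cocone_triangle π
  exact ⟨_, Z, π, p, δ, hπ, h⟩

/-- A map `T ⟶ Z` lifts to `X` because `Hom(T, Q[1]) = 0`, then factors through the approximation,
and so dies in the cone. -/
lemma IsRightApprox.homVanishes_cone {T Q X Z : C} {π : Q ⟶ X} {p : X ⟶ Z}
    {δ : Z ⟶ (shiftFunctor C (1 : ℤ)).obj Q} (hπ : IsRightApprox T π)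
    (h : Triangle.mk π p δ ∈ distTriang C) (hT : Geq T T) : HomVanishes T Z 0 := by
  rw [HomVanishes.zero_iff]
  intro f
  have h1 : HomVanishes T Q 1 := (hT.homVanishes one_pos).addHull_right hπ.1
  obtain ⟨g, rfl⟩ := distTriang_lift₃ h f (h1 _)
  obtain ⟨l, rfl⟩ := hπ.2 T (addHull_self T) g
  rw [Category.assoc, distTriang_comp₁₂ h, comp_zero]

/-- Killing the maps from shifts of `T` one degree at a time pushes `Z` further out. This loses no
maps from `X`, since `X ≥ T` gives `Hom(X, T[n+1]) = 0`. Eventually the bound `N` for `X` applies.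
-/
lemma homVanishes_of_acyclic {T : C} (hT : IsSilting T) {X : C} (hX : Geq X T) {Z : C}
    (hZ : ∀ i : ℤ, 0 ≤ i → HomVanishes T Z i) : HomVanishes X Z 0 := by
  obtain ⟨N, hN⟩ := hT.2 (boundedFor T) inferInstance inferInstance (boundedFor_self T) X
  -- Here `Z` is acyclic down to degree `-n`, and `k` bounds how many more degrees are needed to
  -- reach `-N`.
  suffices H : ∀ k n : ℕ, N ≤ (n : ℤ) + k → ∀ Z : C,
      (∀ i : ℤ, -(n : ℤ) ≤ i → HomVanishes T Z i) → HomVanishes X Z 0 from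
    H N.toNat 0 (by simp) Z (fun i hi => hZ i (by simpa using hi))
  intro k
  induction k with
  | zero => exact fun n hn Z hZ => hN Z fun i hi => hZ i (by simp at hn; linarith)
  | succ k ih =>
    intro n hn Z hZ
    obtain ⟨Q, W, π, p, δ, hπ, h⟩ := exists_approx_triangle K ((shiftFunctor C ((n : ℤ) + 1)).obj T) Z
    have hQ : HomVanishes X Q 0 := HomVanishes.addHull_right hπ.1
      ((HomVanishes.shift_right_iff ((n : ℤ) + 1) 0 ((n : ℤ) + 1) (by ring)).2
        (hX.homVanishes (by positivity)))
    have hTT : ∀ i : ℤ, -(n : ℤ) ≤ i → HomVanishes T Q i := fun i hi =>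
      HomVanishes.addHull_right hπ.1
      ((HomVanishes.shift_right_iff ((n : ℤ) + 1) i ((n : ℤ) + 1 + i) (by ring)).2
        (hT.1.homVanishes (by linarith)))
    refine HomVanishes.right₂ h hQ (ih (n + 1) (by push_cast at hn ⊢; linarith) W fun i hi => ?_)
    -- The new boundary degree `-(n+1)` is cleared by the approximation property; the higher degrees
    -- are inherited from `Z`.
    rcases eq_or_lt_of_le hi with hi | hi
    · have h0 := hπ.homVanishes_cone K h (fun i hi =>
        (HomVanishes.shift_left_iff ((n : ℤ) + 1) i (i - (n + 1)) (by ring)).2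
          ((HomVanishes.shift_right_iff ((n : ℤ) + 1) (i - (n + 1)) i (by ring)).2
            (hT.1.homVanishes hi)))
      rwa [HomVanishes.shift_left_iff ((n : ℤ) + 1) 0 i (by push_cast at hi; linarith)] at h0
    · push_cast at hi
      exact HomVanishes.right₃ h (hZ i (by linarith)) (hTT _ (by linarith))

/-- If `T` is silting and `T ≥ X ≥ T`, then `X ∈ add T`. -/
lemma addHull_of_geq_geq {T : C} (hT : IsSilting T) {X : C} (h₁ : Geq T X) (h₂ : Geq X T) :
    addHull T X := by
  obtain ⟨Q, Z, π, p, δ, hπ, h⟩ := exists_approx_triangle K T X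
  have hZ : ∀ i : ℤ, 0 ≤ i → HomVanishes T Z i := fun i hi => by
    rcases eq_or_lt_of_le hi with rfl | hi
    · exact hπ.homVanishes_cone K h hT.1
    · exact HomVanishes.right₃ h (h₁.homVanishes hi)
        ((hT.1.homVanishes (by linarith)).addHull_right hπ.1)
  -- The cone of the approximation is acyclic in all degrees `≥ 0`, so `X ⟶ Z` vanishes and the
  -- approximation splits.
  have hp : p = 0 := HomVanishes.zero_iff.1 (homVanishes_of_acyclic K hT h₂ hZ) p
  obtain ⟨s, hs⟩ := distTriang_lift₂ h (𝟙 X) (by simp [hp])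
  exact hπ.1.of_retract ⟨s, π, hs.symm⟩

end Linear

end Triangulated

open scoped ModuleCat.Algebra

/-! ### Finite dimensionality of the morphism spaces. -/

section LinearStructure

variable (K : Type v) [Field K] (Λ : Type w) [Ring Λ] [Algebra K Λ]

instance : Linear K (KbProj Λ) :=
  inferInstanceAs (Linear K (perf Λ).FullSubcategory)

lemma finite_hom_moduleCat [FiniteDimensional K Λ] (A B : ModuleCat.{w} Λ)
    [Module.Finite Λ A] [Module.Finite Λ B] : Module.Finite K (A ⟶ B) := by
  have : Module.Finite K A := Module.Finite.trans Λ A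
  have : Module.Finite K B := Module.Finite.trans Λ B
  let φ : (A ⟶ B) →ₗ[K] (A →ₗ[K] B) :=
    { toFun := fun f => f.hom.restrictScalars K
      map_add' := fun _ _ => rfl
      map_smul' := fun _ _ => rfl }
  refine Module.Finite.of_injective φ fun f g h => ?_
  ext x
  exact LinearMap.congr_fun h x

lemma finite_hom_complex [FiniteDimensional K Λ] {X Y : CochainComplex (ModuleCat.{w} Λ) ℤ}
    (hX : perfComplex Λ X) (hY : perfComplex Λ Y) : Module.Finite K (X ⟶ Y) := by
  obtain ⟨h1, N, h2⟩ := hX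
  have h3 := hY.1
  have : ∀ n : Finset.Icc (-N) N, Module.Finite K (X.X n ⟶ Y.X n) := fun n => by
    have := (h1 n).1
    have := (h3 n).1
    exact finite_hom_moduleCat K Λ _ _
  let φ : (X ⟶ Y) →ₗ[K] (∀ n : Finset.Icc (-N) N, (X.X n ⟶ Y.X n)) :=
    { toFun := fun f n => f.f n
      map_add' := fun _ _ => rfl
      map_smul' := fun _ _ => rfl }
  refine Module.Finite.of_injective φ fun f g h => ?_
  ext1 n
  by_cases hn : n ∈ Finset.Icc (-N) N
  · exact congrFun h ⟨n, hn⟩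
  · refine (h2 n ?_).eq_of_src _ _
    rw [Finset.mem_Icc, ← abs_le] at hn
    exact not_le.1 hn

instance [FiniteDimensional K Λ] (X Y : KbProj Λ) : Module.Finite K (X ⟶ Y) := by
  have := finite_hom_complex K Λ X.property Y.property
  let φ : (X.obj.as ⟶ Y.obj.as) →ₗ[K] (X ⟶ Y) :=
    { toFun := fun f => ObjectProperty.homMk ((HomotopyCategory.quotient _ _).map f)
      map_add' := fun f g => by
        apply (perf Λ).ι.map_injective
        exact (HomotopyCategory.quotient _ _).map_add
      map_smul' := fun c f => by
        apply (perf Λ).ι.map_injective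
        exact (HomotopyCategory.quotient (ModuleCat Λ) (ComplexShape.up ℤ)).map_smul c f }
  refine Module.Finite.of_surjective φ fun f => ?_
  obtain ⟨g, hg⟩ := (HomotopyCategory.quotient _ _).map_surjective f.hom
  exact ⟨g, (perf Λ).ι.map_injective hg⟩

end LinearStructure

/-! ### Finitely generated projectives embed fully faithfully as stalk complexes. -/

section Stalk

variable (Λ : Type w) [Ring Λ]

/-- The functor sending a finitely generated projective module to its stalk complex. -/
def stalkFunctor : (proj Λ).FullSubcategory ⥤ KbProj Λ :=
  (perf Λ).lift ((proj Λ).ι ⋙ HomologicalComplex.single _ (ComplexShape.up ℤ) 0 ⋙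
    HomotopyCategory.quotient _ _) fun P => by
      have := P.property.1
      have := P.property.2
      exact (stalk P.obj).property

instance : (stalkFunctor Λ).Additive where
  map_add {P Q f g} := by
    apply (perf Λ).ι.map_injective
    change (HomotopyCategory.quotient _ _).map
      ((HomologicalComplex.single _ (ComplexShape.up ℤ) 0).map (f.hom + g.hom)) = _
    rw [Functor.map_add, Functor.map_add]
    rfl

instance : (stalkFunctor Λ).Full where
  map_surjective {P Q} f := by
    obtain ⟨g, hg⟩ := (HomotopyCategory.quotient _ _).map_surjective f.hom
    obtain ⟨g, rfl⟩ := (HomologicalComplex.single _ (ComplexShape.up ℤ) 0).map_surjective g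
    exact ⟨ObjectProperty.homMk g, (perf Λ).ι.map_injective hg⟩

/-- A null-homotopy of a map between stalks contributes nothing in degree `0`, because all the
differentials vanish. -/
instance : (stalkFunctor Λ).Faithful where
  map_injective {P Q} f g h := by
    rw [← sub_eq_zero] at h ⊢
    rw [← Functor.map_sub] at h
    generalize f - g = u at h
    have h' := congrArg (fun z => z.hom) h
    change (HomotopyCategory.quotient _ _).map
      ((HomologicalComplex.single _ (ComplexShape.up ℤ) 0).map u.hom) = 0 at h'
    rw [HomotopyCategory.quotient_map_eq_zero_iff] at h'
    obtain ⟨h'⟩ := h'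
    have h0 := h'.comm 0
    rw [dNext_eq h'.hom (show (ComplexShape.up ℤ).Rel 0 1 by simp),
      prevD_eq h'.hom (show (ComplexShape.up ℤ).Rel (-1) 0 by simp)] at h0
    rw [HomologicalComplex.single_obj_d, HomologicalComplex.single_obj_d] at h0
    simp only [zero_comp, comp_zero, add_zero, HomologicalComplex.zero_f] at h0
    apply (proj Λ).ι.map_injective
    apply (HomologicalComplex.single _ (ComplexShape.up ℤ) 0).map_injective
    rw [Functor.map_zero, Functor.map_zero]
    exact HomologicalComplex.from_single_hom_ext h0

end Stalk

/-! ### Degreewise vanishing, and projectives as summands of free modules. -/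

section Shift

variable {Λ : Type w} [Ring Λ]

/-- The shift of an object of `K^b(proj Λ)` in terms of chain complexes. -/
def shiftObjIso (X : KbProj Λ) (n : ℤ) : ((shiftFunctor (KbProj Λ) n).obj X).obj ≅
    (HomotopyCategory.quotient _ _).obj
      ((shiftFunctor (CochainComplex (ModuleCat.{w} Λ) ℤ) n).obj X.obj.as) :=
  ((perf Λ).ι.commShiftIso n).app X ≪≫
    (((HomotopyCategory.quotient (ModuleCat.{w} Λ) (ComplexShape.up ℤ)).commShiftIso n).app
      X.obj.as).symm

lemma homVanishes_of_degreewise {X Y : KbProj Λ} {n : ℤ}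
    (h : ∀ i : ℤ, IsZero (X.obj.as.X i) ∨ IsZero (Y.obj.as.X (i + n))) :
    HomVanishes X Y n := fun f => by
  apply (perf Λ).ι.map_injective
  obtain ⟨g, hg⟩ := (HomotopyCategory.quotient _ _).map_surjective
    ((perf Λ).ι.map f ≫ (shiftObjIso Y n).hom)
  have : g = 0 := by
    ext1 i
    rcases h i with h | h
    · exact h.eq_of_src _ _
    · exact IsZero.eq_of_tgt (h : IsZero (((shiftFunctor (CochainComplex (ModuleCat.{w} Λ) ℤ)
        n).obj Y.obj.as).X i)) _ _
  rw [this, Functor.map_zero] at hg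
  rw [Functor.map_zero, ← cancel_mono (shiftObjIso Y n).hom, zero_comp]
  exact hg.symm

lemma isZero_stalk_X (P : ModuleCat.{w} Λ) [Module.Finite Λ P] [Module.Projective Λ P] {i : ℤ}
    (hi : i ≠ 0) : IsZero ((stalk P).obj.as.X i) :=
  HomologicalComplex.isZero_single_obj_X _ _ _ _ hi

lemma homVanishes_stalk (P Q : ModuleCat.{w} Λ) [Module.Finite Λ P] [Module.Projective Λ P]
    [Module.Finite Λ Q] [Module.Projective Λ Q] {n : ℤ} (hn : n ≠ 0) :
    HomVanishes (stalk P) (stalk Q) n := by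
  refine homVanishes_of_degreewise fun i => ?_
  by_cases hi : i = 0
  · exact Or.inr (isZero_stalk_X Q (by omega))
  · exact Or.inl (isZero_stalk_X P hi)

lemma homVanishes_regular {n : ℤ} (hn : n ≠ 0) : HomVanishes (regular Λ) (regular Λ) n :=
  homVanishes_stalk _ _ hn

lemma addHull_regular_stalk (P : ModuleCat.{w} Λ) [hf : Module.Finite Λ P]
    [hp : Module.Projective Λ P] : addHull (regular Λ) (stalk P) := by
  obtain ⟨n, f, g, hg, -, h⟩ := Module.Finite.exists_comp_eq_id_of_projective Λ P
  let F := stalkFunctor Λ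
  let P' : (proj Λ).FullSubcategory := ⟨P, hf, hp⟩
  let R' : (proj Λ).FullSubcategory := ⟨ModuleCat.of Λ Λ, inferInstanceAs (Module.Finite Λ Λ),
    inferInstanceAs (Module.Projective Λ Λ)⟩
  let i : Fin n → (P' ⟶ R') := fun k =>
    ObjectProperty.homMk (ModuleCat.ofHom (LinearMap.proj k ∘ₗ g))
  let p : Fin n → (R' ⟶ P') := fun k =>
    ObjectProperty.homMk (ModuleCat.ofHom (f ∘ₗ LinearMap.single Λ (fun _ => Λ) k))
  have hip : ∑ k, i k ≫ p k = 𝟙 P' := by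
    apply (proj Λ).ι.map_injective
    rw [Functor.map_sum]
    ext x
    have hx : f (g x) = x := LinearMap.congr_fun h x
    have : g x = ∑ k, Pi.single k (g x k) := by
      rw [Finset.univ_sum_single]
    rw [this, map_sum] at hx
    simp only [Functor.map_comp, ModuleCat.hom_sum, LinearMap.sum_apply]
    exact hx
  have key : ∑ k, F.map (i k) ≫ F.map (p k) = 𝟙 (F.obj P') := by
    rw [← CategoryTheory.Functor.map_id, ← hip, Functor.map_sum]
    simp only [Functor.map_comp]
  exact addHull_of_sum (M := F.obj R') (X := F.obj P') _ _ key

end Shift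

/-! ### Splitting idempotents and indecomposability. -/

section Idempotents

variable {D : Type u} [Category.{v} D] [Preadditive D]

/-- The idempotent `e` splits. -/
def SplitsIdem {X : D} (e : X ⟶ X) : Prop :=
  ∃ (Y : D) (i : Y ⟶ X) (p : X ⟶ Y), i ≫ p = 𝟙 Y ∧ p ≫ i = e

lemma nonempty_iso_biprod_of_sum [HasBinaryBiproducts D] {X Y Z : D} {i : Y ⟶ X} {p : X ⟶ Y}
    {j : Z ⟶ X} {q : X ⟶ Z} (hi : i ≫ p = 𝟙 Y) (hj : j ≫ q = 𝟙 Z) (h : p ≫ i + q ≫ j = 𝟙 X) :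
    Nonempty (X ≅ Y ⊞ Z) := by
  -- Orthogonality need not be assumed: inserting `p ≫ i + q ≫ j = 𝟙` into `i ≫ q` gives `i ≫ q = i
  -- ≫ q + i ≫ q`.
  have h1 : i ≫ q = 0 := by
    have : i ≫ (p ≫ i + q ≫ j) ≫ q = i ≫ q + i ≫ q := by
      simp only [Preadditive.add_comp, Preadditive.comp_add, Category.assoc, hj, reassoc_of% hi,
        Category.comp_id]
    rw [h, Category.id_comp] at this
    simpa using this
  have h2 : j ≫ p = 0 := by
    have : j ≫ (p ≫ i + q ≫ j) ≫ p = j ≫ p + j ≫ p := by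
      simp only [Preadditive.add_comp, Preadditive.comp_add, Category.assoc, hi, reassoc_of% hj,
        Category.comp_id]
    rw [h, Category.id_comp] at this
    simpa using this
  refine ⟨⟨biprod.lift p q, biprod.desc i j, by rw [biprod.lift_desc, h], ?_⟩⟩
  ext <;> simp [hi, hj, h1, h2]

lemma idem_eq_zero_or_id_of_indecomposable [HasBinaryBiproducts D] {X : D} (hX : Indecomposable X)
    {e : X ⟶ X} (h₁ : SplitsIdem e) (h₂ : SplitsIdem (𝟙 X - e)) :
    e = 0 ∨ e = 𝟙 X := by
  obtain ⟨Y, i, p, hi, rfl⟩ := h₁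
  obtain ⟨Z, j, q, hj, hq⟩ := h₂
  obtain ⟨f⟩ := nonempty_iso_biprod_of_sum hi hj (by rw [hq]; abel)
  rcases hX.2 Y Z f with h | h
  · left
    rw [h.eq_of_tgt p 0, zero_comp]
  · right
    rw [h.eq_of_tgt q 0, zero_comp] at hq
    exact (sub_eq_zero.1 hq.symm).symm

lemma indecomposable_of_idem [HasBinaryBiproducts D] {X : D} (h₀ : ¬ IsZero X)
    (h : ∀ e : X ⟶ X, e ≫ e = e → e = 0 ∨ e = 𝟙 X) : Indecomposable X := by
  refine ⟨h₀, fun Y Z f => ?_⟩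
  rcases h (f.hom ≫ biprod.fst ≫ biprod.inl ≫ f.inv) (by simp) with h | h
  · left
    have h' := congrArg (fun z => biprod.inl ≫ f.inv ≫ z ≫ f.hom ≫ biprod.fst) h
    simp only [Category.assoc, Iso.inv_hom_id_assoc, biprod.inl_fst_assoc, biprod.inl_fst,
      zero_comp, comp_zero] at h'
    exact (IsZero.iff_id_eq_zero _).2 h'
  · right
    have h' := congrArg (fun z => biprod.inr ≫ f.inv ≫ z ≫ f.hom ≫ biprod.snd) h
    simp only [Category.assoc, Iso.inv_hom_id_assoc, biprod.inr_fst_assoc, biprod.inr_snd,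
      zero_comp, Category.id_comp] at h'
    exact (IsZero.iff_id_eq_zero _).2 h'.symm

end Idempotents

section StalkIdempotents

variable {Λ : Type w} [Ring Λ]

lemma indecomposable_stalk {P : ModuleCat.{w} Λ} [hf : Module.Finite Λ P]
    [hp : Module.Projective Λ P] (hP : Indecomposable P) : Indecomposable (stalk P) := by
  let P' : (proj Λ).FullSubcategory := ⟨P, hf, hp⟩
  refine indecomposable_of_idem (fun h => hP.1 ?_) fun e he => ?_
  · have h1 : (stalkFunctor Λ).map (𝟙 P') = (stalkFunctor Λ).map 0 :=
      IsZero.eq_of_src (X := stalk P) h _ _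
    have h2 := congrArg (fun z => z.hom) ((stalkFunctor Λ).map_injective h1)
    exact (IsZero.iff_id_eq_zero _).2 h2
  · obtain ⟨u, rfl⟩ := (stalkFunctor Λ).map_surjective (X := P') (Y := P') e
    have hu : u ≫ u = u := (stalkFunctor Λ).map_injective (by rw [Functor.map_comp]; exact he)
    have hu' : u.hom ≫ u.hom = u.hom := congrArg (fun z => z.hom) hu
    obtain ⟨Y, i, p, h1, h2⟩ := IsIdempotentComplete.idempotents_split P u.hom hu'
    obtain ⟨Z, j, q, h3, h4⟩ := IsIdempotentComplete.idempotents_split P (𝟙 P - u.hom)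
      (by simp [hu'])
    rcases idem_eq_zero_or_id_of_indecomposable hP ⟨Y, i, p, h1, h2⟩ ⟨Z, j, q, h3, h4⟩ with h | h
    · left
      have : u = 0 := (proj Λ).ι.map_injective h
      rw [this]
      exact Functor.map_zero _ _ _
    · right
      have : u = 𝟙 P' := (proj Λ).ι.map_injective h
      rw [this]
      exact CategoryTheory.Functor.map_id _ _

/-- `X` is a retract of the stalk of a free module `Q`. Fullness and faithfulness turn `e` into an
idempotent module endomorphism `u` of `Q`, and the stalk of its image, which is projective, splits
`e`. -/
lemma splitsIdem_of_addHull {X : KbProj Λ} (hX : addHull (regular Λ) X) {e : X ⟶ X}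
    (he : e ≫ e = e) : SplitsIdem e := by
  let F := stalkFunctor Λ
  let R' : (proj Λ).FullSubcategory := ⟨ModuleCat.of Λ Λ, inferInstanceAs (Module.Finite Λ Λ),
    inferInstanceAs (Module.Projective Λ Λ)⟩
  have hX' : addHull (F.obj R') X := hX
  obtain ⟨n, i, p, hip⟩ := addHull_iff_exists_sum.1 hX'
  let Q : (proj Λ).FullSubcategory := ⟨ModuleCat.of Λ (Fin n → Λ),
    inferInstanceAs (Module.Finite Λ (Fin n → Λ)),
    inferInstanceAs (Module.Projective Λ (Fin n → Λ))⟩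
  let a : Fin n → (R' ⟶ Q) := fun k =>
    ObjectProperty.homMk (ModuleCat.ofHom (LinearMap.single Λ (fun _ => Λ) k))
  let b : Fin n → (Q ⟶ R') := fun k => ObjectProperty.homMk (ModuleCat.ofHom (LinearMap.proj k))
  have hab : ∀ k l, a k ≫ b l = if k = l then 𝟙 R' else 0 := by
    intro k l
    apply (proj Λ).ι.map_injective
    split_ifs with h
    · subst h
      ext
      change (Pi.single k (1 : Λ) : Fin n → Λ) k = 1
      simp
    · ext
      change (Pi.single k (1 : Λ) : Fin n → Λ) l = 0
      exact Pi.single_eq_of_ne (Ne.symm h) _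
  let i' : X ⟶ F.obj Q := ∑ k, i k ≫ F.map (a k)
  let p' : F.obj Q ⟶ X := ∑ k, F.map (b k) ≫ p k
  have h1 : i' ≫ p' = 𝟙 X := by
    rw [← hip, Preadditive.sum_comp]
    refine Finset.sum_congr rfl fun k _ => ?_
    rw [Preadditive.comp_sum, Finset.sum_eq_single k]
    · rw [Category.assoc, ← F.map_comp_assoc, hab, if_pos rfl, CategoryTheory.Functor.map_id,
        Category.id_comp]
    · intro l _ hl
      rw [Category.assoc, ← F.map_comp_assoc, hab, if_neg (Ne.symm hl), Functor.map_zero,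
        zero_comp, comp_zero]
    · simp
  obtain ⟨u, hu⟩ := F.map_surjective (p' ≫ e ≫ i')
  have huu : u ≫ u = u := by
    apply F.map_injective
    rw [F.map_comp, hu]
    simp only [Category.assoc, reassoc_of% h1, reassoc_of% he]
  let M : (proj Λ).FullSubcategory := ⟨ModuleCat.of Λ (LinearMap.range u.hom.hom), by
    have hf : Module.Finite Λ (LinearMap.range u.hom.hom) := by
      have : Module.Finite Λ Q.obj := inferInstanceAs (Module.Finite Λ (Fin n → Λ))
      infer_instance
    have hp : Module.Projective Λ (LinearMap.range u.hom.hom) := by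
      have : Module.Projective Λ Q.obj := inferInstanceAs (Module.Projective Λ (Fin n → Λ))
      refine Module.Projective.of_split (LinearMap.range u.hom.hom).subtype
        u.hom.hom.rangeRestrict ?_
      refine LinearMap.ext fun ⟨x, y, hy⟩ => ?_
      subst hy
      exact Subtype.ext (LinearMap.congr_fun (congrArg (fun z => z.hom.hom) huu) y)
    exact ⟨hf, hp⟩⟩
  let c : M ⟶ Q := ObjectProperty.homMk (ModuleCat.ofHom (LinearMap.range u.hom.hom).subtype)
  let r : Q ⟶ M := ObjectProperty.homMk (ModuleCat.ofHom u.hom.hom.rangeRestrict)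
  have hcr : c ≫ r = 𝟙 M := by
    apply (proj Λ).ι.map_injective
    ext ⟨x, y, rfl⟩
    exact Subtype.ext (LinearMap.congr_fun (congrArg (fun z => z.hom.hom) huu) y)
  have hrc : r ≫ c = u := by
    apply (proj Λ).ι.map_injective
    ext x
    rfl
  -- The image of `u` lies in the summand `X` of `Q`, because `u` itself factors through `i'`.
  have hc : F.map c ≫ p' ≫ i' = F.map c := by
    have : F.map c = F.map c ≫ p' ≫ e ≫ i' := by
      rw [← hu, ← F.map_comp, ← hrc, reassoc_of% hcr]
    rw [this]
    simp only [Category.assoc, reassoc_of% h1]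
  refine ⟨F.obj M, F.map c ≫ p', i' ≫ F.map r, ?_, ?_⟩
  · rw [Category.assoc, reassoc_of% hc, ← F.map_comp, hcr, CategoryTheory.Functor.map_id]
  · rw [Category.assoc, ← F.map_comp_assoc, hrc, hu]
    simp only [Category.assoc, h1, reassoc_of% h1, Category.comp_id]

end StalkIdempotents

/-! ### The endomorphism algebra of the generator. -/

section RegularEnd

variable (K : Type v) [Field K] {Λ : Type w} [Ring Λ] [Algebra K Λ]

instance : (stalkFunctor Λ).Linear K where
  map_smul {P Q} f c := by
    apply (perf Λ).ι.map_injective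
    change (HomotopyCategory.quotient _ _).map
      ((HomologicalComplex.single _ (ComplexShape.up ℤ) 0).map (c • f.hom)) =
      c • (HomotopyCategory.quotient _ _).map
      ((HomologicalComplex.single _ (ComplexShape.up ℤ) 0).map f.hom)
    rw [← Functor.map_smul]
    congr 1
    exact ((CochainComplex.singleFunctors (ModuleCat.{w} Λ)).functor 0).map_smul c f.hom

variable (Λ) in
/-- The free module of rank one. -/
def freeOne : (proj Λ).FullSubcategory := ⟨ModuleCat.of Λ Λ, inferInstanceAs (Module.Finite Λ Λ),
    inferInstanceAs (Module.Projective Λ Λ)⟩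

/-- The value at `1` of an endomorphism of `Λ`. -/
def regularEval : (regular Λ ⟶ regular Λ) →ₗ[K] Λ where
  toFun f := ((stalkFunctor Λ).preimage (X := freeOne Λ) (Y := freeOne Λ) f).hom.hom (1 : Λ)
  map_add' f g := by
    obtain ⟨f, rfl⟩ := (stalkFunctor Λ).map_surjective (X := freeOne Λ) (Y := freeOne Λ) f
    obtain ⟨g, rfl⟩ := (stalkFunctor Λ).map_surjective (X := freeOne Λ) (Y := freeOne Λ) g
    have h : (stalkFunctor Λ).preimage (X := freeOne Λ) (Y := freeOne Λ)
        ((stalkFunctor Λ).map f + (stalkFunctor Λ).map g) = f + g :=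
      (stalkFunctor Λ).map_injective (by rw [Functor.map_preimage, Functor.map_add])
    have hf := (stalkFunctor Λ).preimage_map f
    have hg := (stalkFunctor Λ).preimage_map g
    refine (congrArg (fun z : freeOne Λ ⟶ freeOne Λ => z.hom.hom (1 : Λ)) h).trans ?_
    rw [hf, hg]
    rfl
  map_smul' c f := by
    obtain ⟨f, rfl⟩ := (stalkFunctor Λ).map_surjective (X := freeOne Λ) (Y := freeOne Λ) f
    have h : (stalkFunctor Λ).preimage (X := freeOne Λ) (Y := freeOne Λ)
        (c • (stalkFunctor Λ).map f) = c • f :=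
      (stalkFunctor Λ).map_injective (by rw [Functor.map_preimage, Functor.map_smul])
    have hf := (stalkFunctor Λ).preimage_map f
    refine (congrArg (fun z : freeOne Λ ⟶ freeOne Λ => z.hom.hom (1 : Λ)) h).trans ?_
    rw [hf]
    exact (Algebra.smul_def (A := Λ) c (f.hom.hom (1 : Λ))).symm

lemma regularEval_map (f : freeOne Λ ⟶ freeOne Λ) :
    regularEval K ((stalkFunctor Λ).map f) = f.hom.hom (1 : Λ) :=
  congrArg (fun z : freeOne Λ ⟶ freeOne Λ => z.hom.hom (1 : Λ)) ((stalkFunctor Λ).preimage_map f)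

lemma regularEval_injective : Function.Injective (regularEval K (Λ := Λ)) := by
  intro f g h
  obtain ⟨f, rfl⟩ := (stalkFunctor Λ).map_surjective (X := freeOne Λ) (Y := freeOne Λ) f
  obtain ⟨g, rfl⟩ := (stalkFunctor Λ).map_surjective (X := freeOne Λ) (Y := freeOne Λ) g
  rw [regularEval_map, regularEval_map] at h
  congr 1
  apply (proj Λ).ι.map_injective
  apply ModuleCat.hom_ext
  exact LinearMap.ext_ring h

lemma regularEval_surjective : Function.Surjective (regularEval K (Λ := Λ)) := by
  intro a
  refine ⟨(stalkFunctor Λ).map (X := freeOne Λ) (Y := freeOne Λ)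
    (ObjectProperty.homMk (ModuleCat.ofHom (LinearMap.toSpanSingleton Λ Λ a))), ?_⟩
  rw [regularEval_map]
  exact (LinearMap.toSpanSingleton_apply Λ Λ a 1).trans (one_smul _ _)

/-- For left modules `g (f 1) = f 1 * g 1`, so composition in diagrammatic order is the
multiplication of `Λ` and not of its opposite. -/
lemma regularEval_comp (f g : regular Λ ⟶ regular Λ) :
    regularEval K (f ≫ g) = regularEval K f * regularEval K g := by
  obtain ⟨f, rfl⟩ := (stalkFunctor Λ).map_surjective (X := freeOne Λ) (Y := freeOne Λ) f
  obtain ⟨g, rfl⟩ := (stalkFunctor Λ).map_surjective (X := freeOne Λ) (Y := freeOne Λ) g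
  have h : regularEval K ((stalkFunctor Λ).map f ≫ (stalkFunctor Λ).map g) =
      g.hom.hom (f.hom.hom (1 : Λ)) :=
    (congrArg (regularEval K) ((stalkFunctor Λ).map_comp f g).symm).trans (regularEval_map K (f ≫ g))
  refine h.trans ?_
  rw [regularEval_map, regularEval_map]
  have := g.hom.hom.map_smul (f.hom.hom (1 : Λ)) (1 : Λ)
  refine Eq.trans (congrArg _ ?_) this
  exact (mul_one (M := Λ) _).symm

end RegularEnd

section BiproductFin

variable {D : Type u} [Category.{v} D] [Preadditive D] [HasFiniteBiproducts D]
  [HasBinaryBiproducts D]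

lemma nonempty_iso_biproduct_fin_succ {n : ℕ} (F : Fin (n + 1) → D) :
    Nonempty ((⨁ F) ≅ F 0 ⊞ ⨁ fun k : Fin n => F k.succ) := by
  refine nonempty_iso_biprod_of_sum (i := biproduct.ι F 0) (p := biproduct.π F 0)
    (j := biproduct.desc fun k => biproduct.ι F k.succ)
    (q := biproduct.lift fun k => biproduct.π F k.succ) (by simp) ?_ ?_
  · ext j k
    simp only [biproduct.ι_desc_assoc, Category.assoc, biproduct.lift_π, Category.id_comp]
    by_cases h : k = j
    · subst h
      simp
    · rw [biproduct.ι_π_ne _ h, biproduct.ι_π_ne _ (fun h' => h (Fin.succ_injective _ h'))]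
  · rw [biproduct.lift_desc, ← biproduct.total, Fin.sum_univ_succ]

end BiproductFin

/-! ### Brutal truncation and generation by `Λ`. -/

section BrutalTruncation

variable {Λ : Type w} [Ring Λ]

/-- The degreewise submodules defining the part of a complex in degrees `≥ t`. -/
def truncSubmodule (X : CochainComplex (ModuleCat.{w} Λ) ℤ) (t i : ℤ) : Submodule Λ (X.X i) :=
  if t ≤ i then ⊤ else ⊥

lemma truncSubmodule_le_comap (X : CochainComplex (ModuleCat.{w} Λ) ℤ) (t i j : ℤ) :
    truncSubmodule X t i ≤ (truncSubmodule X t j).comap (X.d i j).hom := by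
  by_cases hij : (ComplexShape.up ℤ).Rel i j
  · have : i + 1 = j := hij
    subst this
    unfold truncSubmodule
    split_ifs
    · simp
    · omega
    · simp
    · simp
  · rw [X.shape i j hij]
    intro x _
    exact Submodule.zero_mem _

/-- The subcomplex of terms in degrees `≥ t`. -/
def truncSub (X : CochainComplex (ModuleCat.{w} Λ) ℤ) (t : ℤ) :
    CochainComplex (ModuleCat.{w} Λ) ℤ where
  X i := ModuleCat.of Λ (truncSubmodule X t i)
  d i j := ModuleCat.ofHom ((X.d i j).hom.restrict (truncSubmodule_le_comap X t i j))
  shape i j h := by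
    ext x
    simp [X.shape i j h]
  d_comp_d' i j k _ _ := by
    ext x
    exact LinearMap.congr_fun (congrArg ModuleCat.Hom.hom (X.d_comp_d i j k)) x.1

/-- The quotient complex of terms in degrees `< t`. -/
def truncQuot (X : CochainComplex (ModuleCat.{w} Λ) ℤ) (t : ℤ) :
    CochainComplex (ModuleCat.{w} Λ) ℤ where
  X i := ModuleCat.of Λ (X.X i ⧸ truncSubmodule X t i)
  d i j := ModuleCat.ofHom ((truncSubmodule X t i).mapQ (truncSubmodule X t j) (X.d i j).hom
    (truncSubmodule_le_comap X t i j))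
  shape i j h := by
    ext x
    have : (X.d i j).hom x = 0 := by simp [X.shape i j h]
    exact congrArg (Submodule.Quotient.mk (p := truncSubmodule X t j)) this
  d_comp_d' i j k _ _ := by
    ext x
    have := LinearMap.congr_fun (congrArg ModuleCat.Hom.hom (X.d_comp_d i j k)) x
    exact congrArg (Submodule.Quotient.mk (p := truncSubmodule X t k)) this

/-- The inclusion of the brutal truncation. -/
def truncι (X : CochainComplex (ModuleCat.{w} Λ) ℤ) (t : ℤ) : truncSub X t ⟶ X where
  f i := ModuleCat.ofHom (truncSubmodule X t i).subtype
  comm' _ _ _ := rfl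

/-- The projection onto the brutal truncation. -/
def truncπ (X : CochainComplex (ModuleCat.{w} Λ) ℤ) (t : ℤ) : X ⟶ truncQuot X t where
  f i := ModuleCat.ofHom (truncSubmodule X t i).mkQ
  comm' _ _ _ := rfl

/-- The degreewise split exact sequence of brutal truncations. -/
def truncSequence (X : CochainComplex (ModuleCat.{w} Λ) ℤ) (t : ℤ) :
    ShortComplex (CochainComplex (ModuleCat.{w} Λ) ℤ) :=
  ShortComplex.mk (truncι X t) (truncπ X t) (by
    ext i x
    exact (Submodule.Quotient.mk_eq_zero _).2 x.2)

lemma truncSequence_shortExact (X : CochainComplex (ModuleCat.{w} Λ) ℤ) (t i : ℤ) :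
    ((truncSequence X t).map (HomologicalComplex.eval _ _ i)).ShortExact where
  exact := by
    rw [ShortComplex.moduleCat_exact_iff]
    intro x hx
    exact ⟨⟨x, (Submodule.Quotient.mk_eq_zero _).1 hx⟩, rfl⟩
  mono_f := (ModuleCat.mono_iff_injective _).2 (truncSubmodule X t i).injective_subtype
  epi_g := (ModuleCat.epi_iff_surjective _).2 (truncSubmodule X t i).mkQ_surjective

lemma truncSub_isZero_X (X : CochainComplex (ModuleCat.{w} Λ) ℤ) {t i : ℤ} (h : i < t) :
    IsZero ((truncSub X t).X i) := by
  have : truncSubmodule X t i = ⊥ := if_neg (not_le.2 h)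
  have : Subsingleton (truncSubmodule X t i) := by rw [this]; infer_instance
  exact ModuleCat.isZero_of_subsingleton (ModuleCat.of Λ (truncSubmodule X t i))

lemma truncQuot_isZero_X (X : CochainComplex (ModuleCat.{w} Λ) ℤ) {t i : ℤ} (h : t ≤ i) :
    IsZero ((truncQuot X t).X i) := by
  have : truncSubmodule X t i = ⊤ := if_pos h
  have : Subsingleton (X.X i ⧸ truncSubmodule X t i) := by
    rw [this]
    infer_instance
  exact ModuleCat.isZero_of_subsingleton (ModuleCat.of Λ (X.X i ⧸ truncSubmodule X t i))

/-- In degrees `≥ t` the brutal truncation agrees with the complex. -/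
def truncSubXIso (X : CochainComplex (ModuleCat.{w} Λ) ℤ) {t i : ℤ} (h : t ≤ i) :
    (truncSub X t).X i ≅ X.X i :=
  (LinearEquiv.ofTop (truncSubmodule X t i) (if_pos h)).toModuleIso

/-- In degrees `< t` the brutal truncation agrees with the complex. -/
def truncQuotXIso (X : CochainComplex (ModuleCat.{w} Λ) ℤ) {t i : ℤ} (h : i < t) :
    (truncQuot X t).X i ≅ X.X i :=
  (Submodule.quotEquivOfEqBot (truncSubmodule X t i) (if_neg (not_le.2 h))).toModuleIso

lemma isZero_truncSub_of_isZero {X : CochainComplex (ModuleCat.{w} Λ) ℤ} {t i : ℤ}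
    (h : IsZero (X.X i)) : IsZero ((truncSub X t).X i) := by
  by_cases hi : t ≤ i
  · exact h.of_iso (truncSubXIso X hi)
  · exact truncSub_isZero_X X (not_le.1 hi)

lemma isZero_truncQuot_of_isZero {X : CochainComplex (ModuleCat.{w} Λ) ℤ} {t i : ℤ}
    (h : IsZero (X.X i)) : IsZero ((truncQuot X t).X i) := by
  by_cases hi : t ≤ i
  · exact truncQuot_isZero_X X hi
  · exact h.of_iso (truncQuotXIso X (not_le.1 hi))

lemma perfComplex_truncSub {X : CochainComplex (ModuleCat.{w} Λ) ℤ} (hX : perfComplex Λ X)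
    (t : ℤ) : perfComplex Λ (truncSub X t) := by
  obtain ⟨h1, N, h2⟩ := hX
  refine ⟨fun i => ?_, N, fun i hi => isZero_truncSub_of_isZero (h2 i hi)⟩
  by_cases hi : t ≤ i
  · exact proj_of_iso (truncSubXIso X hi).symm (h1 i)
  · exact proj_of_isZero (truncSub_isZero_X X (not_le.1 hi))

lemma perfComplex_truncQuot {X : CochainComplex (ModuleCat.{w} Λ) ℤ} (hX : perfComplex Λ X)
    (t : ℤ) : perfComplex Λ (truncQuot X t) := by
  obtain ⟨h1, N, h2⟩ := hX
  refine ⟨fun i => ?_, N, fun i hi => isZero_truncQuot_of_isZero (h2 i hi)⟩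
  by_cases hi : t ≤ i
  · exact proj_of_isZero (truncQuot_isZero_X X hi)
  · exact proj_of_iso (truncQuotXIso X (not_le.1 hi)).symm (h1 i)

/-- A bounded complex of finitely generated projective modules as an object of `K^b(proj Λ)`. -/
def ofComplex (X : CochainComplex (ModuleCat.{w} Λ) ℤ) (hX : perfComplex Λ X) : KbProj Λ :=
  ⟨(HomotopyCategory.quotient _ _).obj X, hX⟩

/-- Projectivity of the quotient terms splits the sequence degreewise, so it gives a triangle in the
full homotopy category. Its third term is compared there with the cone formed in `KbProj`. -/
lemma exists_truncation_triangle {X : CochainComplex (ModuleCat.{w} Λ) ℤ} (hX : perfComplex Λ X)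
    (t : ℤ) : ∃ T ∈ distTriang (KbProj Λ), T.obj₁ = ofComplex _ (perfComplex_truncSub hX t) ∧
      T.obj₂ = ofComplex X hX ∧ Nonempty (T.obj₃ ≅ ofComplex _ (perfComplex_truncQuot hX t)) := by
  have hp : ∀ i, Projective ((truncQuot X t).X i) := fun i => by
    have := ((perfComplex_truncQuot hX t).1 i).2
    infer_instance
  have σ : ∀ i, ((truncSequence X t).map (HomologicalComplex.eval _ _ i)).Splitting := fun i =>
    have : Projective ((truncSequence X t).map (HomologicalComplex.eval _ _ i)).X₃ := hp i
    (truncSequence_shortExact X t i).splittingOfProjective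
  have hT : CochainComplex.trianglehOfDegreewiseSplit (truncSequence X t) σ ∈
      distTriang (HomotopyCategory (ModuleCat.{w} Λ) (ComplexShape.up ℤ)) := by
    rw [HomotopyCategory.distinguished_iff_iso_trianglehOfDegreewiseSplit]
    exact ⟨_, σ, ⟨Iso.refl _⟩⟩
  let f : ofComplex _ (perfComplex_truncSub hX t) ⟶ ofComplex X hX :=
    ObjectProperty.homMk ((HomotopyCategory.quotient _ _).map (truncι X t))
  obtain ⟨Z, g, h, hZ⟩ := Pretriangulated.distinguished_cocone_triangle f
  refine ⟨_, hZ, rfl, rfl, ⟨(perf Λ).fullyFaithfulι.preimageIso ?_⟩⟩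
  exact Triangle.π₃.mapIso (isoTriangleOfIso₁₂ _ _ ((perf Λ).ι.map_distinguished _ hZ) hT
    (Iso.refl _) (Iso.refl _) ((Category.comp_id _).trans (Category.id_comp _).symm))

/-- The stalk complex of a complex concentrated in degree `m`. -/
lemma nonempty_iso_stalk {X : CochainComplex (ModuleCat.{w} Λ) ℤ} (hX : perfComplex Λ X) {m : ℤ}
    (h : ∀ i, i ≠ m → IsZero (X.X i)) : ∃ (P : ModuleCat.{w} Λ) (_ : Module.Finite Λ P)
      (_ : Module.Projective Λ P),
      Nonempty ((shiftFunctor (KbProj Λ) m).obj (ofComplex X hX) ≅ stalk P) := by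
  let Y := (shiftFunctor (CochainComplex (ModuleCat.{w} Λ) ℤ) m).obj X
  have hY : ∀ i, i ≠ 0 → IsZero (Y.X i) := fun i hi => h (i + m) (by omega)
  have h1 : Module.Finite Λ (Y.X 0) := (hX.1 (0 + m)).1
  have h2 : Module.Projective Λ (Y.X 0) := (hX.1 (0 + m)).2
  refine ⟨Y.X 0, h1, h2, ⟨(perf Λ).fullyFaithfulι.preimageIso (shiftObjIso _ _ ≪≫
    (HomotopyCategory.quotient _ _).mapIso ?_)⟩⟩
  let φ : Y ⟶ (HomologicalComplex.single (ModuleCat.{w} Λ) (ComplexShape.up ℤ) 0).obj (Y.X 0) :=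
    HomologicalComplex.mkHomToSingle (𝟙 _) (fun i hi =>
      (hY i (by simp at hi; omega)).eq_of_src _ _)
  have : ∀ i, IsIso (φ.f i) := fun i => by
    by_cases hi : i = 0
    · subst hi
      rw [HomologicalComplex.mkHomToSingle_f]
      infer_instance
    · exact isIso_of_source_target_iso_zero _ (hY i hi).isoZero
        (HomologicalComplex.isZero_single_obj_X _ _ _ _ hi).isoZero
  exact HomologicalComplex.Hom.isoOfComponents (fun i => @asIso _ _ _ _ (φ.f i) (this i)) fun i j _ => φ.comm i j

/-- `Λ` generates `K^b(proj Λ)` as a thick subcategory. -/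
lemma thickGenerates_regular : ThickGenerates (regular Λ) := by
  intro Q hQ hQ' hR
  have : Q.IsClosedUnderIsomorphisms := ⟨fun e h => Q.prop_of_retract e.symm.retract h⟩
  have hsum : ∀ n : ℕ, Q (⨁ fun _ : Fin n => regular Λ) := by
    intro n
    induction n with
    | zero =>
      refine Q.prop_of_isZero ?_
      rw [IsZero.iff_id_eq_zero]
      ext j
      exact j.elim0
    | succ n ih =>
      obtain ⟨e⟩ := nonempty_iso_biproduct_fin_succ (fun _ : Fin (n + 1) => regular Λ)
      exact Q.prop_of_iso e.symm
        (Q.ext_of_isTriangulatedClosed₂ _ (binaryBiproductTriangle_distinguished _ _) hR ih)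
  have hadd : ∀ Y, addHull (regular Λ) Y → Q Y := by
    rintro Y ⟨n, ⟨r⟩⟩
    exact Q.prop_of_retract r (hsum n)
  -- Induction on the length of the window `[m, m + k)` that supports the complex: the lowest term
  -- is split off as a shifted stalk.
  have key : ∀ (k : ℕ) (m : ℤ) (X : CochainComplex (ModuleCat.{w} Λ) ℤ) (hX : perfComplex Λ X),
      (∀ i, ¬ (m ≤ i ∧ i < m + k) → IsZero (X.X i)) → Q (ofComplex X hX) := by
    intro k
    induction k with
    | zero =>
      intro m X hX h
      refine Q.prop_of_isZero ?_
      have : IsZero X := by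
        rw [IsZero.iff_id_eq_zero]
        ext1 i
        exact (h i (by simp)).eq_of_src _ _
      have := (HomotopyCategory.quotient _ _).map_isZero this
      rw [IsZero.iff_id_eq_zero] at this ⊢
      exact (perf Λ).ι.map_injective this
    | succ k ih =>
      intro m X hX h
      obtain ⟨T, hT, h1, h2, ⟨e⟩⟩ := exists_truncation_triangle hX (m + 1)
      rw [← h2]
      refine Q.ext_of_isTriangulatedClosed₂ T hT ?_ ?_
      · rw [h1]
        refine ih (m + 1) _ _ fun i hi => ?_
        by_cases hm : i < m + 1
        · exact truncSub_isZero_X X hm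
        · exact isZero_truncSub_of_isZero (h i (by push_cast; omega))
      · refine Q.prop_of_iso e.symm ?_
        obtain ⟨P, hf, hp, ⟨e'⟩⟩ := nonempty_iso_stalk (perfComplex_truncQuot hX (m + 1)) (m := m)
          (fun i hi => by
            by_cases hm : m + 1 ≤ i
            · exact truncQuot_isZero_X X hm
            · exact isZero_truncQuot_of_isZero (h i (by push_cast; omega)))
        have h3 : Q ((shiftFunctor (KbProj Λ) m).obj (ofComplex _ _)) :=
          Q.prop_of_iso e'.symm (hadd _ (addHull_regular_stalk P))
        exact Q.prop_of_iso (shiftShiftNeg _ m) (Q.le_shift (-m) _ h3)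
  intro X
  obtain ⟨N, hN⟩ := X.property.2
  refine key (2 * N.toNat + 1) (-N.toNat) X.obj.as X.property fun i hi => hN i ?_
  by_contra h'
  rw [not_lt, abs_le] at h'
  exact hi ⟨by omega, by omega⟩

end BrutalTruncation

/-! ### Finite dimensional algebras without idempotents -/

/-- Fitting's lemma for left multiplication by `a`: `A = ker aⁿ ⊕ aⁿA`, and the component of `1` in
`aⁿA` is idempotent. If it is `0` then `aⁿ = 0`; if it is `1` then `a` has a right inverse. -/
lemma isUnit_or_isNilpotent_of_idem (K : Type*) {A : Type*} [Field K] [Ring A] [Algebra K A]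
    [FiniteDimensional K A] (h : ∀ e : A, e * e = e → e = 0 ∨ e = 1) (a : A) :
    IsUnit a ∨ IsNilpotent a := by
  -- The requirement `n ≥ 1` allows a factor `a` to be pulled out of `aⁿ` at the end.
  obtain ⟨n, hn, hn1⟩ := ((LinearMap.eventually_isCompl_ker_pow_range_pow
    (LinearMap.mulLeft K a)).and (Filter.eventually_ge_atTop 1)).exists
  rw [LinearMap.pow_mulLeft] at hn
  obtain ⟨e', he', e, ⟨b, rfl⟩, he⟩ := Submodule.mem_sup.1
    (hn.sup_eq_top.ge (Submodule.mem_top : (1 : A) ∈ ⊤))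
  rw [LinearMap.mem_ker, LinearMap.mulLeft_apply] at he'
  rw [LinearMap.mulLeft_apply] at he
  have h1 : a ^ n * b - a ^ n * b * (a ^ n * b) = e' * (a ^ n * b) := by
    rw [← eq_sub_iff_add_eq] at he
    rw [he]
    noncomm_ring
  -- The defect from idempotency lies both in the kernel and in the range.
  have h2 : a ^ n * b - a ^ n * b * (a ^ n * b) = 0 := by
    refine (Submodule.disjoint_def.1 hn.disjoint) _ ?_ ?_
    · rw [h1, LinearMap.mem_ker, LinearMap.mulLeft_apply, ← mul_assoc, he', zero_mul]
    · exact ⟨b - b * (a ^ n * b), by rw [LinearMap.mulLeft_apply]; noncomm_ring⟩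
  rcases h _ (sub_eq_zero.1 h2).symm with h3 | h3
  · right
    refine ⟨n, ?_⟩
    rw [h3, add_zero] at he
    rwa [he, mul_one] at he'
  · left
    obtain ⟨m, rfl⟩ : ∃ m, n = m + 1 := ⟨n - 1, by omega⟩
    have : IsArtinianRing A := IsArtinianRing.of_finite K A
    rw [pow_succ', mul_assoc] at h3
    exact IsUnit.of_mul_eq_one _ h3

/-! ### Symmetric generators -/

section Generator

variable {C : Type u} [Category.{v} C] [Preadditive C] [HasZeroObject C] [HasShift C ℤ]
  [∀ n : ℤ, (shiftFunctor C n).Additive] [Pretriangulated C]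

/-- A generator without self-extensions whose endomorphism algebra is a symmetric algebra of
radical cube zero. -/
structure SymmetricGenerator (K : Type*) [Field K] [Linear K C] (Λ : Type*) [Ring Λ] [Algebra K Λ]
    (R : C) where
  homVanishes : ∀ n : ℤ, n ≠ 0 → HomVanishes R R n
  thick : ThickGenerates R
  splits : ∀ X : C, addHull R X → ∀ e : X ⟶ X, e ≫ e = e → SplitsIdem e
  eval : (R ⟶ R) →ₗ[K] Λ
  eval_injective : Function.Injective eval
  eval_surjective : Function.Surjective eval
  eval_comp : ∀ f g : R ⟶ R, eval (f ≫ g) = eval f * eval g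
  form : Λ →ₗ[K] K
  form_comm : ∀ a b : Λ, form (a * b) = form (b * a)
  form_nondegenerate : ∀ a : Λ, (∀ b : Λ, form (a * b) = 0) → a = 0
  jacobson_cube : Ring.jacobson Λ ^ 3 = ⊥

lemma eq_zero_of_generator_comp {R X Y : C} (hX : addHull R X) {f : X ⟶ Y}
    (h : ∀ α : R ⟶ X, α ≫ f = 0) : f = 0 := by
  obtain ⟨n, i, p, hip⟩ := addHull_iff_exists_sum.1 hX
  rw [← Category.id_comp f, ← hip, Preadditive.sum_comp]
  exact Finset.sum_eq_zero fun k _ => by rw [Category.assoc, h, comp_zero]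

lemma eq_zero_of_comp_generator {R X Y : C} (hY : addHull R Y) {f : X ⟶ Y}
    (h : ∀ β : Y ⟶ R, f ≫ β = 0) : f = 0 := by
  obtain ⟨n, i, p, hip⟩ := addHull_iff_exists_sum.1 hY
  rw [← Category.comp_id f, ← hip, Preadditive.comp_sum]
  exact Finset.sum_eq_zero fun k _ => by rw [← Category.assoc, h, zero_comp]

variable {K : Type*} [Field K] [Linear K C]
  {Λ : Type*} [Ring Λ] [Algebra K Λ] {R : C} (S : SymmetricGenerator K Λ R)

namespace SymmetricGenerator

include S in
lemma isSilting : IsSilting R :=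
  ⟨fun n hn => S.homVanishes n hn.ne', S.thick⟩

/-- The radical morphisms. -/
def rad (X Y : C) : Submodule K (X ⟶ Y) where
  carrier := {f | ∀ (α : R ⟶ X) (β : Y ⟶ R), S.eval (α ≫ f ≫ β) ∈ Ring.jacobson Λ}
  zero_mem' α β := by simp
  add_mem' {f g} hf hg α β := by
    rw [Preadditive.add_comp, Preadditive.comp_add, map_add]
    exact add_mem (hf α β) (hg α β)
  smul_mem' c f hf α β := by
    rw [Linear.smul_comp, Linear.comp_smul, map_smul, Algebra.smul_def]
    exact Ideal.mul_mem_left _ _ (hf α β)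

lemma rad_comp {X Y Z : C} {f : X ⟶ Y} (hf : f ∈ S.rad X Y) (g : Y ⟶ Z) : f ≫ g ∈ S.rad X Z :=
  fun α β => by simpa using hf α (g ≫ β)

lemma comp_rad {X Y Z : C} (f : X ⟶ Y) {g : Y ⟶ Z} (hg : g ∈ S.rad Y Z) : f ≫ g ∈ S.rad X Z :=
  fun α β => by simpa using hg (α ≫ f) β

/-- The hypothesis `J³ = 0` enters here: tested between copies of `R`, and with the identities of
`Y` and `Z` expanded through `R`, the composite becomes a sum of products of three elements of the
Jacobson radical. -/
lemma rad_comp_rad_comp_rad {X Y Z W : C} {f : X ⟶ Y} {g : Y ⟶ Z} {h : Z ⟶ W}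
    (hX : addHull R X) (hY : addHull R Y) (hZ : addHull R Z) (hW : addHull R W)
    (hf : f ∈ S.rad X Y) (hg : g ∈ S.rad Y Z) (hh : h ∈ S.rad Z W) : f ≫ g ≫ h = 0 := by
  refine eq_zero_of_generator_comp hX fun α => eq_zero_of_comp_generator hW fun β => ?_
  obtain ⟨n, i, p, hip⟩ := addHull_iff_exists_sum.1 hY
  obtain ⟨m, j, q, hjq⟩ := addHull_iff_exists_sum.1 hZ
  have : (α ≫ f ≫ g ≫ h) ≫ β =
      ∑ k, ∑ l, (α ≫ f ≫ i k) ≫ (p k ≫ g ≫ j l) ≫ (q l ≫ h ≫ β) := by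
    calc (α ≫ f ≫ g ≫ h) ≫ β
        = α ≫ f ≫ (∑ k, i k ≫ p k) ≫ g ≫ (∑ l, j l ≫ q l) ≫ h ≫ β := by
          rw [hip, hjq]; simp
      _ = _ := by
          simp only [Preadditive.sum_comp, Preadditive.comp_sum, Category.assoc]
          rw [Finset.sum_comm]
  rw [this]
  refine Finset.sum_eq_zero fun k _ => Finset.sum_eq_zero fun l _ => S.eval_injective ?_
  rw [S.eval_comp, S.eval_comp, map_zero, ← mul_assoc]
  have := Ideal.mul_mem_mul (Ideal.mul_mem_mul (hf α (i k)) (hg (p k) (j l))) (hh (q l) β)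
  have h3 : Ring.jacobson Λ * Ring.jacobson Λ * Ring.jacobson Λ = ⊥ := by
    rw [← S.jacobson_cube, Submodule.pow_succ, Submodule.pow_succ, Submodule.pow_one]
  rwa [h3] at this

/-- A truncated geometric series: with `n = 𝟙 - f` and `n³ = 0`, the inverse of `f` is `𝟙 + n + n²`.
-/
lemma isIso_of_rad {X : C} (hX : addHull R X) {f : X ⟶ X} (hf : 𝟙 X - f ∈ S.rad X X) :
    IsIso f := by
  set n := 𝟙 X - f with hn
  have hf' : f = 𝟙 X - n := by rw [hn]; abel
  have h3 : n ≫ n ≫ n = 0 := S.rad_comp_rad_comp_rad hX hX hX hX hf hf hf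
  refine ⟨𝟙 X + n + n ≫ n, ?_, ?_⟩
  · rw [hf']
    simp only [Preadditive.sub_comp, Preadditive.comp_add, Category.id_comp, Category.comp_id, h3]
    abel
  · rw [hf']
    simp only [Preadditive.comp_sub, Preadditive.add_comp, Category.id_comp, Category.comp_id,
      Category.assoc, h3]
    abel

/-- Nondegeneracy on `Λ` passes to all `Hom` spaces in the additive hull, as the test element of `Λ`
is absorbed into `β`. -/
lemma exists_form_ne_zero {X Y : C} (hX : addHull R X) (hY : addHull R Y) {f : X ⟶ Y}
    (hf : f ≠ 0) : ∃ (α : R ⟶ X) (β : Y ⟶ R), S.form (S.eval (α ≫ f ≫ β)) ≠ 0 := by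
  by_contra! h
  refine hf (eq_zero_of_generator_comp hX fun α => eq_zero_of_comp_generator hY fun β => ?_)
  apply S.eval_injective
  rw [map_zero]
  refine S.form_nondegenerate _ fun b => ?_
  obtain ⟨γ, rfl⟩ := S.eval_surjective b
  rw [← S.eval_comp]
  simpa using h α (β ≫ γ)

/-- The trace form on endomorphisms, with respect to a decomposition of the identity. -/
lemma exists_trace {X : C} (hX : addHull R X) : ∃ tr : (X ⟶ X) →ₗ[K] K,
    ∀ (α : R ⟶ X) (β : X ⟶ R), tr (β ≫ α) = S.form (S.eval (α ≫ β)) := by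
  obtain ⟨n, i, p, hip⟩ := addHull_iff_exists_sum.1 hX
  refine ⟨∑ k, S.form ∘ₗ S.eval ∘ₗ Linear.leftComp K R (p k) ∘ₗ Linear.rightComp K X (i k),
    fun α β => ?_⟩
  -- Symmetry of the form turns the products around, after which the decomposition of `𝟙 X` can be
  -- summed up again.
  have h1 : ∀ k, S.form (S.eval (p k ≫ (β ≫ α) ≫ i k)) =
      S.form (S.eval (α ≫ (i k ≫ p k) ≫ β)) := fun k => by
    have h2 : p k ≫ (β ≫ α) ≫ i k = (p k ≫ β) ≫ (α ≫ i k) := by simp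
    have h3 : α ≫ (i k ≫ p k) ≫ β = (α ≫ i k) ≫ (p k ≫ β) := by simp
    rw [h2, h3, S.eval_comp, S.eval_comp, S.form_comm]
  simp only [LinearMap.sum_apply, LinearMap.comp_apply, Linear.leftComp_apply,
    Linear.rightComp_apply, h1]
  rw [← map_sum, ← map_sum, ← Preadditive.comp_sum, ← Preadditive.sum_comp, hip, Category.id_comp]

/-- Products of two radical morphisms vanish between objects without common summands. -/
lemma rad_comp_rad_eq_zero {X Y Z : C} {f : X ⟶ Y} {g : Y ⟶ Z} (hX : addHull R X)
    (hY : addHull R Y) (hZ : addHull R Z) (h : ∀ k : Z ⟶ X, k ∈ S.rad Z X)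
    (hf : f ∈ S.rad X Y) (hg : g ∈ S.rad Y Z) : f ≫ g = 0 := by
  by_contra h0
  obtain ⟨α, β, hαβ⟩ := S.exists_form_ne_zero hX hZ h0
  obtain ⟨tr, htr⟩ := S.exists_trace hX
  -- Closing up by `β ≫ α : Z ⟶ X`, radical by hypothesis, gives a triple product of radical maps.
  -- Its trace is the value of the form that was assumed nonzero.
  have h1 := S.rad_comp_rad_comp_rad hX hY hZ hX hf hg (h (β ≫ α))
  have h2 := htr α ((f ≫ g) ≫ β)
  simp only [Category.assoc] at h1 h2 hαβ
  rw [h1, map_zero] at h2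
  exact hαβ h2.symm

variable [∀ X Y : C, Module.Finite K (X ⟶ Y)]

include S in
-- The trace pairing `(f, g) ↦ tr (f ≫ g)` embeds `Hom(X, Y)` into the dual of `Hom(Y, X)`.
lemma finrank_hom_le {X Y : C} (hX : addHull R X) (hY : addHull R Y) :
    Module.finrank K (X ⟶ Y) ≤ Module.finrank K (Y ⟶ X) := by
  obtain ⟨tr, htr⟩ := S.exists_trace hX
  let Φ : (X ⟶ Y) →ₗ[K] Module.Dual K (Y ⟶ X) :=
    LinearMap.mk₂ K (fun f g => tr (f ≫ g)) (by simp) (by simp) (by simp) (by simp)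
  have hΦ : Function.Injective Φ := by
    rw [injective_iff_map_eq_zero]
    intro f hf
    by_contra h0
    obtain ⟨α, β, h⟩ := S.exists_form_ne_zero hX hY h0
    apply h
    have := LinearMap.congr_fun hf (β ≫ α)
    rw [LinearMap.mk₂_apply, ← Category.assoc, htr] at this
    exact this
  exact (LinearMap.finrank_le_finrank_of_injective hΦ).trans
    (Subspace.dual_finrank_eq (K := K) (V := (Y ⟶ X))).le

include S in
lemma isIso_or_nilpotent {X : C} (hX : addHull R X) (hX' : Indecomposable X) (f : X ⟶ X) :
    IsIso f ∨ ∃ n : ℕ, (End.of f : End X) ^ n = 0 := by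
  have : FiniteDimensional K (End X) := inferInstanceAs (Module.Finite K (X ⟶ X))
  rcases isUnit_or_isNilpotent_of_idem K (A := End X) (fun (e : X ⟶ X) he =>
    idem_eq_zero_or_id_of_indecomposable hX' (S.splits X hX e he)
      (S.splits X hX _ (by
        have he' : e ≫ e = e := he
        change (𝟙 X - e) ≫ (𝟙 X - e) = 𝟙 X - e
        simp [he']))) (End.of f) with h | h
  · exact Or.inl ((isUnit_iff_isIso _).1 h)
  · exact Or.inr h

include S in
-- Here `f` is a split monomorphism, and the associated idempotent of the indecomposable `Y` is `0`
-- or `𝟙`; the value `0` would force `X` to be zero.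
lemma isIso_of_comp_isIso {X Y : C} (hX' : Indecomposable X) (hY : addHull R Y)
    (hY' : Indecomposable Y) {f : X ⟶ Y} {g : Y ⟶ X} (h : IsIso (f ≫ g)) : IsIso f := by
  have h1 : f ≫ g ≫ inv (f ≫ g) = 𝟙 X := by
    rw [← Category.assoc, IsIso.hom_inv_id]
  have he : (g ≫ inv (f ≫ g) ≫ f) ≫ (g ≫ inv (f ≫ g) ≫ f) = g ≫ inv (f ≫ g) ≫ f := by
    simp only [Category.assoc, reassoc_of% h1]
  rcases idem_eq_zero_or_id_of_indecomposable hY' (S.splits Y hY _ he)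
    (S.splits Y hY _ (by simp only [Preadditive.sub_comp, Preadditive.comp_sub, he]; simp))
      with h2 | h2
  · exfalso
    apply hX'.1
    rw [IsZero.iff_id_eq_zero]
    have h3 : f = 0 := by
      calc f = f ≫ (g ≫ inv (f ≫ g) ≫ f) := by simp only [reassoc_of% h1]
        _ = 0 := by rw [h2, comp_zero]
    rw [← h1]
    simp only [h3, zero_comp]
  · exact ⟨g ≫ inv (f ≫ g), h1, by simpa using h2⟩

/-- Transfers nilpotency of an endomorphism `w ≫ u` of `X` to the element of `Λ` given by `u ≫ w`.
-/
lemma eval_pow {X : C} (u : R ⟶ X) (w : X ⟶ R) (n : ℕ) :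
    S.eval (u ≫ w) ^ (n + 1) = S.eval (u ≫ (End.of (w ≫ u) ^ n : End X) ≫ w) := by
  induction n with
  | zero => simp [End.one_def]
  | succ n ih =>
    rw [pow_succ, ih, pow_succ', End.mul_def, ← S.eval_comp]
    simp [End.of]

/-- The endomorphism `f ≫ β ≫ γ ≫ α` of `X` is nilpotent, for otherwise it is invertible and `f` is
an isomorphism. So the corresponding element of `Λ` is nilpotent and `1` plus it is a unit, which is
the test for the Jacobson radical. -/
lemma mem_rad_of_not_isIso {X Y : C} (hX : addHull R X) (hX' : Indecomposable X)
    (hY : addHull R Y) (hY' : Indecomposable Y) {f : X ⟶ Y} (hf : ¬ IsIso f) : f ∈ S.rad X Y := by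
  intro α β
  rw [← Ideal.jacobson_bot, Ideal.mem_jacobson_iff]
  intro b
  obtain ⟨γ, rfl⟩ := S.eval_surjective b
  have hnil : IsNilpotent (S.eval (γ ≫ α ≫ f ≫ β)) := by
    rcases S.isIso_or_nilpotent hX hX' ((f ≫ β) ≫ (γ ≫ α)) with h | ⟨n, h⟩
    · refine absurd (S.isIso_of_comp_isIso hX' hY hY' (g := β ≫ γ ≫ α) ?_) hf
      simpa using h
    · refine ⟨n + 1, ?_⟩
      have := S.eval_pow (γ ≫ α) (f ≫ β) n
      rw [h] at this
      rw [show γ ≫ α ≫ f ≫ β = (γ ≫ α) ≫ f ≫ β by simp, this]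
      exact (congrArg S.eval (by rw [show ((0 : End X) ≫ f ≫ β) = 0 from zero_comp]; exact comp_zero)).trans
        (map_zero _)
  obtain ⟨u, hu⟩ := hnil.isUnit_one_add
  refine ⟨(↑u⁻¹ : Λ), ?_⟩
  have h1 : (↑u⁻¹ : Λ) * (1 + S.eval (γ ≫ α ≫ f ≫ β)) = 1 := by rw [← hu]; exact u.inv_mul
  rw [mul_assoc, ← S.eval_comp]
  rw [mul_add, mul_one] at h1
  rw [add_comm, h1]
  simp

lemma not_isIso_of_mem_rad {X Y : C} (hX : addHull R X) (hX' : ¬ IsZero X) {f : X ⟶ Y}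
    (hf : f ∈ S.rad X Y) : ¬ IsIso f := by
  intro h
  apply hX'
  rw [IsZero.iff_id_eq_zero]
  have h1 : 𝟙 X ∈ S.rad X X := by
    rw [← IsIso.hom_inv_id f]
    exact S.rad_comp hf _
  have := S.rad_comp_rad_comp_rad hX hX hX hX h1 h1 h1
  simpa using this

/-- Algebraic closedness enters here: for `c` in the spectrum of `f`, the difference `f - c • 𝟙 X`
is not invertible, hence radical. -/
lemma exists_scalar [IsAlgClosed K] {X : C} (hX : addHull R X) (hX' : Indecomposable X)
    (f : X ⟶ X) : ∃ c : K, f - c • 𝟙 X ∈ S.rad X X := by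
  have : FiniteDimensional K (End X) := inferInstanceAs (Module.Finite K (X ⟶ X))
  have : Nontrivial (End X) := ⟨⟨𝟙 X, 0, fun h => hX'.1 ((IsZero.iff_id_eq_zero _).2 h)⟩⟩
  obtain ⟨c, hc⟩ := spectrum.nonempty_of_isAlgClosed_of_finiteDimensional K (End.of f)
  refine ⟨c, S.mem_rad_of_not_isIso hX hX' hX hX' fun h => hc ?_⟩
  rw [spectrum.mem_resolventSet_iff, isUnit_iff_isIso]
  have h1 : (algebraMap K (End X) c - End.of f : End X) = -(f - c • 𝟙 X) := by
    rw [Algebra.algebraMap_eq_smul_one]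
    exact (neg_sub _ _).symm
  rw [h1]
  generalize f - c • 𝟙 X = g at h
  exact ⟨-inv g, by simp, by simp⟩

end SymmetricGenerator

end Generator

/-! ### Matrix components of maps between direct sums. -/

section Biproducts

variable {D : Type u} [Category.{v} D] [Preadditive D] [HasFiniteBiproducts D]

lemma components_comp {I J L : Type} [Fintype I] [Fintype J] [Fintype L] {F : I → D} {G : J → D}
    {H : L → D} (f : (⨁ F) ⟶ ⨁ G) (g : (⨁ G) ⟶ ⨁ H) (i : I) (l : L) :
    biproduct.components (f ≫ g) i l =
      ∑ j, biproduct.components f i j ≫ biproduct.components g j l := by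
  have : f ≫ g = f ≫ (∑ j, biproduct.π G j ≫ biproduct.ι G j) ≫ g := by simp
  unfold biproduct.components
  rw [this, Preadditive.sum_comp, Preadditive.comp_sum, Preadditive.sum_comp, Preadditive.comp_sum]
  simp

lemma components_add {I J : Type} [Fintype I] [Fintype J] {F : I → D} {G : J → D}
    (f g : (⨁ F) ⟶ ⨁ G) (i : I) (j : J) : biproduct.components (f + g) i j =
      biproduct.components f i j + biproduct.components g i j := by
  simp [biproduct.components]

lemma components_sub {I J : Type} [Fintype I] [Fintype J] {F : I → D} {G : J → D}
    (f g : (⨁ F) ⟶ ⨁ G) (i : I) (j : J) : biproduct.components (f - g) i j =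
      biproduct.components f i j - biproduct.components g i j := by
  simp [biproduct.components]

lemma components_ext {I J : Type} [Fintype I] [Fintype J] {F : I → D} {G : J → D}
    {f g : (⨁ F) ⟶ ⨁ G}
    (h : ∀ i j, biproduct.components f i j = biproduct.components g i j) : f = g := by
  rw [← biproduct.components_matrix f, ← biproduct.components_matrix g]
  congr 1
  funext i j
  exact h i j

lemma eq_sum_components {I J : Type} [Fintype I] [Fintype J] {F : I → D} {G : J → D}
    (f : (⨁ F) ⟶ ⨁ G) :
    f = ∑ i, ∑ j, biproduct.π F i ≫ biproduct.components f i j ≫ biproduct.ι G j := by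
  have h : ∀ i j, biproduct.π F i ≫ biproduct.components f i j ≫ biproduct.ι G j =
      (biproduct.π F i ≫ biproduct.ι F i) ≫ f ≫ (biproduct.π G j ≫ biproduct.ι G j) := by
    intro i j
    simp [biproduct.components]
  simp only [h, ← Preadditive.comp_sum, ← Preadditive.sum_comp, biproduct.total, Category.comp_id,
    Category.id_comp]

lemma nonempty_iso_biproduct_sum [HasBinaryBiproducts D] {I J : Type} [Fintype I] [Fintype J]
    (F : I ⊕ J → D) :
    Nonempty ((⨁ F) ≅ (⨁ fun k => F (Sum.inl k)) ⊞ ⨁ fun k => F (Sum.inr k)) := by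
  refine nonempty_iso_biprod_of_sum
    (i := biproduct.desc fun k => biproduct.ι F (Sum.inl k))
    (p := biproduct.lift fun k => biproduct.π F (Sum.inl k))
    (j := biproduct.desc fun k => biproduct.ι F (Sum.inr k))
    (q := biproduct.lift fun k => biproduct.π F (Sum.inr k)) ?_ ?_ ?_
  · ext j k
    simp only [biproduct.ι_desc_assoc, Category.assoc, biproduct.lift_π, Category.id_comp]
    by_cases h : k = j
    · subst h
      simp
    · rw [biproduct.ι_π_ne _ h, biproduct.ι_π_ne _ (fun h' => h (Sum.inl_injective h'))]
  · ext j k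
    simp only [biproduct.ι_desc_assoc, Category.assoc, biproduct.lift_π, Category.id_comp]
    by_cases h : k = j
    · subst h
      simp
    · rw [biproduct.ι_π_ne _ h, biproduct.ι_π_ne _ (fun h' => h (Sum.inr_injective h'))]
  · rw [biproduct.lift_desc, biproduct.lift_desc, ← biproduct.total, Fintype.sum_sum_type]

end Biproducts

/-! ### Decomposition into indecomposables and residues modulo the radical. -/

section Indecomposables

variable {C : Type u} [Category.{v} C] [Preadditive C] [HasZeroObject C] [HasShift C ℤ]
  [∀ n : ℤ, (shiftFunctor C n).Additive] [Pretriangulated C]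

/-- Indecomposable objects of `addHull R`, up to isomorphism. -/
def indSetoid (R : C) : Setoid {X : C // Indecomposable X ∧ addHull R X} where
  r X Y := Nonempty (X.1 ≅ Y.1)
  iseqv := ⟨fun _ => ⟨Iso.refl _⟩, fun ⟨e⟩ => ⟨e.symm⟩, fun ⟨e⟩ ⟨e'⟩ => ⟨e ≪≫ e'⟩⟩

/-- Isomorphism classes of indecomposable objects of `addHull R`. -/
def Ind (R : C) : Type _ := Quotient (indSetoid R)

namespace Ind

variable {R : C}

/-- A representative of an isomorphism class of indecomposable objects. -/
def obj (i : Ind R) : C := (Quotient.out i).1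

lemma indecomposable (i : Ind R) : Indecomposable i.obj := (Quotient.out i).2.1

lemma addHull (i : Ind R) : addHull R i.obj := (Quotient.out i).2.2

lemma eq_of_iso {i j : Ind R} (e : i.obj ≅ j.obj) : i = j := by
  have := Quotient.sound (s := indSetoid R) (a := Quotient.out i) (b := Quotient.out j) ⟨e⟩
  exact (Quotient.out_eq i).symm.trans (this.trans (Quotient.out_eq j))

lemma exists_iso {X : C} (hX : Indecomposable X) (hX' : Silting.addHull R X) :
    ∃ i : Ind R, Nonempty (X ≅ i.obj) := by
  refine ⟨Quotient.mk (indSetoid R) ⟨X, hX, hX'⟩, ?_⟩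
  obtain ⟨e⟩ := Quotient.mk_out (s := indSetoid R) ⟨X, hX, hX'⟩
  exact ⟨e.symm⟩

end Ind

/-- The direct sum of a finite family of indecomposable objects. -/
abbrev sumObj {R : C} {I : Type} [Fintype I] (x : I → Ind R) : C := ⨁ fun k => (x k).obj

lemma addHull_sumObj {R : C} {I : Type} [Fintype I] (x : I → Ind R) : addHull R (sumObj x) :=
  addHull_biproduct fun k => (x k).addHull

variable {K : Type*} [Field K] [Linear K C] [∀ X Y : C, Module.Finite K (X ⟶ Y)]
  {Λ : Type*} [Ring Λ] [Algebra K Λ] {R : C} (S : SymmetricGenerator K Λ R)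

lemma nonempty_sumObj_sum {I J : Type} [Fintype I] [Fintype J] (x : I → Ind R) (y : J → Ind R) :
    Nonempty (sumObj (Sum.elim x y) ≅ sumObj x ⊞ sumObj y) :=
  nonempty_iso_biproduct_sum fun k => (Sum.elim x y k).obj

/-- Provides the decreasing quantity for the existence of decompositions in `exists_iso_sumObj`. -/
lemma finrank_end_lt (K : Type*) [Field K] [Linear K C] [∀ X Y : C, Module.Finite K (X ⟶ Y)]
    {X Y Z : C} (e : X ≅ Y ⊞ Z) (hZ : ¬ IsZero Z) :
    Module.finrank K (Y ⟶ Y) < Module.finrank K (X ⟶ X) := by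
  let φ : ((Y ⟶ Y) × (Z ⟶ Z)) →ₗ[K] (X ⟶ X) :=
    { toFun := fun f => e.hom ≫ (biprod.fst ≫ f.1 ≫ biprod.inl + biprod.snd ≫ f.2 ≫ biprod.inr) ≫
        e.inv
      map_add' := fun f g => by simp; abel
      map_smul' := fun c f => by simp }
  have hφ : Function.Injective φ := by
    rw [injective_iff_map_eq_zero]
    rintro ⟨f, g⟩ h
    have h' : e.hom ≫ (biprod.fst ≫ f ≫ biprod.inl + biprod.snd ≫ g ≫ biprod.inr) ≫ e.inv = 0 := h
    have h1 := congrArg (fun z => biprod.inl ≫ e.inv ≫ z ≫ e.hom ≫ biprod.fst) h'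
    have h2 := congrArg (fun z => biprod.inr ≫ e.inv ≫ z ≫ e.hom ≫ biprod.snd) h'
    simp at h1 h2
    rw [h1, h2]
    rfl
  have h1 := LinearMap.finrank_le_finrank_of_injective hφ
  rw [Module.finrank_prod] at h1
  have : Nontrivial (Z ⟶ Z) := ⟨⟨𝟙 Z, 0, fun h => hZ ((IsZero.iff_id_eq_zero _).2 h)⟩⟩
  have h2 : 0 < Module.finrank K (Z ⟶ Z) := Module.finrank_pos
  omega

lemma exists_iso_sumObj (K : Type*) [Field K] [Linear K C] [∀ X Y : C, Module.Finite K (X ⟶ Y)]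
    {R X : C} (hX : addHull R X) :
    ∃ (I : Type) (_ : Fintype I) (x : I → Ind R), Nonempty (X ≅ sumObj x) := by
  induction hn : Module.finrank K (X ⟶ X) using Nat.strong_induction_on generalizing X with
  | _ n ih =>
    by_cases h0 : IsZero X
    · refine ⟨Empty, inferInstance, Empty.elim, ⟨h0.iso ?_⟩⟩
      rw [IsZero.iff_id_eq_zero]
      ext j
      exact j.elim
    by_cases h1 : Indecomposable X
    · obtain ⟨i, ⟨e⟩⟩ := Ind.exists_iso h1 hX
      exact ⟨Unit, inferInstance, fun _ => i, ⟨e ≪≫ (biproductUniqueIso fun _ : Unit => i.obj).symm⟩⟩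
    · have h2 : ∃ Y Z : C, Nonempty (X ≅ Y ⊞ Z) ∧ ¬ IsZero Y ∧ ¬ IsZero Z := by
        by_contra! h
        exact h1 ⟨h0, fun Y Z e => or_iff_not_imp_left.2 (h Y Z ⟨e⟩)⟩
      obtain ⟨Y, Z, ⟨e⟩, hY, hZ⟩ := h2
      obtain ⟨I, _, x, ⟨e₁⟩⟩ := ih _ (hn ▸ finrank_end_lt K e hZ)
        (hX.of_retract ⟨biprod.inl ≫ e.inv, e.hom ≫ biprod.fst, by simp⟩) rfl
      obtain ⟨J, _, y, ⟨e₂⟩⟩ := ih _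
        (hn ▸ finrank_end_lt K (e ≪≫ biprod.braiding _ _) hY)
        (hX.of_retract ⟨biprod.inr ≫ e.inv, e.hom ≫ biprod.snd, by simp⟩) rfl
      obtain ⟨e₃⟩ := nonempty_sumObj_sum x y
      exact ⟨I ⊕ J, inferInstance, Sum.elim x y, ⟨e ≪≫ biprod.mapIso e₁ e₂ ≪≫ e₃.symm⟩⟩

namespace SymmetricGenerator

lemma mem_rad_of_ne {i j : Ind R} (h : i ≠ j) (f : i.obj ⟶ j.obj) : f ∈ S.rad i.obj j.obj :=
  S.mem_rad_of_not_isIso i.addHull i.indecomposable j.addHull j.indecomposable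
    fun _ => h (Ind.eq_of_iso (asIso f))

lemma mem_rad_iff_components {I J : Type} [Fintype I] [Fintype J] {x : I → Ind R} {y : J → Ind R}
    (f : sumObj x ⟶ sumObj y) :
    f ∈ S.rad _ _ ↔ ∀ k l, biproduct.components f k l ∈ S.rad _ _ := by
  constructor
  · intro h k l
    exact S.comp_rad _ (S.rad_comp h _)
  · intro h
    rw [eq_sum_components f]
    exact sum_mem fun k _ => sum_mem fun l _ => S.comp_rad _ (S.rad_comp (h k l) _)

lemma mem_rad_of_disjoint {I J : Type} [Fintype I] [Fintype J] {x : I → Ind R} {y : J → Ind R}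
    (h : ∀ k l, x k ≠ y l) (f : sumObj x ⟶ sumObj y) : f ∈ S.rad _ _ :=
  (S.mem_rad_iff_components f).2 fun k l => S.mem_rad_of_ne (h k l) _

end SymmetricGenerator

open Classical in
/-- The morphism between indecomposable objects that is given by a scalar. -/
def scalarHom (c : K) (i j : Ind R) : i.obj ⟶ j.obj :=
  if h : i = j then c • eqToHom (by rw [h]) else 0

lemma scalarHom_self (c : K) (i : Ind R) : scalarHom c i i = c • 𝟙 i.obj := by
  simp [scalarHom]

lemma scalarHom_of_ne (c : K) {i j : Ind R} (h : i ≠ j) : scalarHom c i j = 0 := dif_neg h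

@[simp]
lemma scalarHom_zero (i j : Ind R) : scalarHom (0 : K) i j = 0 := by
  by_cases h : i = j
  · subst h; simp [scalarHom_self]
  · exact scalarHom_of_ne _ h

lemma scalarHom_add (c d : K) (i j : Ind R) :
    scalarHom (c + d) i j = scalarHom c i j + scalarHom d i j := by
  by_cases h : i = j
  · subst h; simp [scalarHom_self, add_smul]
  · simp [scalarHom_of_ne _ h]

lemma scalarHom_mul (a c : K) (i j : Ind R) :
    scalarHom (a * c) i j = a • scalarHom c i j := by
  by_cases h : i = j
  · subst h; simp [scalarHom_self, mul_smul]
  · simp [scalarHom_of_ne _ h]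

namespace SymmetricGenerator

variable [IsAlgClosed K]

lemma exists_scalarHom {i j : Ind R} (f : i.obj ⟶ j.obj) :
    ∃ c : K, f - scalarHom c i j ∈ S.rad _ _ ∧ (i ≠ j → c = 0) := by
  by_cases h : i = j
  · subst h
    obtain ⟨c, hc⟩ := S.exists_scalar i.addHull i.indecomposable f
    exact ⟨c, by rwa [scalarHom_self], fun h => absurd rfl h⟩
  · exact ⟨0, S.mem_rad_of_ne h _, fun _ => rfl⟩

lemma scalar_eq_zero_of_mem_rad {i j : Ind R} {c : K} (h : scalarHom c i j ∈ S.rad _ _)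
    (h' : i ≠ j → c = 0) : c = 0 := by
  by_cases hij : i = j
  · subst hij
    by_contra hc
    rw [scalarHom_self] at h
    refine S.not_isIso_of_mem_rad i.addHull i.indecomposable.1 h ?_
    exact ⟨c⁻¹ • 𝟙 _, by simp [smul_smul, hc], by simp [smul_smul, hc]⟩
  · exact h' hij

lemma scalar_unique {i j : Ind R} {f : i.obj ⟶ j.obj} {c d : K}
    (hc : f - scalarHom c i j ∈ S.rad _ _ ∧ (i ≠ j → c = 0))
    (hd : f - scalarHom d i j ∈ S.rad _ _ ∧ (i ≠ j → d = 0)) : c = d := by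
  rw [← sub_eq_zero]
  refine S.scalar_eq_zero_of_mem_rad (i := i) (j := j) ?_ fun h => by
    rw [hc.2 h, hd.2 h, sub_zero]
  have h1 : scalarHom (c - d) i j = (f - scalarHom d i j) - (f - scalarHom c i j) := by
    have := scalarHom_add (c - d) d i j
    rw [sub_add_cancel] at this
    rw [this]
    abel
  rw [h1]
  exact sub_mem hd.1 hc.1

/-- The scalar part of a morphism between indecomposable objects. -/
def scalar (i j : Ind R) : (i.obj ⟶ j.obj) →ₗ[K] K where
  toFun f := (S.exists_scalarHom f).choose
  map_add' f g := by
    have hf := (S.exists_scalarHom f).choose_spec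
    have hg := (S.exists_scalarHom g).choose_spec
    refine S.scalar_unique (S.exists_scalarHom (f + g)).choose_spec ⟨?_, fun h => by
      rw [hf.2 h, hg.2 h, add_zero]⟩
    rw [scalarHom_add, add_sub_add_comm]
    exact add_mem hf.1 hg.1
  map_smul' c f := by
    have hf := (S.exists_scalarHom f).choose_spec
    refine S.scalar_unique (S.exists_scalarHom (c • f)).choose_spec ⟨?_, fun h => by
      rw [hf.2 h, smul_zero]⟩
    rw [smul_eq_mul, scalarHom_mul, RingHom.id_apply, ← smul_sub]
    exact Submodule.smul_mem _ _ hf.1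

lemma scalar_spec {i j : Ind R} (f : i.obj ⟶ j.obj) :
    f - scalarHom (S.scalar i j f) i j ∈ S.rad _ _ := (S.exists_scalarHom f).choose_spec.1

lemma scalar_of_ne {i j : Ind R} (h : i ≠ j) (f : i.obj ⟶ j.obj) : S.scalar i j f = 0 :=
  (S.exists_scalarHom f).choose_spec.2 h

lemma scalar_eq_of_mem {i j : Ind R} {f : i.obj ⟶ j.obj} {c : K}
    (hc : f - scalarHom c i j ∈ S.rad _ _) (hc' : i ≠ j → c = 0) : S.scalar i j f = c :=
  S.scalar_unique (S.exists_scalarHom f).choose_spec ⟨hc, hc'⟩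

lemma scalar_eq_zero_iff {i j : Ind R} {f : i.obj ⟶ j.obj} :
    S.scalar i j f = 0 ↔ f ∈ S.rad _ _ := by
  constructor
  · intro h
    have := S.scalar_spec f
    rwa [h, scalarHom_zero, sub_zero] at this
  · intro h
    exact S.scalar_eq_of_mem (by simpa using h) fun _ => rfl

lemma scalar_scalarHom {i j : Ind R} {c : K} (h : i ≠ j → c = 0) :
    S.scalar i j (scalarHom c i j) = c :=
  S.scalar_eq_of_mem (by simp) h

/-- The radical is an ideal. A path from `i` to `i` through some `j ≠ i` is radical, so it
contributes nothing to the residue. -/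
lemma scalar_comp {i j k : Ind R} (f : i.obj ⟶ j.obj) (g : j.obj ⟶ k.obj) :
    S.scalar i k (f ≫ g) = S.scalar i j f * S.scalar j k g := by
  by_cases hij : i = j
  · subst hij
    by_cases hik : i = k
    · subst hik
      refine S.scalar_eq_of_mem ?_ fun h => absurd rfl h
      have h1 : f ≫ g - scalarHom (S.scalar i i f * S.scalar i i g) i i =
          (f - scalarHom (S.scalar i i f) i i) ≫ g +
          scalarHom (S.scalar i i f) i i ≫ (g - scalarHom (S.scalar i i g) i i) := by
        simp [scalarHom_self, mul_smul, smul_comm (S.scalar i i f)]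
      rw [h1]
      exact add_mem (S.rad_comp (S.scalar_spec f) _) (S.comp_rad _ (S.scalar_spec g))
    · rw [S.scalar_of_ne hik, S.scalar_of_ne hik, mul_zero]
  · rw [S.scalar_of_ne hij, zero_mul, S.scalar_eq_zero_iff]
    exact S.rad_comp (S.mem_rad_of_ne hij _) _

end SymmetricGenerator

end Indecomposables

/-! ### Scalar matrices and transposition of morphisms. -/

section Matrices

variable {C : Type u} [Category.{v} C] [Preadditive C] [HasZeroObject C] [HasShift C ℤ]
  [∀ n : ℤ, (shiftFunctor C n).Additive] [Pretriangulated C]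
  {K : Type*} [Field K] [Linear K C] [∀ X Y : C, Module.Finite K (X ⟶ Y)]
  {Λ : Type*} [Ring Λ] [Algebra K Λ] {R : C}
  {I J L : Type} [Fintype I] [Fintype J] [Fintype L] {x : I → Ind R} {y : J → Ind R} {z : L → Ind R}

/-- The matrix is supported on the pairs of equal indecomposable objects. -/
def IsSupported (x : I → Ind R) (y : J → Ind R) (A : Matrix I J K) : Prop :=
  ∀ k l, x k ≠ y l → A k l = 0

lemma IsSupported.transpose {A : Matrix I J K} (h : IsSupported x y A) :
    IsSupported y x A.transpose := fun k l hkl => h l k hkl.symm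

/-- The morphism between sums of indecomposable objects that is given by a matrix of scalars. -/
def ofMat (x : I → Ind R) (y : J → Ind R) (A : Matrix I J K) : sumObj x ⟶ sumObj y :=
  biproduct.matrix fun k l => scalarHom (A k l) (x k) (y l)

@[simp]
lemma components_ofMat (A : Matrix I J K) (k : I) (l : J) :
    biproduct.components (ofMat x y A) k l = scalarHom (A k l) (x k) (y l) :=
  biproduct.matrix_components _ _ _

open scoped Classical in
lemma ofMat_one : ofMat x x (1 : Matrix I I K) = 𝟙 _ := by
  refine components_ext fun k l => ?_
  rw [components_ofMat]
  by_cases h : k = l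
  · subst h
    simp [scalarHom_self, biproduct.components]
  · simp only [biproduct.components, Category.id_comp, Matrix.one_apply_ne h, scalarHom_zero]
    rw [biproduct.ι_π_ne _ h]

namespace SymmetricGenerator

variable (S : SymmetricGenerator K Λ R)

section

variable [IsAlgClosed K]

/-- The matrix of scalar parts of the components. -/
def scalarMat (f : sumObj x ⟶ sumObj y) : Matrix I J K :=
  fun k l => S.scalar (x k) (y l) (biproduct.components f k l)

lemma isSupported_scalarMat (f : sumObj x ⟶ sumObj y) : IsSupported x y (S.scalarMat f) :=
  fun _ _ h => S.scalar_of_ne h _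

lemma scalarMat_comp (f : sumObj x ⟶ sumObj y) (g : sumObj y ⟶ sumObj z) :
    S.scalarMat (f ≫ g) = S.scalarMat f * S.scalarMat g := by
  ext k l
  rw [Matrix.mul_apply]
  unfold scalarMat
  rw [components_comp, map_sum]
  exact Finset.sum_congr rfl fun j _ => S.scalar_comp _ _

lemma scalarMat_add (f g : sumObj x ⟶ sumObj y) :
    S.scalarMat (f + g) = S.scalarMat f + S.scalarMat g := by
  ext k l
  simp [scalarMat, components_add]

lemma scalarMat_sub (f g : sumObj x ⟶ sumObj y) :
    S.scalarMat (f - g) = S.scalarMat f - S.scalarMat g := by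
  ext k l
  simp [scalarMat, components_sub]

lemma scalarMat_eq_zero_iff {f : sumObj x ⟶ sumObj y} : S.scalarMat f = 0 ↔ f ∈ S.rad _ _ := by
  rw [mem_rad_iff_components, ← Matrix.ext_iff]
  exact forall_congr' fun k => forall_congr' fun l => S.scalar_eq_zero_iff

lemma scalarMat_ofMat {A : Matrix I J K} (hA : IsSupported x y A) :
    S.scalarMat (ofMat x y A) = A := by
  ext k l
  rw [scalarMat, components_ofMat, S.scalar_scalarHom (hA k l)]

lemma sub_ofMat_mem_rad (f : sumObj x ⟶ sumObj y) : f - ofMat x y (S.scalarMat f) ∈ S.rad _ _ := by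
  rw [← scalarMat_eq_zero_iff, scalarMat_sub, S.scalarMat_ofMat (S.isSupported_scalarMat f), sub_self]

open scoped Classical in
lemma isSupported_one : IsSupported x x (1 : Matrix I I K) := fun k l h =>
  Matrix.one_apply_ne fun h' => h (by rw [h'])

open scoped Classical in
lemma scalarMat_id : S.scalarMat (𝟙 (sumObj x)) = 1 := by
  rw [← ofMat_one (K := K), S.scalarMat_ofMat isSupported_one]

open scoped Classical in
lemma isIso_of_scalarMat_eq_one {f : sumObj x ⟶ sumObj x} (hf : S.scalarMat f = 1) : IsIso f := by
  refine S.isIso_of_rad (addHull_sumObj x) ?_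
  rw [← scalarMat_eq_zero_iff, scalarMat_sub, hf, scalarMat_id, sub_self]

/-- If `x k = y l`, the matrix unit at `(k, l)` would define a morphism that is not radical. -/
lemma ne_of_forall_mem_rad (h : ∀ f : sumObj x ⟶ sumObj y, f ∈ S.rad _ _) (k : I) (l : J) :
    x k ≠ y l := by
  classical
  intro hkl
  have h1 : IsSupported x y (Matrix.single k l (1 : K)) := by
    intro k' l' h'
    rw [Matrix.single_apply_of_ne]
    rintro ⟨rfl, rfl⟩
    exact h' hkl
  have h2 := S.scalarMat_eq_zero_iff.2 (h (ofMat x y (Matrix.single k l (1 : K))))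
  rw [S.scalarMat_ofMat h1] at h2
  have h3 := congrFun (congrFun h2 k) l
  simp at h3

end

/-! ### Transposition -/

include S in
lemma nonempty_hom_equiv (i j : Ind R) : Nonempty ((i.obj ⟶ j.obj) ≃ₗ[K] (j.obj ⟶ i.obj)) :=
  FiniteDimensional.nonempty_linearEquiv_of_finrank_eq
    (le_antisymm (S.finrank_hom_le i.addHull j.addHull) (S.finrank_hom_le j.addHull i.addHull))

open scoped Classical in
/-- A choice of mutually inverse bijections `Hom(i, j) ≃ Hom(j, i)` for `i ≠ j`. -/
def swap (i j : Ind R) : (i.obj ⟶ j.obj) →ₗ[K] (j.obj ⟶ i.obj) :=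
  -- A well-order on the classes decides which direction carries the chosen isomorphism and which
  -- carries its inverse.
  if WellOrderingRel i j then (S.nonempty_hom_equiv i j).some.toLinearMap
  else (S.nonempty_hom_equiv j i).some.symm.toLinearMap

lemma swap_swap {i j : Ind R} (h : i ≠ j) (f : i.obj ⟶ j.obj) : S.swap j i (S.swap i j f) = f := by
  unfold swap
  rcases trichotomous_of WellOrderingRel i j with hij | hij | hij
  · rw [if_pos hij, if_neg (asymm_of WellOrderingRel hij)]
    simp
  · exact absurd hij h
  · rw [if_pos hij, if_neg (asymm_of WellOrderingRel hij)]
    simp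

/-- Compatibility of `swap` with arbitrary compositions is not available. A scalar morphism,
however, is a multiple of an identity or zero, and for those linearity is enough. -/
lemma swap_comp_scalarHom {i j k : Ind R} (f : i.obj ⟶ j.obj) (c : K) :
    S.swap i k (f ≫ scalarHom c j k) = scalarHom c k j ≫ S.swap i j f := by
  by_cases h : j = k
  · subst h
    simp [scalarHom_self]
  · simp [scalarHom_of_ne _ h, scalarHom_of_ne _ (Ne.symm h)]

lemma swap_scalarHom_comp {i j k : Ind R} (c : K) (f : j.obj ⟶ k.obj) :
    S.swap i k (scalarHom c i j ≫ f) = S.swap j k f ≫ scalarHom c j i := by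
  by_cases h : i = j
  · subst h
    simp [scalarHom_self]
  · simp [scalarHom_of_ne _ h, scalarHom_of_ne _ (Ne.symm h)]

/-- The transpose of a morphism between sums of indecomposable objects. -/
def tr (f : sumObj x ⟶ sumObj y) : sumObj y ⟶ sumObj x :=
  biproduct.matrix fun l k => S.swap (x k) (y l) (biproduct.components f k l)

lemma components_tr (f : sumObj x ⟶ sumObj y) (k : I) (l : J) :
    biproduct.components (S.tr f) l k = S.swap (x k) (y l) (biproduct.components f k l) :=
  biproduct.matrix_components _ _ _

lemma tr_add (f g : sumObj x ⟶ sumObj y) : S.tr (f + g) = S.tr f + S.tr g :=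
  components_ext fun l k => by
    simp only [components_tr, components_add, map_add]

lemma tr_tr (h : ∀ k l, x k ≠ y l) (f : sumObj x ⟶ sumObj y) : S.tr (S.tr f) = f :=
  components_ext fun k l => by rw [components_tr, components_tr, S.swap_swap (h k l)]

lemma tr_comp_ofMat (f : sumObj x ⟶ sumObj y) (A : Matrix J L K) :
    S.tr (f ≫ ofMat y z A) = ofMat z y A.transpose ≫ S.tr f :=
  components_ext fun l k => by
    rw [components_tr, components_comp, components_comp, map_sum]
    exact Finset.sum_congr rfl fun j _ => by
      rw [components_ofMat, components_ofMat, components_tr, swap_comp_scalarHom,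
        Matrix.transpose_apply]

lemma tr_ofMat_comp (A : Matrix I J K) (f : sumObj y ⟶ sumObj z) :
    S.tr (ofMat x y A ≫ f) = S.tr f ≫ ofMat y x A.transpose :=
  components_ext fun l k => by
    rw [components_tr, components_comp, components_comp, map_sum]
    exact Finset.sum_congr rfl fun j _ => by
      rw [components_ofMat, components_ofMat, components_tr, swap_scalarHom_comp,
        Matrix.transpose_apply]

end SymmetricGenerator

end Matrices

/-! ### Two-term complexes, their order and their transposes. -/

section TwoTerm

variable {C : Type u} [Category.{v} C] [Preadditive C] [HasZeroObject C] [HasShift C ℤ]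
  [∀ n : ℤ, (shiftFunctor C n).Additive] [Pretriangulated C]

/-- Under the vanishing hypotheses, `Hom(T, T'[1])` consists of the maps `Q₁ ⟶ Q₀'` modulo
homotopies, as for complexes concentrated in degrees `-1` and `0`. -/
lemma homVanishes_one_iff {Q₁ Q₀ T Q₁' Q₀' T' : C} {a : Q₁ ⟶ Q₀} {g : Q₀ ⟶ T}
    {h : T ⟶ (shiftFunctor C (1 : ℤ)).obj Q₁} {b : Q₁' ⟶ Q₀'} {g' : Q₀' ⟶ T'}
    {h' : T' ⟶ (shiftFunctor C (1 : ℤ)).obj Q₁'} (hT : Triangle.mk a g h ∈ distTriang C)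
    (hT' : Triangle.mk b g' h' ∈ distTriang C) (h₀₀ : HomVanishes Q₀ Q₀' 1)
    (h₀₁ : HomVanishes Q₀ Q₁' 1) (h₁₁ : HomVanishes Q₁ Q₁' 1) (h₀₁' : HomVanishes Q₀ Q₁' 2) :
    HomVanishes T T' 1 ↔
      ∀ f : Q₁ ⟶ Q₀', ∃ (s : Q₀ ⟶ Q₀') (t : Q₁ ⟶ Q₁'), f = a ≫ s + t ≫ b := by
  constructor
  · intro H f
    -- The vanishing is applied to the composite `T ⟶ Q₁[1] ⟶ T'[1]` induced by `f`.
    obtain ⟨ψ, hψ⟩ := distTriang_desc₁ hT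
      ((shiftFunctor C (1 : ℤ)).map (f ≫ g')) (H _)
    obtain ⟨ψ, rfl⟩ := (shiftFunctor C (1 : ℤ)).map_surjective ψ
    rw [← Functor.map_comp] at hψ
    replace hψ := (shiftFunctor C (1 : ℤ)).map_injective hψ
    obtain ⟨s, rfl⟩ := distTriang_lift₃ hT' ψ (h₀₁ _)
    obtain ⟨t, ht⟩ := distTriang_lift₂ hT' (f - a ≫ s) (by
      rw [Preadditive.sub_comp, hψ, Category.assoc, sub_self])
    exact ⟨s, t, by rw [← ht]; abel⟩
  · intro H φ
    have h1 : HomVanishes Q₀ T' 1 := HomVanishes.right₃ hT' h₀₀ h₀₁'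
    obtain ⟨ψ, rfl⟩ := distTriang_desc₃ hT φ (h1 _)
    obtain ⟨ψ, rfl⟩ := (shiftFunctor C (1 : ℤ)).map_surjective ψ
    obtain ⟨f, rfl⟩ := distTriang_lift₃ hT' ψ (h₁₁ _)
    obtain ⟨s, t, rfl⟩ := H f
    rw [Preadditive.add_comp, Category.assoc, Category.assoc, distTriang_comp₁₂ hT', comp_zero,
      add_zero, Functor.map_comp, ← Category.assoc, distTriang_comp₃₁ hT, zero_comp]

/-- A morphism between two sums of indecomposable objects of `addHull R` without common summand. -/
structure TwoTerm (R : C) where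
  /-- The index type of the summands in degree `-1`. -/
  I₁ : Type
  /-- The index type of the summands in degree `0`. -/
  I₀ : Type
  [fintype₁ : Fintype I₁]
  [fintype₀ : Fintype I₀]
  /-- The summands in degree `-1`. -/
  x₁ : I₁ → Ind R
  /-- The summands in degree `0`. -/
  x₀ : I₀ → Ind R
  /-- The differential. -/
  a : sumObj x₁ ⟶ sumObj x₀
  disjoint : ∀ k l, x₁ k ≠ x₀ l

attribute [instance] TwoTerm.fintype₁ TwoTerm.fintype₀

namespace TwoTerm

variable {R : C} (D E : TwoTerm R)

/-- The cone of the differential. -/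
def obj : C := (Pretriangulated.distinguished_cocone_triangle D.a).choose

/-- The inclusion of the degree `0` part. -/
def g : sumObj D.x₀ ⟶ D.obj :=
  (Pretriangulated.distinguished_cocone_triangle D.a).choose_spec.choose

/-- The projection to the degree `-1` part. -/
def h : D.obj ⟶ (shiftFunctor C (1 : ℤ)).obj (sumObj D.x₁) :=
  (Pretriangulated.distinguished_cocone_triangle D.a).choose_spec.choose_spec.choose

lemma distinguished : Triangle.mk D.a D.g D.h ∈ distTriang C :=
  (Pretriangulated.distinguished_cocone_triangle D.a).choose_spec.choose_spec.choose_spec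

end TwoTerm

variable {K : Type*} [Field K] [Linear K C] [∀ X Y : C, Module.Finite K (X ⟶ Y)]
  {Λ : Type*} [Ring Λ] [Algebra K Λ] {R : C} (S : SymmetricGenerator K Λ R)

namespace SymmetricGenerator

include S in
lemma homVanishes_of_addHull {X Y : C} (hX : addHull R X) (hY : addHull R Y) {n : ℤ} (hn : n ≠ 0) :
    HomVanishes X Y n := (S.homVanishes n hn).addHull hX hY

include S in
lemma homVanishes_obj (D E : TwoTerm R) {n : ℤ} (hn : 1 < n) : HomVanishes D.obj E.obj n := by
  have h1 : ∀ (I J : Type) [Fintype I] [Fintype J] (x : I → Ind R) (y : J → Ind R) {n : ℤ},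
      n ≠ 0 → HomVanishes (sumObj x) (sumObj y) n := fun I J _ _ x y n hn =>
    S.homVanishes_of_addHull (addHull_sumObj x) (addHull_sumObj y) hn
  refine HomVanishes.left₃ D.distinguished ?_ ?_ <;>
  exact HomVanishes.right₃ E.distinguished (h1 _ _ _ _ (by omega)) (h1 _ _ _ _ (by omega))

include S in
lemma geq_obj (D : TwoTerm R) : Geq R D.obj := fun n hn =>
  HomVanishes.right₃ D.distinguished
    (S.homVanishes_of_addHull (addHull_self R) (addHull_sumObj _) (by omega))
    (S.homVanishes_of_addHull (addHull_self R) (addHull_sumObj _) (by omega))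

include S in
lemma obj_geq_shift (D : TwoTerm R) : Geq D.obj ((shiftFunctor C (1 : ℤ)).obj R) := fun n hn => by
  refine (HomVanishes.shift_right_iff 1 n (n + 1) (by omega)).2 ?_
  exact HomVanishes.left₃ D.distinguished
    (S.homVanishes_of_addHull (addHull_sumObj _) (addHull_self R) (by omega))
    (S.homVanishes_of_addHull (addHull_sumObj _) (addHull_self R) (by omega))

lemma mem_rad_differential (D : TwoTerm R) : D.a ∈ S.rad _ _ := S.mem_rad_of_disjoint D.disjoint _

include S in
lemma geq_iff_homVanishes_one (D E : TwoTerm R) : Geq D.obj E.obj ↔ HomVanishes D.obj E.obj 1 := by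
  refine ⟨fun h => h.homVanishes one_pos, fun h n hn => ?_⟩
  by_cases hn1 : n = 1
  · subst hn1
    exact h
  · exact S.homVanishes_obj D E (by omega)

/-- Every map `Q₁ ⟶ Q₀'` has the form `a ≫ s + t ≫ b` with `a` and `b` radical, hence is radical; a
common summand would give one that is not. -/
lemma disjoint_of_homVanishes_one [IsAlgClosed K] {I₁ I₀ J₁ J₀ : Type} [Fintype I₁] [Fintype I₀]
    [Fintype J₁] [Fintype J₀] {x₁ : I₁ → Ind R} {x₀ : I₀ → Ind R} {y₁ : J₁ → Ind R}
    {y₀ : J₀ → Ind R} {a : sumObj x₁ ⟶ sumObj x₀} {b : sumObj y₁ ⟶ sumObj y₀} {T T' : C}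
    {g : sumObj x₀ ⟶ T} {h : T ⟶ (shiftFunctor C (1 : ℤ)).obj (sumObj x₁)} {g' : sumObj y₀ ⟶ T'}
    {h' : T' ⟶ (shiftFunctor C (1 : ℤ)).obj (sumObj y₁)} (hT : Triangle.mk a g h ∈ distTriang C)
    (hT' : Triangle.mk b g' h' ∈ distTriang C) (ha : a ∈ S.rad _ _) (hb : b ∈ S.rad _ _)
    (H : HomVanishes T T' 1) (k : I₁) (l : J₀) : x₁ k ≠ y₀ l := by
  refine S.ne_of_forall_mem_rad (fun f => ?_) k l
  have h1 : ∀ (I J : Type) [Fintype I] [Fintype J] (x : I → Ind R) (y : J → Ind R) {n : ℤ},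
      n ≠ 0 → HomVanishes (sumObj x) (sumObj y) n := fun I J _ _ x y n hn =>
    S.homVanishes_of_addHull (addHull_sumObj x) (addHull_sumObj y) hn
  obtain ⟨s, t, rfl⟩ := (homVanishes_one_iff hT hT' (h1 _ _ _ _ one_ne_zero)
    (h1 _ _ _ _ one_ne_zero) (h1 _ _ _ _ one_ne_zero) (h1 _ _ _ _ two_ne_zero)).1 H f
  exact add_mem (S.rad_comp ha _) (S.comp_rad _ hb)

variable [IsAlgClosed K]

include S in
lemma disjoint_of_geq {D E : TwoTerm R} (h : Geq D.obj E.obj) (k : D.I₁) (l : E.I₀) :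
    D.x₁ k ≠ E.x₀ l :=
  S.disjoint_of_homVanishes_one D.distinguished E.distinguished (S.mem_rad_differential D)
    (S.mem_rad_differential E) (h.homVanishes one_pos) k l

/-- The error `s - ofMat (scalarMat s)` is radical, and a product of two radical maps between sums
without common summand is zero by `rad_comp_rad_eq_zero`. -/
lemma differential_comp_ofMat {D E : TwoTerm R} (hDE : ∀ k l, D.x₁ k ≠ E.x₀ l)
    (s : sumObj D.x₀ ⟶ sumObj E.x₀) : D.a ≫ s = D.a ≫ ofMat _ _ (S.scalarMat s) := by
  rw [← sub_eq_zero, ← Preadditive.comp_sub]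
  exact S.rad_comp_rad_eq_zero (addHull_sumObj _) (addHull_sumObj _) (addHull_sumObj _)
    (S.mem_rad_of_disjoint fun k l => (hDE l k).symm) (S.mem_rad_differential D)
    (S.sub_ofMat_mem_rad s)

lemma ofMat_comp_differential {D E : TwoTerm R} (hDE : ∀ k l, D.x₁ k ≠ E.x₀ l)
    (t : sumObj D.x₁ ⟶ sumObj E.x₁) : t ≫ E.a = ofMat _ _ (S.scalarMat t) ≫ E.a := by
  rw [← sub_eq_zero, ← Preadditive.sub_comp]
  exact S.rad_comp_rad_eq_zero (addHull_sumObj _) (addHull_sumObj _) (addHull_sumObj _)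
    (S.mem_rad_of_disjoint fun k l => (hDE l k).symm) (S.sub_ofMat_mem_rad t)
    (S.mem_rad_differential E)

include S in
-- The order in terms of scalar matrices only. The condition involves no composition of non-scalar
-- maps, so it survives entrywise transposition.
lemma geq_obj_iff (D E : TwoTerm R) : Geq D.obj E.obj ↔ (∀ k l, D.x₁ k ≠ E.x₀ l) ∧
    ∀ f : sumObj D.x₁ ⟶ sumObj E.x₀, ∃ (A : Matrix D.I₀ E.I₀ K) (B : Matrix D.I₁ E.I₁ K),
      f = D.a ≫ ofMat _ _ A + ofMat _ _ B ≫ E.a := by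
  have h1 : ∀ (I J : Type) [Fintype I] [Fintype J] (x : I → Ind R) (y : J → Ind R) {n : ℤ},
      n ≠ 0 → HomVanishes (sumObj x) (sumObj y) n := fun I J _ _ x y n hn =>
    S.homVanishes_of_addHull (addHull_sumObj x) (addHull_sumObj y) hn
  have h2 := homVanishes_one_iff D.distinguished E.distinguished (h1 _ _ _ _ one_ne_zero)
    (h1 _ _ _ _ one_ne_zero) (h1 _ _ _ _ one_ne_zero) (h1 _ _ _ _ two_ne_zero)
  constructor
  · intro h
    refine ⟨S.disjoint_of_geq h, fun f => ?_⟩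
    obtain ⟨s, t, rfl⟩ := h2.1 (h.homVanishes one_pos) f
    exact ⟨S.scalarMat s, S.scalarMat t, by
      rw [S.differential_comp_ofMat (S.disjoint_of_geq h),
        S.ofMat_comp_differential (S.disjoint_of_geq h)]⟩
  · rintro ⟨_, h⟩
    refine (S.geq_iff_homVanishes_one D E).2 (h2.2 fun f => ?_)
    obtain ⟨A, B, hf⟩ := h f
    exact ⟨_, _, hf⟩

/-- The transposed two-term complex. -/
def dual (D : TwoTerm R) : TwoTerm R where
  I₁ := D.I₀
  I₀ := D.I₁
  x₁ := D.x₀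
  x₀ := D.x₁
  a := S.tr D.a
  disjoint k l := (D.disjoint l k).symm

lemma dual_dual (D : TwoTerm R) : S.dual (S.dual D) = D := by
  have h := S.tr_tr D.disjoint D.a
  cases D
  simp only [dual] at h ⊢
  rw [h]

/-- Transposing `f = a A + B b` gives `fᵗ = Aᵗ aᵗ + bᵗ Bᵗ`, the same condition with the two
complexes and the two degrees exchanged. -/
lemma geq_dual {D E : TwoTerm R} (h : Geq D.obj E.obj) : Geq (S.dual E).obj (S.dual D).obj := by
  obtain ⟨h1, h2⟩ := (S.geq_obj_iff D E).1 h
  refine (S.geq_obj_iff _ _).2 ⟨fun k l => (h1 l k).symm, fun (f : sumObj E.x₀ ⟶ sumObj D.x₁) => ?_⟩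
  obtain ⟨A, B, hf⟩ := h2 (S.tr f)
  refine ⟨B.transpose, A.transpose, ?_⟩
  have h3 := congrArg S.tr hf
  rw [S.tr_tr (fun k l => (h1 l k).symm), tr_add, tr_comp_ofMat, tr_ofMat_comp] at h3
  rw [h3, add_comm]
  rfl

lemma geq_dual_iff {D E : TwoTerm R} : Geq (S.dual E).obj (S.dual D).obj ↔ Geq D.obj E.obj := by
  refine ⟨fun h => ?_, S.geq_dual⟩
  have := S.geq_dual h
  rwa [dual_dual, dual_dual] at this

/-! ### Scalar parts of morphisms -/

/-- The morphism has a lift to complexes with the given scalar parts. -/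
def HasScalarPart {D E : TwoTerm R} (φ : D.obj ⟶ E.obj) (A : Matrix D.I₁ E.I₁ K)
    (B : Matrix D.I₀ E.I₀ K) : Prop :=
  ∃ (t : sumObj D.x₁ ⟶ sumObj E.x₁) (s : sumObj D.x₀ ⟶ sumObj E.x₀),
    D.a ≫ s = t ≫ E.a ∧ D.g ≫ φ = s ≫ E.g ∧
    D.h ≫ (shiftFunctor C (1 : ℤ)).map t = φ ≫ E.h ∧ S.scalarMat t = A ∧ S.scalarMat s = B

section

variable {S} {D E F : TwoTerm R}

lemma exists_hasScalarPart (S : SymmetricGenerator K Λ R) (φ : D.obj ⟶ E.obj) :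
    ∃ (A : Matrix D.I₁ E.I₁ K) (B : Matrix D.I₀ E.I₀ K), S.HasScalarPart φ A B := by
  have h1 : HomVanishes (sumObj D.x₀) (sumObj E.x₁) 1 :=
    S.homVanishes_of_addHull (addHull_sumObj _) (addHull_sumObj _) one_ne_zero
  obtain ⟨s, hs⟩ := distTriang_lift₃ E.distinguished (D.g ≫ φ) (h1 _)
  obtain ⟨t, ht₁, ht₂⟩ := complete_distinguished_triangle_morphism₁ _ _ D.distinguished
    E.distinguished s φ hs
  exact ⟨_, _, t, s, ht₁, hs, ht₂, rfl, rfl⟩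

lemma HasScalarPart.comp {φ : D.obj ⟶ E.obj} {ψ : E.obj ⟶ F.obj} {A B A' B'}
    (hφ : S.HasScalarPart φ A B) (hψ : S.HasScalarPart ψ A' B') :
    S.HasScalarPart (φ ≫ ψ) (A * A') (B * B') := by
  obtain ⟨t, s, h1, h2, h3, rfl, rfl⟩ := hφ
  obtain ⟨t', s', h1', h2', h3', rfl, rfl⟩ := hψ
  refine ⟨t ≫ t', s ≫ s', ?_, ?_, ?_, S.scalarMat_comp _ _, S.scalarMat_comp _ _⟩
  · rw [← Category.assoc, h1, Category.assoc, h1', Category.assoc]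
  · rw [← Category.assoc, h2, Category.assoc, h2', Category.assoc]
  · rw [Functor.map_comp, ← Category.assoc, h3, Category.assoc, h3', Category.assoc]

lemma HasScalarPart.add {φ ψ : D.obj ⟶ E.obj} {A B A' B'}
    (hφ : S.HasScalarPart φ A B) (hψ : S.HasScalarPart ψ A' B') :
    S.HasScalarPart (φ + ψ) (A + A') (B + B') := by
  obtain ⟨t, s, h1, h2, h3, rfl, rfl⟩ := hφ
  obtain ⟨t', s', h1', h2', h3', rfl, rfl⟩ := hψ
  refine ⟨t + t', s + s', ?_, ?_, ?_, S.scalarMat_add _ _, S.scalarMat_add _ _⟩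
  · rw [Preadditive.comp_add, Preadditive.add_comp, h1, h1']
  · rw [Preadditive.comp_add, Preadditive.add_comp, h2, h2']
  · rw [Functor.map_add, Preadditive.comp_add, Preadditive.add_comp, h3, h3']

lemma HasScalarPart.sub {φ ψ : D.obj ⟶ E.obj} {A B A' B'}
    (hφ : S.HasScalarPart φ A B) (hψ : S.HasScalarPart ψ A' B') :
    S.HasScalarPart (φ - ψ) (A - A') (B - B') := by
  obtain ⟨t, s, h1, h2, h3, rfl, rfl⟩ := hφ
  obtain ⟨t', s', h1', h2', h3', rfl, rfl⟩ := hψ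
  refine ⟨t - t', s - s', ?_, ?_, ?_, S.scalarMat_sub _ _, S.scalarMat_sub _ _⟩
  · rw [Preadditive.comp_sub, Preadditive.sub_comp, h1, h1']
  · rw [Preadditive.comp_sub, Preadditive.sub_comp, h2, h2']
  · rw [Functor.map_sub, Preadditive.comp_sub, Preadditive.sub_comp, h3, h3']

lemma hasScalarPart_zero : S.HasScalarPart (0 : D.obj ⟶ E.obj) 0 0 :=
  ⟨0, 0, by simp, by simp, by simp, S.scalarMat_eq_zero_iff.2 (zero_mem _),
    S.scalarMat_eq_zero_iff.2 (zero_mem _)⟩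

lemma HasScalarPart.sum {ι : Type*} (s : Finset ι) {φ : ι → (D.obj ⟶ E.obj)}
    {A : ι → Matrix D.I₁ E.I₁ K} {B : ι → Matrix D.I₀ E.I₀ K}
    (h : ∀ k, S.HasScalarPart (φ k) (A k) (B k)) :
    S.HasScalarPart (∑ k ∈ s, φ k) (∑ k ∈ s, A k) (∑ k ∈ s, B k) := by
  classical
  induction s using Finset.induction_on with
  | empty => simpa using hasScalarPart_zero
  | insert k s hk ih =>
    rw [Finset.sum_insert hk, Finset.sum_insert hk, Finset.sum_insert hk]
    exact (h k).add ih

open scoped Classical in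
lemma hasScalarPart_id : S.HasScalarPart (𝟙 D.obj) 1 1 :=
  ⟨𝟙 _, 𝟙 _, by simp, by simp, by simp, S.scalarMat_id, S.scalarMat_id⟩

/-- A lift of the zero map factors through a differential in each degree, so its components are
radical. Hence scalar parts do not depend on the lift. -/
lemma HasScalarPart.eq_zero {A B} (h : S.HasScalarPart (0 : D.obj ⟶ E.obj) A B) :
    A = 0 ∧ B = 0 := by
  obtain ⟨t, s, -, h2, h3, rfl, rfl⟩ := h
  rw [comp_zero] at h2
  rw [zero_comp] at h3
  obtain ⟨k, rfl⟩ := distTriang_lift₂ E.distinguished s h2.symm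
  obtain ⟨l, hl⟩ := distTriang_desc₁ D.distinguished _ h3
  obtain ⟨l, rfl⟩ := (shiftFunctor C (1 : ℤ)).map_surjective l
  rw [← Functor.map_comp] at hl
  rw [(shiftFunctor C (1 : ℤ)).map_injective hl]
  exact ⟨S.scalarMat_eq_zero_iff.2 (S.rad_comp (S.mem_rad_differential D) _),
    S.scalarMat_eq_zero_iff.2 (S.comp_rad _ (S.mem_rad_differential E))⟩

lemma HasScalarPart.unique {φ : D.obj ⟶ E.obj} {A B A' B'}
    (h : S.HasScalarPart φ A B) (h' : S.HasScalarPart φ A' B') : A = A' ∧ B = B' := by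
  have := h.sub h'
  rw [sub_self] at this
  exact ⟨sub_eq_zero.1 this.eq_zero.1, sub_eq_zero.1 this.eq_zero.2⟩

lemma HasScalarPart.isSupported {φ : D.obj ⟶ E.obj} {A B} (h : S.HasScalarPart φ A B) :
    IsSupported D.x₁ E.x₁ A ∧ IsSupported D.x₀ E.x₀ B := by
  obtain ⟨t, s, -, -, -, rfl, rfl⟩ := h
  exact ⟨S.isSupported_scalarMat t, S.isSupported_scalarMat s⟩

/-- The radical parts of a lift do not interact with the differentials, so the scalar matrices alone
form a chain map; its transpose is again one. -/
lemma HasScalarPart.comm {φ : D.obj ⟶ E.obj} {A B} (h : S.HasScalarPart φ A B)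
    (hDE : ∀ k l, D.x₁ k ≠ E.x₀ l) : D.a ≫ ofMat _ _ B = ofMat _ _ A ≫ E.a := by
  obtain ⟨t, s, h1, -, -, rfl, rfl⟩ := h
  rw [← S.differential_comp_ofMat hDE, h1, S.ofMat_comp_differential hDE]

lemma exists_of_comm {A : Matrix D.I₁ E.I₁ K} {B : Matrix D.I₀ E.I₀ K}
    (hA : IsSupported D.x₁ E.x₁ A) (hB : IsSupported D.x₀ E.x₀ B)
    (h : D.a ≫ ofMat _ _ B = ofMat _ _ A ≫ E.a) :
    ∃ φ : D.obj ⟶ E.obj, S.HasScalarPart φ A B := by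
  obtain ⟨φ, h1, h2⟩ := complete_distinguished_triangle_morphism _ _ D.distinguished
    E.distinguished _ _ h
  exact ⟨φ, _, _, h, h1, h2, S.scalarMat_ofMat hA, S.scalarMat_ofMat hB⟩

open scoped Classical in
lemma HasScalarPart.isIso {φ : D.obj ⟶ D.obj} (h : S.HasScalarPart φ 1 1) : IsIso φ := by
  obtain ⟨t, s, h1, h2, h3, ht, hs⟩ := h
  let T : Triangle C := Triangle.mk D.a D.g D.h
  let f : T ⟶ T := { hom₁ := t, hom₂ := s, hom₃ := φ, comm₁ := h1, comm₂ := h2, comm₃ := h3 }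
  exact isIso₃_of_isIso₁₂ f D.distinguished D.distinguished (S.isIso_of_scalarMat_eq_one ht)
    (S.isIso_of_scalarMat_eq_one hs)

end

/-! ### Dual morphisms -/

/-- The scalar parts of the two morphisms are transposed to each other. -/
def IsDual {D E : TwoTerm R} (φ : D.obj ⟶ E.obj) (φ' : (S.dual E).obj ⟶ (S.dual D).obj) : Prop :=
  ∃ (A : Matrix D.I₁ E.I₁ K) (B : Matrix D.I₀ E.I₀ K),
    S.HasScalarPart φ A B ∧ S.HasScalarPart φ' B.transpose A.transpose

section

variable {S} {D E F : TwoTerm R}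

/-- The dual morphism is determined only up to morphisms with zero scalar part, so duality is kept
as a relation: a dual of an identity is merely an isomorphism (`IsDual.isIso`). -/
lemma exists_isDual (S : SymmetricGenerator K Λ R) (hDE : Geq D.obj E.obj) (φ : D.obj ⟶ E.obj) :
    ∃ φ', S.IsDual φ φ' := by
  obtain ⟨A, B, h⟩ := S.exists_hasScalarPart φ
  have h1 := congrArg S.tr (h.comm (S.disjoint_of_geq hDE))
  rw [tr_comp_ofMat, tr_ofMat_comp] at h1
  obtain ⟨φ', h'⟩ := exists_of_comm (S := S) (D := S.dual E) (E := S.dual D)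
    h.isSupported.2.transpose h.isSupported.1.transpose h1.symm
  exact ⟨φ', A, B, h, h'⟩

lemma IsDual.comp {φ : D.obj ⟶ E.obj} {ψ : E.obj ⟶ F.obj} {φ' ψ'} (h : S.IsDual φ φ')
    (h' : S.IsDual ψ ψ') : S.IsDual (φ ≫ ψ) (ψ' ≫ φ') := by
  obtain ⟨A, B, h1, h2⟩ := h
  obtain ⟨A', B', h1', h2'⟩ := h'
  refine ⟨_, _, h1.comp h1', ?_⟩
  rw [Matrix.transpose_mul, Matrix.transpose_mul]
  exact h2'.comp h2

lemma IsDual.add {φ ψ : D.obj ⟶ E.obj} {φ' ψ'} (h : S.IsDual φ φ')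
    (h' : S.IsDual ψ ψ') : S.IsDual (φ + ψ) (φ' + ψ') := by
  obtain ⟨A, B, h1, h2⟩ := h
  obtain ⟨A', B', h1', h2'⟩ := h'
  refine ⟨_, _, h1.add h1', ?_⟩
  rw [Matrix.transpose_add, Matrix.transpose_add]
  exact h2.add h2'

lemma IsDual.sub {φ ψ : D.obj ⟶ E.obj} {φ' ψ'} (h : S.IsDual φ φ')
    (h' : S.IsDual ψ ψ') : S.IsDual (φ - ψ) (φ' - ψ') := by
  obtain ⟨A, B, h1, h2⟩ := h
  obtain ⟨A', B', h1', h2'⟩ := h'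
  refine ⟨_, _, h1.sub h1', ?_⟩
  rw [Matrix.transpose_sub, Matrix.transpose_sub]
  exact h2.sub h2'

lemma isDual_zero : S.IsDual (0 : D.obj ⟶ E.obj) 0 :=
  ⟨0, 0, hasScalarPart_zero, by
    rw [Matrix.transpose_zero, Matrix.transpose_zero]; exact hasScalarPart_zero⟩

lemma isDual_sum {ι : Type*} (s : Finset ι) {φ : ι → (D.obj ⟶ E.obj)}
    {φ' : ι → ((S.dual E).obj ⟶ (S.dual D).obj)} (h : ∀ k, S.IsDual (φ k) (φ' k)) :
    S.IsDual (∑ k ∈ s, φ k) (∑ k ∈ s, φ' k) := by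
  classical
  induction s using Finset.induction_on with
  | empty => simpa using isDual_zero
  | insert k s hk ih =>
    rw [Finset.sum_insert hk, Finset.sum_insert hk]
    exact (h k).add ih

lemma isDual_id : S.IsDual (𝟙 D.obj) (𝟙 _) := by
  classical
  refine ⟨_, _, hasScalarPart_id, ?_⟩
  rw [Matrix.transpose_one, Matrix.transpose_one]
  exact hasScalarPart_id

open scoped Classical in
lemma IsDual.hasScalarPart_one {φ'} (h : S.IsDual (𝟙 D.obj) φ') : S.HasScalarPart φ' 1 1 := by
  obtain ⟨A, B, h1, h2⟩ := h
  obtain ⟨rfl, rfl⟩ := h1.unique hasScalarPart_id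
  rwa [Matrix.transpose_one, Matrix.transpose_one] at h2

lemma IsDual.isIso {φ'} (h : S.IsDual (𝟙 D.obj) φ') : IsIso φ' := h.hasScalarPart_one.isIso

/-- Used to correct chosen dual morphisms by an automorphism without leaving the relation. -/
lemma IsDual.inv {φ'} (h : S.IsDual (𝟙 D.obj) φ') [IsIso φ'] :
    S.IsDual (𝟙 D.obj) (inv φ') := by
  classical
  refine ⟨1, 1, hasScalarPart_id, ?_⟩
  rw [Matrix.transpose_one, Matrix.transpose_one]
  obtain ⟨A, B, h1⟩ := S.exists_hasScalarPart (D := S.dual D) (E := S.dual D) (CategoryTheory.inv φ')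
  have h2 := h.hasScalarPart_one.comp h1
  rw [IsIso.hom_inv_id] at h2
  obtain ⟨h3, h4⟩ := h2.unique hasScalarPart_id
  rw [one_mul] at h3 h4
  rwa [h3, h4] at h1

end

/-- The composites of the duals of `e.hom` and `e.inv` are dual to identities, hence invertible, so
a dual of `e.hom` has inverses on both sides. -/
lemma nonempty_iso_dual {D E : TwoTerm R} (h : Geq D.obj D.obj) (e : D.obj ≅ E.obj) :
    Nonempty ((S.dual D).obj ≅ (S.dual E).obj) := by
  have h1 : Geq D.obj E.obj := h.of_iso (Iso.refl _) e
  have h2 : Geq E.obj D.obj := h.of_iso e (Iso.refl _)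
  obtain ⟨φ, hφ⟩ := S.exists_isDual h1 e.hom
  obtain ⟨ψ, hψ⟩ := S.exists_isDual h2 e.inv
  have h3 := hφ.comp hψ
  rw [e.hom_inv_id] at h3
  have h4 := hψ.comp hφ
  rw [e.inv_hom_id] at h4
  have := h3.isIso
  have := h4.isIso
  have h5 : φ ≫ ψ ≫ CategoryTheory.inv (φ ≫ ψ) = 𝟙 _ := by
    rw [← Category.assoc, IsIso.hom_inv_id]
  have h6 : (CategoryTheory.inv (ψ ≫ φ) ≫ ψ) ≫ φ = 𝟙 _ := by
    rw [Category.assoc, IsIso.inv_hom_id]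
  have h7 : CategoryTheory.inv (ψ ≫ φ) ≫ ψ = ψ ≫ CategoryTheory.inv (φ ≫ ψ) := by
    rw [← Category.comp_id (CategoryTheory.inv (ψ ≫ φ) ≫ ψ), ← h5, ← Category.assoc, h6,
      Category.id_comp]
  exact ⟨(⟨φ, ψ ≫ CategoryTheory.inv (φ ≫ ψ), h5, by rw [← h7, h6]⟩ : _ ≅ _).symm⟩

lemma addHull_dual {D E : TwoTerm R} (h : Geq D.obj D.obj) (hE : addHull D.obj E.obj) :
    addHull (S.dual D).obj (S.dual E).obj := by
  obtain ⟨n, i, p, hip⟩ := addHull_iff_exists_sum.1 hE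
  have h1 : Geq D.obj E.obj := h.addHull (addHull_self _) hE
  have h2 : Geq E.obj D.obj := h.addHull hE (addHull_self _)
  choose i' hi' using fun k => S.exists_isDual h2 (i k)
  choose p' hp' using fun k => S.exists_isDual h1 (p k)
  have h3 := isDual_sum Finset.univ fun k => (hi' k).comp (hp' k)
  rw [hip] at h3
  have := h3.isIso
  refine addHull_of_sum p' (fun k => i' k ≫ CategoryTheory.inv (∑ k, p' k ≫ i' k)) ?_
  simp only [← Category.assoc]
  rw [← Preadditive.sum_comp, IsIso.hom_inv_id]

/-- The dual inclusions and projections satisfy the biproduct relations only up to zero scalar part,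
and are corrected in Gram–Schmidt fashion until the relations hold exactly. -/
lemma nonempty_dual_iso_biprod {D E F : TwoTerm R} (h : Geq D.obj D.obj)
    (e : D.obj ≅ E.obj ⊞ F.obj) :
    Nonempty ((S.dual D).obj ≅ (S.dual E).obj ⊞ (S.dual F).obj) := by
  have hE : addHull D.obj E.obj := (addHull_self D.obj).of_retract
    ⟨biprod.inl ≫ e.inv, e.hom ≫ biprod.fst, by simp⟩
  have hF : addHull D.obj F.obj := (addHull_self D.obj).of_retract
    ⟨biprod.inr ≫ e.inv, e.hom ≫ biprod.snd, by simp⟩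
  obtain ⟨p₁, hp₁⟩ := S.exists_isDual (h.addHull (addHull_self _) hE) (e.hom ≫ biprod.fst)
  obtain ⟨i₁, hi₁⟩ := S.exists_isDual (h.addHull hE (addHull_self _)) (biprod.inl ≫ e.inv)
  obtain ⟨p₂, hp₂⟩ := S.exists_isDual (h.addHull (addHull_self _) hF) (e.hom ≫ biprod.snd)
  obtain ⟨i₂, hi₂⟩ := S.exists_isDual (h.addHull hF (addHull_self _)) (biprod.inr ≫ e.inv)
  have h1 := hi₁.comp hp₁
  rw [show (biprod.inl ≫ e.inv) ≫ e.hom ≫ biprod.fst = 𝟙 E.obj by simp] at h1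
  have := h1.isIso
  replace hi₁ := h1.inv.comp hi₁
  rw [Category.id_comp] at hi₁
  set j₁ := i₁ ≫ CategoryTheory.inv (p₁ ≫ i₁) with hj₁
  have h11 : p₁ ≫ j₁ = 𝟙 _ := by rw [hj₁, ← Category.assoc, IsIso.hom_inv_id]
  have h3 := isDual_id.sub (hp₁.comp hi₁)
  -- The idempotent complementary to the first summand; composing with it makes the second pair of
  -- maps orthogonal to the first.
  set d := 𝟙 _ - j₁ ≫ p₁ with hd
  have h4 : p₁ ≫ d = 0 := by
    rw [hd, Preadditive.comp_sub, ← Category.assoc, h11, Category.comp_id, Category.id_comp,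
      sub_self]
  have h5 : d ≫ j₁ = 0 := by
    rw [hd, Preadditive.sub_comp, Category.assoc, h11, Category.comp_id, Category.id_comp,
      sub_self]
  have h6 := h3.comp hp₂
  rw [show (𝟙 D.obj - (e.hom ≫ biprod.fst) ≫ biprod.inl ≫ e.inv) ≫ e.hom ≫ biprod.snd =
    e.hom ≫ biprod.snd by simp] at h6
  have h7 := hi₂.comp h3
  rw [show (biprod.inr ≫ e.inv) ≫ (𝟙 D.obj - (e.hom ≫ biprod.fst) ≫ biprod.inl ≫ e.inv) =
    biprod.inr ≫ e.inv by simp] at h7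
  have h8 := h7.comp h6
  rw [show (biprod.inr ≫ e.inv) ≫ e.hom ≫ biprod.snd = 𝟙 F.obj by simp] at h8
  have := h8.isIso
  replace h7 := h8.inv.comp h7
  rw [Category.id_comp] at h7
  set q₂ := p₂ ≫ d with hq₂
  set j₂ := (d ≫ i₂) ≫ CategoryTheory.inv (q₂ ≫ d ≫ i₂) with hj₂
  have h22 : q₂ ≫ j₂ = 𝟙 _ := by rw [hj₂, ← Category.assoc, IsIso.hom_inv_id]
  have h12 : p₁ ≫ j₂ = 0 := by
    rw [hj₂, ← Category.assoc, ← Category.assoc, h4, zero_comp, zero_comp]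
  have h21 : q₂ ≫ j₁ = 0 := by rw [hq₂, Category.assoc, h5, comp_zero]
  have h9 := (hp₁.comp hi₁).add (h6.comp h7)
  rw [show (e.hom ≫ biprod.fst) ≫ biprod.inl ≫ e.inv + (e.hom ≫ biprod.snd) ≫ biprod.inr ≫ e.inv
    = 𝟙 D.obj by
      simp only [Category.assoc, ← Preadditive.comp_add]
      simp only [← Category.assoc, ← Preadditive.add_comp, biprod.total]
      simp] at h9
  have h10 := h9.isIso
  refine nonempty_iso_biprod_of_sum h11 h22 ?_
  -- The sum of the two orthogonal idempotents is idempotent, and it is invertible because it is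
  -- dual to an identity; so it is the identity.
  rw [← cancel_epi (j₁ ≫ p₁ + j₂ ≫ q₂)]
  simp only [Preadditive.add_comp, Preadditive.comp_add, Category.assoc, Category.comp_id]
  simp only [← Category.assoc p₁, ← Category.assoc q₂, h11, h12, h21, h22, zero_comp, comp_zero,
    Category.id_comp, add_zero, zero_add]

end SymmetricGenerator

end TwoTerm

/-! ### Radical presentations, and invariance of silting objects under transposition. -/

section Presentations

variable {C : Type u} [Category.{v} C] [Preadditive C] [HasZeroObject C] [HasShift C ℤ]
  [∀ n : ℤ, (shiftFunctor C n).Additive] [Pretriangulated C]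

lemma IsRightApprox.iso_comp {T Q Q' X : C} {π : Q ⟶ X} (hπ : IsRightApprox T π) (e : Q' ≅ Q) :
    IsRightApprox T (e.hom ≫ π) := by
  refine ⟨hπ.1.of_iso e, fun N hN g => ?_⟩
  obtain ⟨h, rfl⟩ := hπ.2 N hN g
  exact ⟨h ≫ e.inv, by simp⟩

lemma IsLeftApprox.comp_iso {T Q Q' X : C} {π : X ⟶ Q} (hπ : IsLeftApprox T π) (e : Q ≅ Q') :
    IsLeftApprox T (π ≫ e.hom) := by
  refine ⟨hπ.1.of_iso e.symm, fun N hN g => ?_⟩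
  obtain ⟨h, rfl⟩ := hπ.2 N hN g
  exact ⟨e.inv ≫ h, by simp⟩

lemma indecomposable_of_iso {X Y : C} (e : X ≅ Y) (hX : Indecomposable X) : Indecomposable Y :=
  ⟨fun h => hX.1 (h.of_iso e), fun Z W e' => hX.2 Z W (e ≪≫ e')⟩

lemma distTriang_of_iso₁ {X X' Y Z : C} {f : X ⟶ Y} {g : Y ⟶ Z}
    {h : Z ⟶ (shiftFunctor C (1 : ℤ)).obj X} (hT : Triangle.mk f g h ∈ distTriang C)
    (e : X ≅ X') :
    Triangle.mk (e.inv ≫ f) g (h ≫ (shiftFunctor C (1 : ℤ)).map e.hom) ∈ distTriang C := by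
  refine isomorphic_distinguished _ hT _ (Triangle.isoMk _ _ e.symm (Iso.refl _) (Iso.refl _) ?_ ?_ ?_)
  · exact Category.comp_id _
  · exact (Category.comp_id _).trans (Category.id_comp _).symm
  · change (h ≫ (shiftFunctor C (1 : ℤ)).map e.hom) ≫ (shiftFunctor C (1 : ℤ)).map e.inv = 𝟙 _ ≫ h
    rw [Category.assoc, ← Functor.map_comp, e.hom_inv_id, CategoryTheory.Functor.map_id,
      Category.comp_id, Category.id_comp]

lemma nonempty_iso_of_distTriang {X Y Z Z' : C} {f : X ⟶ Y} {g : Y ⟶ Z}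
    {h : Z ⟶ (shiftFunctor C (1 : ℤ)).obj X} {g' : Y ⟶ Z'}
    {h' : Z' ⟶ (shiftFunctor C (1 : ℤ)).obj X} (hT : Triangle.mk f g h ∈ distTriang C)
    (hT' : Triangle.mk f g' h' ∈ distTriang C) : Nonempty (Z ≅ Z') :=
  ⟨Triangle.π₃.mapIso (isoTriangleOfIso₁₂ _ _ hT hT' (Iso.refl _) (Iso.refl _)
    ((Category.comp_id f).trans (Category.id_comp f).symm))⟩

/-- The cocone of a right `addHull T`-approximation of `V[1]` with `V ∈ addHull R`. -/
lemma geq_of_rightApprox {R T V X Q : C} {f : V ⟶ X} {g : X ⟶ Q}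
    {w : Q ⟶ (shiftFunctor C (1 : ℤ)).obj V} (hR : Geq R R) (hV : addHull R V)
    (h₁ : Geq R T) (h₂ : Geq T ((shiftFunctor C (1 : ℤ)).obj R)) (hT : Geq T T)
    (hw : IsRightApprox T w) (h : Triangle.mk f g w ∈ distTriang C) :
    Geq T X ∧ Geq X T ∧ Geq X X ∧ Geq R X ∧ Geq X ((shiftFunctor C (1 : ℤ)).obj R) := by
  have h₂' : ∀ n : ℤ, 1 < n → HomVanishes T R n := fun n hn =>
    (HomVanishes.shift_right_iff 1 (n - 1) n (by omega)).1 (h₂.homVanishes (by omega))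
  have hQ := hw.1
  have a1 : Geq T X := fun n hn => by
    by_cases hn1 : n = 1
    · subst hn1
      intro φ
      have hr : Triangle.mk g w (-(shiftFunctor C (1 : ℤ)).map f) ∈ distTriang C :=
        rot_of_distTriang _ h
      obtain ⟨ψ, hψ⟩ := distTriang_lift₁ hr φ
        (((hT.homVanishes one_pos).addHull_right hQ) _)
      obtain ⟨χ, rfl⟩ := hw.2 T (addHull_self T) ψ
      rw [hψ, Category.assoc, distTriang_comp₂₃ hr, comp_zero]
    · exact HomVanishes.right₂ h ((h₂' n (by omega)).addHull_right hV)
        ((hT.homVanishes hn).addHull_right hQ)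
  have a2 : Geq R X := fun n hn => HomVanishes.right₂ h ((hR.homVanishes hn).addHull_right hV)
    ((h₁.homVanishes hn).addHull_right hQ)
  refine ⟨a1, fun n hn => ?_, fun n hn => ?_, a2, fun n hn => ?_⟩
  · exact HomVanishes.left₂ h ((h₁.homVanishes hn).addHull_left hV)
      ((hT.homVanishes hn).addHull_left hQ)
  · exact HomVanishes.left₂ h ((a2.homVanishes hn).addHull_left hV)
      ((a1.homVanishes hn).addHull_left hQ)
  · refine HomVanishes.left₂ h ?_ ((h₂.homVanishes hn).addHull_left hQ)
    exact (HomVanishes.shift_right_iff 1 n (n + 1) (by omega)).2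
      ((hR.homVanishes (by omega)).addHull_left hV)

variable {K : Type*} [Field K] [Linear K C] [∀ X Y : C, Module.Finite K (X ⟶ Y)]
  {Λ : Type*} [Ring Λ] [Algebra K Λ] {R : C} (S : SymmetricGenerator K Λ R)

namespace SymmetricGenerator

/-- If a relation `a` has an invertible entry in column `l`, the restriction of `π` to the summand
`l` is expressed through the other summands, which may then be kept alone. -/
lemma exists_smaller_rightApprox {I J : Type} [Fintype I] [DecidableEq I] [Fintype J] {x : I → Ind R}
    {y : J → Ind R} {M T : C} {π : sumObj x ⟶ T} (hπ : IsRightApprox M π)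
    {a : sumObj y ⟶ sumObj x} (ha : a ≫ π = 0) {k : J} {l : I}
    (hkl : IsIso (biproduct.components a k l)) :
    ∃ π' : (sumObj fun i : {i // i ≠ l} => x i) ⟶ T, IsRightApprox M π' := by
  let F : I → C := fun i => (x i).obj
  let ρ : sumObj x ⟶ sumObj fun i : {i // i ≠ l} => x i :=
    biproduct.lift fun i => biproduct.π F i
  let j : (sumObj fun i : {i // i ≠ l} => x i) ⟶ sumObj x := biproduct.desc fun i => biproduct.ι F i
  have h1 : ρ ≫ j = 𝟙 _ - biproduct.π F l ≫ biproduct.ι F l := by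
    rw [eq_sub_iff_add_eq, add_comm, ← biproduct.total, biproduct.lift_desc,
      Fintype.sum_eq_add_sum_subtype_ne (fun i => biproduct.π F i ≫ biproduct.ι F i) l]
  set c := biproduct.components a k l with hc
  have h2 : c ≫ biproduct.ι F l ≫ π = - biproduct.ι (fun i => (y i).obj) k ≫ a ≫ ρ ≫ j ≫ π := by
    rw [← Category.assoc ρ, h1, Preadditive.sub_comp, Category.id_comp, Preadditive.comp_sub, ha,
      zero_sub, Preadditive.comp_neg, neg_neg, hc]
    simp [biproduct.components, F]
  have h3 : π = (ρ - biproduct.π F l ≫ inv c ≫ biproduct.ι (fun i => (y i).obj) k ≫ a ≫ ρ) ≫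
      j ≫ π := by
    have h4 : biproduct.ι F l ≫ π = - inv c ≫ biproduct.ι (fun i => (y i).obj) k ≫ a ≫ ρ ≫ j ≫ π := by
      rw [← cancel_epi c, h2, Preadditive.comp_neg, IsIso.hom_inv_id_assoc]
    rw [Preadditive.sub_comp, ← Category.assoc ρ, h1, Preadditive.sub_comp, Category.id_comp,
      Category.assoc, h4]
    simp
  refine ⟨j ≫ π, addHull_biproduct fun i => addHull.of_retract
    (⟨biproduct.ι F i, biproduct.π F i, by simp⟩ : Retract (F i) (sumObj x)) hπ.1, fun N hN g => ?_⟩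
  obtain ⟨h, rfl⟩ := hπ.2 N hN g
  exact ⟨h ≫ (ρ - biproduct.π F l ≫ inv c ≫ biproduct.ι (fun i => (y i).obj) k ≫ a ≫ ρ), by
    rw [Category.assoc, ← h3]⟩

/-- A right approximation all of whose relations are radical. -/
lemma exists_radical_rightApprox {M : C} (hM : addHull R M) (T : C) :
    ∃ (I : Type) (_ : Fintype I) (x : I → Ind R) (π : sumObj x ⟶ T), IsRightApprox M π ∧
      ∀ (J : Type) [Fintype J] (y : J → Ind R)
      (a : sumObj y ⟶ sumObj x), a ≫ π = 0 → a ∈ S.rad _ _ := by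
  classical
  -- An approximation with the least number of summands admits no invertible entry in a relation.
  have hex : ∃ n, ∃ (I : Type) (_ : Fintype I) (x : I → Ind R) (π : sumObj x ⟶ T),
      IsRightApprox M π ∧ Fintype.card I = n := by
    obtain ⟨n, π, hπ⟩ := exists_rightApprox K M T
    obtain ⟨I, _, x, ⟨e⟩⟩ := exists_iso_sumObj K (addHull_biproduct fun _ : Fin n => hM)
    exact ⟨_, I, _, x, _, hπ.iso_comp e.symm, rfl⟩
  obtain ⟨I, _, x, π, hπ, hI⟩ := Nat.find_spec hex
  refine ⟨I, _, x, π, hπ, fun J _ y a ha => (S.mem_rad_iff_components a).2 fun k l => ?_⟩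
  refine S.mem_rad_of_not_isIso (y k).addHull (y k).indecomposable (x l).addHull
    (x l).indecomposable fun hkl => ?_
  obtain ⟨π', hπ'⟩ := exists_smaller_rightApprox hπ ha hkl
  have h1 := Nat.find_min' hex ⟨_, _, _, π', hπ', rfl⟩
  rw [← hI] at h1
  exact absurd (Fintype.card_subtype_lt (p := fun i => i ≠ l) (x := l) (by simp)) (not_lt.2 h1)

lemma exists_smaller_leftApprox {I J : Type} [Fintype I] [DecidableEq I] [Fintype J] {x : I → Ind R}
    {y : J → Ind R} {M T : C} {π : T ⟶ sumObj x} (hπ : IsLeftApprox M π)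
    {a : sumObj x ⟶ sumObj y} (ha : π ≫ a = 0) {k : J} {l : I}
    (hkl : IsIso (biproduct.components a l k)) :
    ∃ π' : T ⟶ (sumObj fun i : {i // i ≠ l} => x i), IsLeftApprox M π' := by
  let F : I → C := fun i => (x i).obj
  let ρ : sumObj x ⟶ sumObj fun i : {i // i ≠ l} => x i :=
    biproduct.lift fun i => biproduct.π F i
  let j : (sumObj fun i : {i // i ≠ l} => x i) ⟶ sumObj x := biproduct.desc fun i => biproduct.ι F i
  have h1 : ρ ≫ j = 𝟙 _ - biproduct.π F l ≫ biproduct.ι F l := by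
    rw [eq_sub_iff_add_eq, add_comm, ← biproduct.total, biproduct.lift_desc,
      Fintype.sum_eq_add_sum_subtype_ne (fun i => biproduct.π F i ≫ biproduct.ι F i) l]
  set c := biproduct.components a l k with hc
  let q := j ≫ a ≫ biproduct.π (fun i => (y i).obj) k
  have h2 : (π ≫ biproduct.π F l) ≫ c = - π ≫ ρ ≫ q := by
    rw [← Category.assoc ρ, h1, Preadditive.sub_comp, Category.id_comp, Preadditive.comp_sub,
      ← Category.assoc π a, ha, zero_comp, zero_sub, neg_neg, hc]
    simp [biproduct.components, F]
  have h4 : π ≫ biproduct.π F l = - π ≫ ρ ≫ q ≫ inv c := by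
    rw [← cancel_mono c, h2, Preadditive.neg_comp]
    simp
  have h3 : π = (π ≫ ρ) ≫ (j - q ≫ inv c ≫ biproduct.ι F l) := by
    rw [Preadditive.comp_sub, Category.assoc, h1, Preadditive.comp_sub, Category.comp_id,
      ← Category.assoc π (biproduct.π F l), h4]
    simp
  refine ⟨π ≫ ρ, addHull_biproduct fun i => addHull.of_retract
    (⟨biproduct.ι F i, biproduct.π F i, by simp⟩ : Retract (F i) (sumObj x)) hπ.1, fun N hN g => ?_⟩
  obtain ⟨h, rfl⟩ := hπ.2 N hN g
  exact ⟨(j - q ≫ inv c ≫ biproduct.ι F l) ≫ h, by rw [← Category.assoc, ← h3]⟩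

/-- A left approximation all of whose relations are radical. -/
lemma exists_radical_leftApprox {M : C} (hM : addHull R M) (T : C) :
    ∃ (I : Type) (_ : Fintype I) (x : I → Ind R) (π : T ⟶ sumObj x), IsLeftApprox M π ∧
      ∀ (J : Type) [Fintype J] (y : J → Ind R) (a : sumObj x ⟶ sumObj y),
        π ≫ a = 0 → a ∈ S.rad _ _ := by
  classical
  have hex : ∃ n, ∃ (I : Type) (_ : Fintype I) (x : I → Ind R) (π : T ⟶ sumObj x),
      IsLeftApprox M π ∧ Fintype.card I = n := by
    obtain ⟨n, π, hπ⟩ := exists_leftApprox K M T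
    obtain ⟨I, _, x, ⟨e⟩⟩ := exists_iso_sumObj K (addHull_biproduct fun _ : Fin n => hM)
    exact ⟨_, I, _, x, _, hπ.comp_iso e, rfl⟩
  obtain ⟨I, _, x, π, hπ, hI⟩ := Nat.find_spec hex
  refine ⟨I, _, x, π, hπ, fun J _ y a ha => (S.mem_rad_iff_components a).2 fun l k => ?_⟩
  refine S.mem_rad_of_not_isIso (x l).addHull (x l).indecomposable (y k).addHull
    (y k).indecomposable fun hkl => ?_
  obtain ⟨π', hπ'⟩ := exists_smaller_leftApprox hπ ha hkl
  have h1 := Nat.find_min' hex ⟨_, _, _, π', hπ', rfl⟩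
  rw [← hI] at h1
  exact absurd (Fintype.card_subtype_lt (p := fun i => i ≠ l) (x := l) (by simp)) (not_lt.2 h1)

include S in
-- If `t ≫ π = π`, then `𝟙 - t` is a relation, hence radical, and `t` is invertible.
lemma exists_minimalRightApprox {M : C} (hM : addHull R M) (T : C) :
    ∃ (I : Type) (_ : Fintype I) (x : I → Ind R) (π : sumObj x ⟶ T),
      IsMinimalRightApprox M π := by
  obtain ⟨I, _, x, π, hπ, h⟩ := S.exists_radical_rightApprox hM T
  exact ⟨I, _, x, π, hπ.1, hπ.2, fun t ht => S.isIso_of_rad (addHull_sumObj x)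
    (h _ _ _ (by rw [Preadditive.sub_comp, ht, Category.id_comp, sub_self]))⟩

include S in
lemma exists_minimalLeftApprox {M : C} (hM : addHull R M) (T : C) :
    ∃ (I : Type) (_ : Fintype I) (x : I → Ind R) (π : T ⟶ sumObj x),
      IsMinimalLeftApprox M π := by
  obtain ⟨I, _, x, π, hπ, h⟩ := S.exists_radical_leftApprox hM T
  exact ⟨I, _, x, π, hπ.1, hπ.2, fun t ht => S.isIso_of_rad (addHull_sumObj x)
    (h _ _ _ (by rw [Preadditive.comp_sub, ht, Category.comp_id, sub_self]))⟩

variable [IsAlgClosed K]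

include S in
-- The cocone `Q` of a radical approximation of `T` by projectives satisfies `R ≥ Q ≥ R`, so it is
-- itself projective. The differential is radical, and `Hom(T, T[1]) = 0` excludes common summands.
lemma exists_twoTerm {T : C} (h₁ : Geq R T) (h₂ : Geq T ((shiftFunctor C (1 : ℤ)).obj R))
    (hT : Geq T T) : ∃ D : TwoTerm R, Nonempty (T ≅ D.obj) := by
  have h₂' : ∀ n : ℤ, 1 < n → HomVanishes T R n := fun n hn =>
    (HomVanishes.shift_right_iff 1 (n - 1) n (by omega)).1 (h₂.homVanishes (by omega))
  obtain ⟨I, _, x, π, hπ, hrad⟩ := S.exists_radical_rightApprox (addHull_self R) T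
  obtain ⟨Q, f, h, hQ⟩ := Pretriangulated.distinguished_cocone_triangle₁ π
  have hR : ∀ n : ℤ, 0 < n → HomVanishes R (sumObj x) n := fun n hn =>
    S.homVanishes_of_addHull (addHull_self R) (addHull_sumObj x) hn.ne'
  have a1 : Geq R Q := fun n hn => by
    by_cases hn1 : n = 1
    · subst hn1
      intro φ
      obtain ⟨ψ, rfl⟩ := distTriang_lift₁ hQ φ (hR 1 one_pos _)
      obtain ⟨χ, rfl⟩ := hπ.2 R (addHull_self R) ψ
      rw [Category.assoc, distTriang_comp₂₃ hQ, comp_zero]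
    · exact HomVanishes.right₁ hQ (h₁.homVanishes (by omega)) (hR n hn)
  have a2 : Geq Q R := fun n hn => HomVanishes.left₁ hQ (h₂' _ (by omega))
    (S.homVanishes_of_addHull (addHull_sumObj x) (addHull_self R) hn.ne')
  obtain ⟨J, _, y, ⟨e⟩⟩ := exists_iso_sumObj K (addHull_of_geq_geq K S.isSilting a1 a2)
  have hQ' := distTriang_of_iso₁ hQ e
  have ha := hrad J y _ (distTriang_comp₁₂ hQ')
  let D : TwoTerm R :=
    { I₁ := J
      I₀ := I
      x₁ := y
      x₀ := x
      a := e.inv ≫ f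
      disjoint := S.disjoint_of_homVanishes_one hQ' hQ' ha ha (hT.homVanishes one_pos) }
  exact ⟨D, nonempty_iso_of_distTriang hQ' D.distinguished⟩

include S in
lemma exists_twoTerm_of_addHull {D : TwoTerm R} (hD : Geq D.obj D.obj) {T : C}
    (hT : addHull D.obj T) : ∃ E : TwoTerm R, Nonempty (T ≅ E.obj) :=
  S.exists_twoTerm ((S.geq_obj D).addHull (addHull_self _) hT)
    ((S.obj_geq_shift D).addHull hT (addHull_self _)) (hD.addHull hT hT)

include S in
-- A silting criterion visibly stable under `dual`. For generation, a right approximation of `R[1]`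
-- gives a triangle `R ⟶ X ⟶ Q ⟶ R[1]` with `Q` in the additive hull of `D.obj`. Maximality puts `X`
-- there too, and then `R` lies in the thick closure.
lemma isSilting_iff {D : TwoTerm R} : IsSilting D.obj ↔ Geq D.obj D.obj ∧
    ∀ E : TwoTerm R, Geq E.obj E.obj → Geq D.obj E.obj → Geq E.obj D.obj →
      addHull D.obj E.obj := by
  refine ⟨fun h => ⟨h.1, fun E _ h₁ h₂ => addHull_of_geq_geq K h h₁ h₂⟩, fun ⟨h, H⟩ => ⟨h, ?_⟩⟩
  obtain ⟨n, w, hw⟩ := exists_rightApprox K D.obj ((shiftFunctor C (1 : ℤ)).obj R)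
  obtain ⟨X, f, g, hX⟩ := Pretriangulated.distinguished_cocone_triangle₂ w
  obtain ⟨h1, h2, h3, h4, h5⟩ := geq_of_rightApprox S.isSilting.1 (addHull_self R) (S.geq_obj D)
    (S.obj_geq_shift D) h hw hX
  obtain ⟨E, ⟨e⟩⟩ := S.exists_twoTerm h4 h5 h3
  have hE : addHull D.obj X := (H E (h3.of_iso e e) (h1.of_iso (Iso.refl _) e)
    (h2.of_iso e (Iso.refl _))).of_iso e
  intro Q hQ hQ' hD
  refine S.thick Q hQ hQ' ?_
  have key : ∀ Y, addHull D.obj Y → Q Y := by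
    rintro Y ⟨m, ⟨r⟩⟩
    refine ObjectProperty.prop_of_retract Q r ?_
    clear r
    induction m with
    | zero =>
      refine ObjectProperty.prop_of_isZero Q ?_
      rw [IsZero.iff_id_eq_zero]
      ext k
      exact k.elim0
    | succ m ih =>
      obtain ⟨e⟩ := nonempty_iso_biproduct_fin_succ fun _ : Fin (m + 1) => D.obj
      refine ObjectProperty.prop_of_iso Q e.symm ?_
      exact ObjectProperty.ext_of_isTriangulatedClosed₂ Q _
        (binaryBiproductTriangle_distinguished _ _) hD ih
  exact ObjectProperty.ext_of_isTriangulatedClosed₁ Q _ hX (key _ hE) (key _ hw.1)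

lemma isSilting_dual {D : TwoTerm R} (h : IsSilting D.obj) : IsSilting (S.dual D).obj := by
  obtain ⟨h1, h2⟩ := S.isSilting_iff.1 h
  refine S.isSilting_iff.2 ⟨S.geq_dual h1, fun E hE hDE hED => ?_⟩
  have h3 := S.geq_dual hDE
  have h4 := S.geq_dual hED
  rw [dual_dual] at h3 h4
  have h5 := S.addHull_dual h1 (h2 _ (S.geq_dual hE) h4 h3)
  rwa [dual_dual] at h5

lemma isZero_dual {D : TwoTerm R} (h : IsZero D.obj) : IsZero (S.dual D).obj := by
  rw [IsZero.iff_id_eq_zero] at h ⊢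
  have h1 : S.IsDual (𝟙 D.obj) 0 := by
    rw [h]
    exact isDual_zero
  have : IsIso (0 : (S.dual D).obj ⟶ (S.dual D).obj) := h1.isIso
  rw [← IsIso.hom_inv_id (0 : (S.dual D).obj ⟶ (S.dual D).obj), zero_comp]

lemma isZero_of_isZero_dual {D : TwoTerm R} (h : IsZero (S.dual D).obj) : IsZero D.obj := by
  have := S.isZero_dual h
  rwa [dual_dual] at this

/-- A decomposition of the dual transposes back to a decomposition of `D.obj`, as `dual` is an
involution that detects zero objects. -/
lemma indecomposable_dual {D : TwoTerm R} (h : Geq D.obj D.obj) (hD : Indecomposable D.obj) :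
    Indecomposable (S.dual D).obj := by
  refine ⟨fun h0 => hD.1 (S.isZero_of_isZero_dual h0), fun Y Z e => ?_⟩
  have h' := S.geq_dual h
  obtain ⟨E, ⟨eE⟩⟩ := S.exists_twoTerm_of_addHull h' ((addHull_self _).of_retract
    (⟨biprod.inl ≫ e.inv, e.hom ≫ biprod.fst, by simp⟩ : Retract Y _))
  obtain ⟨F, ⟨eF⟩⟩ := S.exists_twoTerm_of_addHull h' ((addHull_self _).of_retract
    (⟨biprod.inr ≫ e.inv, e.hom ≫ biprod.snd, by simp⟩ : Retract Z _))
  obtain ⟨e'⟩ := S.nonempty_dual_iso_biprod h' (e ≪≫ biprod.mapIso eE eF)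
  rw [dual_dual] at e'
  exact (hD.2 _ _ e').imp (fun h0 => (S.isZero_of_isZero_dual h0).of_iso eE)
    fun h0 => (S.isZero_of_isZero_dual h0).of_iso eF

lemma exists_dual_iso_biproduct {n : ℕ} (Z : Fin n → C) {D : TwoTerm R} (h : Geq D.obj D.obj)
    (e : D.obj ≅ ⨁ Z) : ∃ E : Fin n → TwoTerm R, (∀ k, Nonempty (Z k ≅ (E k).obj)) ∧
      Nonempty ((S.dual D).obj ≅ ⨁ fun k => (S.dual (E k)).obj) := by
  induction n generalizing D with
  | zero =>
    have h0 : ∀ W : Fin 0 → C, IsZero (⨁ W) := fun W => by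
      rw [IsZero.iff_id_eq_zero]
      ext k
      exact k.elim0
    exact ⟨fun k => k.elim0, fun k => k.elim0, ⟨(S.isZero_dual ((h0 _).of_iso e)).iso (h0 _)⟩⟩
  | succ n ih =>
    obtain ⟨e₁⟩ := nonempty_iso_biproduct_fin_succ Z
    obtain ⟨E, ⟨eE⟩⟩ := S.exists_twoTerm_of_addHull h ((addHull_self _).of_retract
      (⟨biprod.inl ≫ (e ≪≫ e₁).inv, (e ≪≫ e₁).hom ≫ biprod.fst, by simp⟩ : Retract (Z 0) _))
    have hF := (addHull_self _).of_retract
      (⟨biprod.inr ≫ (e ≪≫ e₁).inv, (e ≪≫ e₁).hom ≫ biprod.snd, by simp⟩ :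
        Retract (⨁ fun k => Z (Fin.succ k)) _)
    obtain ⟨F, ⟨eF⟩⟩ := S.exists_twoTerm_of_addHull h hF
    obtain ⟨e'⟩ := S.nonempty_dual_iso_biprod h (e ≪≫ e₁ ≪≫ biprod.mapIso eE eF)
    obtain ⟨E', hE', ⟨e''⟩⟩ := ih (fun k => Z (Fin.succ k)) ((h.addHull hF hF).of_iso eF eF) eF.symm
    refine ⟨Fin.cons E E', Fin.cases ⟨eE⟩ hE', ?_⟩
    obtain ⟨e₂⟩ := nonempty_iso_biproduct_fin_succ
      fun k => (S.dual ((Fin.cons E E' : Fin (n + 1) → TwoTerm R) k)).obj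
    exact ⟨e' ≪≫ biprod.mapIso (Iso.refl _) e'' ≪≫ e₂.symm⟩

lemma isBasic_dual {D : TwoTerm R} (h : Geq D.obj D.obj) (hD : IsBasic D.obj) :
    IsBasic (S.dual D).obj := by
  obtain ⟨n, Z, h1, h2, ⟨e⟩⟩ := hD
  obtain ⟨E, hE, e'⟩ := S.exists_dual_iso_biproduct Z h e
  have h3 : ∀ k, Geq (E k).obj (E k).obj := fun k => by
    have hk : addHull D.obj (Z k) := (addHull_self _).of_retract
      ⟨biproduct.ι Z k ≫ e.inv, e.hom ≫ biproduct.π Z k, by simp⟩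
    exact (h.addHull hk hk).of_iso (hE k).some (hE k).some
  refine ⟨n, _, fun k => S.indecomposable_dual (h3 k) ?_, fun k l hkl => ?_, e'⟩
  · exact indecomposable_of_iso (hE k).some (h1 k)
  · obtain ⟨e₁⟩ := hkl
    have h4 := S.nonempty_iso_dual (S.geq_dual (h3 k)) e₁
    rw [dual_dual, dual_dual] at h4
    exact h2 k l ⟨(hE k).some ≪≫ h4.some ≪≫ (hE l).some.symm⟩

include S in
-- If the class of `E.x₀ k` did not occur in `D`, the `(k, k)` entry of the scalar part of `𝟙 E.obj`
-- would vanish, since it is computed through matrices supported on equal classes.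
lemma exists_x₀_eq_of_addHull {D E : TwoTerm R} (h : addHull D.obj E.obj) (k : E.I₀) :
    ∃ l, D.x₀ l = E.x₀ k := by
  classical
  obtain ⟨n, i, p, hip⟩ := addHull_iff_exists_sum.1 h
  by_contra! hk
  choose A B hAB using fun j => S.exists_hasScalarPart (i j)
  choose A' B' hAB' using fun j => S.exists_hasScalarPart (p j)
  have h1 := HasScalarPart.sum Finset.univ fun j => (hAB j).comp (hAB' j)
  rw [hip] at h1
  have h2 := congrFun (congrFun (h1.unique hasScalarPart_id).2 k) k
  rw [Matrix.one_apply_eq, Matrix.sum_apply] at h2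
  refine one_ne_zero (h2.symm.trans (Finset.sum_eq_zero fun j _ => ?_))
  rw [Matrix.mul_apply]
  exact Finset.sum_eq_zero fun l _ => by rw [(hAB j).isSupported.2 k l (hk l).symm, zero_mul]

include S in
lemma exists_x₁_eq_of_addHull {D E : TwoTerm R} (h : addHull D.obj E.obj) (k : E.I₁) :
    ∃ l, D.x₁ l = E.x₁ k := by
  classical
  obtain ⟨n, i, p, hip⟩ := addHull_iff_exists_sum.1 h
  by_contra! hk
  choose A B hAB using fun j => S.exists_hasScalarPart (i j)
  choose A' B' hAB' using fun j => S.exists_hasScalarPart (p j)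
  have h1 := HasScalarPart.sum Finset.univ fun j => (hAB j).comp (hAB' j)
  rw [hip] at h1
  have h2 := congrFun (congrFun (h1.unique hasScalarPart_id).1 k) k
  rw [Matrix.one_apply_eq, Matrix.sum_apply] at h2
  refine one_ne_zero (h2.symm.trans (Finset.sum_eq_zero fun j _ => ?_))
  rw [Matrix.mul_apply]
  exact Finset.sum_eq_zero fun l _ => by rw [(hAB j).isSupported.1 k l (hk l).symm, zero_mul]

end SymmetricGenerator

end Presentations

/-! ### Shifts, basic objects, and which projectives occur in a silting object. -/

section Mutation

variable {C : Type u} [Category.{v} C] [Preadditive C] [HasZeroObject C] [HasShift C ℤ]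
  [∀ n : ℤ, (shiftFunctor C n).Additive] [Pretriangulated C]

lemma distTriang_of_iso₂₃ {X Y Z Y' Z' : C} {f : X ⟶ Y} {g : Y ⟶ Z}
    {h : Z ⟶ (shiftFunctor C (1 : ℤ)).obj X} (hT : Triangle.mk f g h ∈ distTriang C)
    (e : Y ≅ Y') (e' : Z ≅ Z') :
    Triangle.mk (f ≫ e.hom) (e.inv ≫ g ≫ e'.hom) (e'.inv ≫ h) ∈ distTriang C := by
  refine isomorphic_distinguished _ hT _ (Triangle.isoMk _ _ (Iso.refl _) e.symm e'.symm ?_ ?_ ?_)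
  · change (f ≫ e.hom) ≫ e.inv = 𝟙 _ ≫ f
    simp
  · change (e.inv ≫ g ≫ e'.hom) ≫ e'.inv = e.inv ≫ g
    simp
  · change (e'.inv ≫ h) ≫ (shiftFunctor C (1 : ℤ)).map (𝟙 X) = e'.inv ≫ h
    simp

lemma addHull_shift_iff {M X : C} : addHull ((shiftFunctor C (1 : ℤ)).obj M)
    ((shiftFunctor C (1 : ℤ)).obj X) ↔ addHull M X := by
  constructor
  · intro h
    obtain ⟨n, i, p, hip⟩ := addHull_iff_exists_sum.1 h
    choose i' hi' using fun k => (shiftFunctor C (1 : ℤ)).map_surjective (i k)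
    choose p' hp' using fun k => (shiftFunctor C (1 : ℤ)).map_surjective (p k)
    refine addHull_iff_exists_sum.2 ⟨n, i', p', (shiftFunctor C (1 : ℤ)).map_injective ?_⟩
    simp only [Functor.map_sum, Functor.map_comp, hi', hp', CategoryTheory.Functor.map_id, hip]
  · intro h
    obtain ⟨n, i, p, hip⟩ := addHull_iff_exists_sum.1 h
    refine addHull_iff_exists_sum.2 ⟨n, fun k => (shiftFunctor C (1 : ℤ)).map (i k),
      fun k => (shiftFunctor C (1 : ℤ)).map (p k), ?_⟩
    simp only [← Functor.map_comp, ← Functor.map_sum, hip, CategoryTheory.Functor.map_id]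

lemma exists_iso_shift (X : C) : ∃ Y : C, Nonempty (X ≅ (shiftFunctor C (1 : ℤ)).obj Y) :=
  ⟨_, ⟨(shiftFunctor C (1 : ℤ)).objObjPreimageIso X |>.symm⟩⟩

lemma isZero_shift_iff {X : C} : IsZero ((shiftFunctor C (1 : ℤ)).obj X) ↔ IsZero X := by
  rw [IsZero.iff_id_eq_zero, IsZero.iff_id_eq_zero, ← CategoryTheory.Functor.map_id,
    Functor.map_eq_zero_iff]

lemma indecomposable_shift_iff {X : C} :
    Indecomposable ((shiftFunctor C (1 : ℤ)).obj X) ↔ Indecomposable X := by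
  have := preservesBinaryBiproducts_of_preservesBiproducts (shiftFunctor C (1 : ℤ))
  constructor
  · intro h
    refine ⟨fun h0 => h.1 (isZero_shift_iff.2 h0), fun Y Z e => ?_⟩
    have := h.2 _ _ ((shiftFunctor C (1 : ℤ)).mapIso e ≪≫ (shiftFunctor C (1 : ℤ)).mapBiprod Y Z)
    exact this.imp isZero_shift_iff.1 isZero_shift_iff.1
  · intro h
    refine ⟨fun h0 => h.1 (isZero_shift_iff.1 h0), fun Y Z e => ?_⟩
    obtain ⟨Y', ⟨eY⟩⟩ := exists_iso_shift Y
    obtain ⟨Z', ⟨eZ⟩⟩ := exists_iso_shift Z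
    have := h.2 Y' Z' ((shiftFunctor C (1 : ℤ)).preimageIso
      (e ≪≫ biprod.mapIso eY eZ ≪≫ ((shiftFunctor C (1 : ℤ)).mapBiprod Y' Z').symm))
    exact this.imp (fun h0 => (isZero_shift_iff.2 h0).of_iso eY)
      fun h0 => (isZero_shift_iff.2 h0).of_iso eZ

lemma isBasic_shift_iff {X : C} : IsBasic ((shiftFunctor C (1 : ℤ)).obj X) ↔ IsBasic X := by
  constructor
  · rintro ⟨n, Z, h1, h2, ⟨e⟩⟩
    choose Y hY using fun k => exists_iso_shift (Z k)
    refine ⟨n, Y, fun k => ?_, fun k l ⟨e'⟩ => ?_, ?_⟩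
    · exact indecomposable_shift_iff.1 (indecomposable_of_iso (hY k).some (h1 k))
    · exact h2 k l ⟨(hY k).some ≪≫ (shiftFunctor C (1 : ℤ)).mapIso e' ≪≫ (hY l).some.symm⟩
    · exact ⟨(shiftFunctor C (1 : ℤ)).preimageIso (e ≪≫ biproduct.mapIso (fun k => (hY k).some) ≪≫
        ((shiftFunctor C (1 : ℤ)).mapBiproduct Y).symm)⟩
  · rintro ⟨n, Z, h1, h2, ⟨e⟩⟩
    refine ⟨n, fun k => (shiftFunctor C (1 : ℤ)).obj (Z k), fun k => indecomposable_shift_iff.2 (h1 k),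
      fun k l ⟨e'⟩ => h2 k l ⟨(shiftFunctor C (1 : ℤ)).preimageIso e'⟩,
      ⟨(shiftFunctor C (1 : ℤ)).mapIso e ≪≫ (shiftFunctor C (1 : ℤ)).mapBiproduct Z⟩⟩

lemma IsBasic.of_iso {X Y : C} (e : X ≅ Y) (h : IsBasic X) : IsBasic Y := by
  obtain ⟨n, Z, h1, h2, ⟨e'⟩⟩ := h
  exact ⟨n, Z, h1, h2, ⟨e.symm ≪≫ e'⟩⟩

variable {K : Type*} [Field K] [Linear K C] [∀ X Y : C, Module.Finite K (X ⟶ Y)]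
  {Λ : Type*} [Ring Λ] [Algebra K Λ] {R : C} (S : SymmetricGenerator K Λ R)

namespace SymmetricGenerator

lemma mem_rad_to_sumObj {I : Type} [Fintype I] {x : I → Ind R} {i : Ind R} (h : ∀ k, x k ≠ i)
    (f : i.obj ⟶ sumObj x) : f ∈ S.rad _ _ := by
  rw [← Category.comp_id f, ← biproduct.total, Preadditive.comp_sum]
  refine sum_mem fun k _ => ?_
  rw [← Category.assoc]
  exact S.rad_comp (S.mem_rad_of_ne (h k).symm _) _

lemma mem_rad_from_sumObj {I : Type} [Fintype I] {x : I → Ind R} {i : Ind R} (h : ∀ k, x k ≠ i)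
    (f : sumObj x ⟶ i.obj) : f ∈ S.rad _ _ := by
  rw [← Category.id_comp f, ← biproduct.total, Preadditive.sum_comp]
  refine sum_mem fun k _ => ?_
  rw [Category.assoc]
  exact S.comp_rad _ (S.mem_rad_of_ne (h k) _)

lemma id_not_mem_rad (i : Ind R) : 𝟙 i.obj ∉ S.rad _ _ := fun h =>
  S.not_isIso_of_mem_rad i.addHull i.indecomposable.1 h inferInstance

include S in
lemma exists_eq_of_addHull {I : Type} [Fintype I] {x : I → Ind R} {i : Ind R}
    (h : addHull (sumObj x) i.obj) : ∃ k, x k = i := by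
  by_contra! hx
  obtain ⟨n, a, p, hap⟩ := addHull_iff_exists_sum.1 h
  refine S.id_not_mem_rad i ?_
  rw [← hap]
  exact sum_mem fun k _ => S.rad_comp (S.mem_rad_to_sumObj hx _) _

variable [IsAlgClosed K]

include S in
/-- In a silting object every indecomposable projective occurs. -/
lemma exists_eq_of_isSilting {D : TwoTerm R} (hD : IsSilting D.obj) (i : Ind R) :
    (∃ l, D.x₀ l = i) ∨ ∃ l, D.x₁ l = i := by
  by_contra! hi
  obtain ⟨h₀, h₁⟩ := hi
  -- In the triangle `i ⟶ X ⟶ Q ⟶ i[1]` with first map `u`, both `X` and `Q` lie in the additive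
  -- hull of `D.obj`, so neither has `i` as a summand of its terms. The plan is to show `u = 0`.
  obtain ⟨n, w, hw⟩ := exists_rightApprox K D.obj ((shiftFunctor C (1 : ℤ)).obj i.obj)
  obtain ⟨X, u, r, hX⟩ := Pretriangulated.distinguished_cocone_triangle₂ w
  obtain ⟨h1, h2, -⟩ := geq_of_rightApprox S.isSilting.1 i.addHull (S.geq_obj D)
    (S.obj_geq_shift D) hD.1 hw hX
  have hX' := addHull_of_geq_geq K hD h1 h2
  obtain ⟨G, ⟨eG⟩⟩ := S.exists_twoTerm_of_addHull hD.1 hX'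
  obtain ⟨F, ⟨eF⟩⟩ := S.exists_twoTerm_of_addHull hD.1 hw.1
  have hG : ∀ k, G.x₀ k ≠ i := fun k hk => by
    obtain ⟨l, hl⟩ := S.exists_x₀_eq_of_addHull (hX'.of_iso eG.symm) k
    exact h₀ l (hl.trans hk)
  have hF : ∀ k, F.x₁ k ≠ i := fun k hk => by
    obtain ⟨l, hl⟩ := S.exists_x₁_eq_of_addHull (hw.1.of_iso eF.symm) k
    exact h₁ l (hl.trans hk)
  have hT := distTriang_of_iso₂₃ hX eG eF
  generalize u ≫ eG.hom = u at hT
  generalize eG.inv ≫ r ≫ eF.hom = r at hT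
  generalize eF.inv ≫ w = w at hT
  have hv : ∀ {V W : C}, addHull R V → addHull R W → HomVanishes V W 1 := fun hV hW =>
    S.homVanishes_of_addHull hV hW one_ne_zero
  obtain ⟨α, hα⟩ := distTriang_lift₃ G.distinguished u (hv i.addHull (addHull_sumObj _) _)
  obtain ⟨g, hg⟩ := distTriang_lift₃ hT F.g (hv (addHull_sumObj _) i.addHull _)
  obtain ⟨β, hβ⟩ := distTriang_lift₃ F.distinguished (G.g ≫ r)
    (hv (addHull_sumObj _) (addHull_sumObj _) _)
  obtain ⟨γ, hγ⟩ := distTriang_lift₂ hT (G.g - β ≫ g) (by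
    rw [Preadditive.sub_comp, hβ, Category.assoc, ← hg, sub_self])
  -- Since `i` is absent from degree `0` of `G`, the loop `α ≫ γ` is radical and can be inverted
  -- away, leaving `u = δ ≫ g` through degree `0` of `F`.
  have h3 : (𝟙 _ - α ≫ γ) ≫ u = α ≫ β ≫ g := by
    rw [Preadditive.sub_comp, Category.id_comp, Category.assoc, ← hγ, Preadditive.comp_sub, ← hα]
    abel
  have h4 : IsIso (𝟙 _ - α ≫ γ) := S.isIso_of_rad i.addHull (by
    rw [sub_sub_cancel]
    exact S.rad_comp (S.mem_rad_to_sumObj hG α) _)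
  set δ := inv (𝟙 _ - α ≫ γ) ≫ α ≫ β with hδ
  have h5 : u = δ ≫ g := by
    rw [hδ, Category.assoc, Category.assoc, ← h3, IsIso.inv_hom_id_assoc]
  obtain ⟨ε, hε⟩ := distTriang_lift₂ F.distinguished δ (by
    rw [hg, ← Category.assoc, ← h5, distTriang_comp₁₂ hT])
  obtain ⟨ζ, hζ⟩ := distTriang_lift₂ hT (F.a ≫ g) (by
    rw [Category.assoc, ← hg, distTriang_comp₁₂ F.distinguished])
  -- Now `u = ε ≫ ζ ≫ u` passes through degree `-1` of `F`, where `i` is absent as well; again the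
  -- loop is radical.
  have h6 : (𝟙 _ - ε ≫ ζ) ≫ u = 0 := by
    rw [Preadditive.sub_comp, Category.id_comp, Category.assoc, ← hζ, ← Category.assoc, ← hε, ← h5,
      sub_self]
  have h7 : IsIso (𝟙 _ - ε ≫ ζ) := S.isIso_of_rad i.addHull (by
    rw [sub_sub_cancel]
    exact S.comp_rad _ (S.mem_rad_from_sumObj hF ζ))
  have h8 : u = 0 := by rw [← cancel_epi (𝟙 _ - ε ≫ ζ), h6, comp_zero]
  -- With `u = 0` the map `w` is a split epimorphism, and the identity of `i` factors through degree
  -- `-1` of `F`, a contradiction.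
  obtain ⟨s, hs⟩ := distTriang_lift₁ hT (𝟙 _) (by rw [h8, Functor.map_zero, comp_zero])
  obtain ⟨f, hf⟩ := distTriang_desc₃ F.distinguished w (hv (addHull_sumObj _) i.addHull _)
  obtain ⟨f, rfl⟩ := (shiftFunctor C (1 : ℤ)).map_surjective f
  obtain ⟨σ, hσ⟩ := (shiftFunctor C (1 : ℤ)).map_surjective (s ≫ F.h)
  rw [hf, ← Category.assoc, ← hσ, ← Functor.map_comp, ← CategoryTheory.Functor.map_id] at hs
  refine S.id_not_mem_rad i ?_
  rw [(shiftFunctor C (1 : ℤ)).map_injective hs]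
  exact S.comp_rad _ (S.mem_rad_from_sumObj hF f)

include S in
-- Two rows of the scalar matrix belonging to the same class are supported on one common column, so
-- after multiplication by `B` they cannot be two different rows of the identity matrix.
lemma injective_of_retract {I J : Type} [Fintype I] [Fintype J] {x : I → Ind R} {y : J → Ind R}
    (hy : Function.Injective y) (r : Retract (sumObj x) (sumObj y)) : Function.Injective x := by
  classical
  intro k l hkl
  by_contra hne
  have h1 := S.scalarMat_comp r.i r.r
  rw [r.retract, scalarMat_id] at h1
  have hA := S.isSupported_scalarMat r.i
  generalize S.scalarMat r.i = A at h1 hA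
  generalize S.scalarMat r.r = B at h1
  have hkk := congrFun (congrFun h1 k) k
  have hlk := congrFun (congrFun h1 k) l
  have hll := congrFun (congrFun h1 l) l
  rw [Matrix.one_apply_eq, Matrix.mul_apply] at hkk hll
  rw [Matrix.one_apply_ne hne, Matrix.mul_apply] at hlk
  by_cases hj : ∃ j, x k = y j
  · obtain ⟨j, hj⟩ := hj
    have h2 : ∀ j' ≠ j, A k j' = 0 := fun j' hj' => hA k j' fun h => hj' (hy (h.symm.trans hj))
    have h3 : ∀ j' ≠ j, A l j' = 0 := fun j' hj' => hA l j' fun h =>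
      hj' (hy (h.symm.trans (hkl.symm.trans hj)))
    rw [Fintype.sum_eq_single j fun j' hj' => by rw [h2 j' hj', zero_mul]] at hkk hlk
    rw [Fintype.sum_eq_single j fun j' hj' => by rw [h3 j' hj', zero_mul]] at hll
    rcases mul_eq_zero.1 hlk.symm with h | h
    · rw [h, zero_mul] at hkk
      exact one_ne_zero hkk
    · rw [h, mul_zero] at hll
      exact one_ne_zero hll
  · push Not at hj
    rw [Finset.sum_eq_zero fun j _ => by rw [hA k j (hj j), zero_mul]] at hkk
    exact one_ne_zero hkk

include S in
/-- An indecomposable summand of a basic object does not occur in the complement. -/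
lemma not_addHull_of_isBasic {i : Ind R} {M : C} (hM : addHull R M) (h : IsBasic (i.obj ⊞ M)) :
    ¬ addHull M i.obj := by
  intro hi
  obtain ⟨n, Z, h1, h2, ⟨e⟩⟩ := h
  obtain ⟨J, _, y, ⟨eM⟩⟩ := exists_iso_sumObj K hM
  have hZ : ∀ k, addHull R (Z k) := fun k => addHull.of_retract
    (⟨biproduct.ι Z k ≫ e.inv, e.hom ≫ biproduct.π Z k, by simp⟩ : Retract (Z k) (i.obj ⊞ M))
    (addHull_biprod i.addHull hM)
  choose z hz using fun k => Ind.exists_iso (h1 k) (hZ k)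
  have hz' : Function.Injective z := fun k l hkl =>
    h2 k l ⟨(hz k).some ≪≫ eqToIso (by rw [hkl]) ≪≫ (hz l).some.symm⟩
  obtain ⟨e'⟩ := nonempty_sumObj_sum (fun _ : Unit => i) y
  have e₁ : sumObj (Sum.elim (fun _ : Unit => i) y) ≅ sumObj z :=
    e' ≪≫ biprod.mapIso (biproductUniqueIso fun _ : Unit => i.obj) eM.symm ≪≫ e ≪≫
      biproduct.mapIso fun k => (hz k).some
  have h3 := S.injective_of_retract hz' e₁.retract
  obtain ⟨k, hk⟩ := S.exists_eq_of_addHull (hi.trans (addHull_self (sumObj y) |>.of_iso eM))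
  have := @h3 (Sum.inl ()) (Sum.inr k) hk.symm
  cases this

include S in
/-- A basic version of the generator that contains a given indecomposable object. -/
lemma exists_complement (i : Ind R) : ∃ (J : Type) (_ : Fintype J) (y : J → Ind R),
    IsBasic (i.obj ⊞ sumObj y) ∧ addHull (i.obj ⊞ sumObj y) = addHull R ∧
    ∀ j : Ind R, j ≠ i → addHull (sumObj y) j.obj := by
  classical
  obtain ⟨I, _, x, ⟨e⟩⟩ := exists_iso_sumObj K (addHull_self R)
  let s : Finset (Ind R) := (Finset.univ.image x).erase i
  let y : Fin s.card → Ind R := fun k => (s.equivFin.symm k : Ind R)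
  have hy : ∀ j : Ind R, j ≠ i → ∃ k, y k = j := fun j hj => by
    obtain ⟨k, hk⟩ := S.exists_eq_of_addHull ((addHull_self (sumObj x)).of_iso e |> j.addHull.trans)
    exact ⟨s.equivFin ⟨j, Finset.mem_erase.2 ⟨hj, Finset.mem_image.2 ⟨k, Finset.mem_univ k, hk⟩⟩⟩,
      by simp [y]⟩
  have hy' : ∀ k, y k ≠ i := fun k => (Finset.mem_erase.1 (s.equivFin.symm k).2).1
  have hyi : Function.Injective y := Subtype.val_injective.comp s.equivFin.symm.injective
  have hj : ∀ j : Ind R, j ≠ i → addHull (sumObj y) j.obj := fun j hj => by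
    obtain ⟨k, rfl⟩ := hy j hj
    exact addHull.of_retract (⟨biproduct.ι (fun k => (y k).obj) k,
      biproduct.π (fun k => (y k).obj) k, by simp⟩ : Retract (y k).obj (sumObj y)) (addHull_self _)
  refine ⟨_, _, y, ?_, ?_, hj⟩
  · let Z : Fin (s.card + 1) → C := fun k => ((Fin.cons i y : Fin (s.card + 1) → Ind R) k).obj
    have hinj : Function.Injective (Fin.cons i y : Fin (s.card + 1) → Ind R) :=
      Fin.cons_injective_iff.2 ⟨by rintro ⟨k, hk⟩; exact hy' k hk, hyi⟩
    obtain ⟨e'⟩ := nonempty_iso_biproduct_fin_succ Z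
    exact ⟨_, Z, fun k => Ind.indecomposable _, fun k l ⟨e''⟩ => hinj (Ind.eq_of_iso e''),
      ⟨e'.symm⟩⟩
  · have hi : addHull (i.obj ⊞ sumObj y) i.obj := (addHull_self _).of_retract
      ⟨biprod.inl, biprod.fst, by simp⟩
    have hyy : addHull (i.obj ⊞ sumObj y) (sumObj y) := (addHull_self _).of_retract
      ⟨biprod.inr, biprod.snd, by simp⟩
    ext X
    refine ⟨fun h => h.trans (addHull_biprod i.addHull (addHull_sumObj y)), fun h => h.trans ?_⟩
    refine addHull.of_iso e (addHull_biproduct fun k => ?_)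
    by_cases hk : x k = i
    · rw [hk]
      exact hi
    · exact (hj _ hk).trans hyy

end SymmetricGenerator

end Mutation

/-! ### Comparison with the two mutations in terms of the terms of a complex. -/

section MutationOrder

variable {C : Type u} [Category.{v} C] [Preadditive C] [HasZeroObject C] [HasShift C ℤ]
  [∀ n : ℤ, (shiftFunctor C n).Additive] [Pretriangulated C]

lemma IsLeftMutation.of_iso {T X X' U : C} (e : X ≅ X') (h : IsLeftMutation T X U) :
    IsLeftMutation T X' U := by
  obtain ⟨M, M', Y, f, g, h, ⟨eT⟩, ⟨h1, h2, h3⟩, hT, eU⟩ := h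
  refine ⟨M, M', Y, e.inv ≫ f, g, h ≫ (shiftFunctor C (1 : ℤ)).map e.hom,
    ⟨eT ≪≫ biprod.mapIso e (Iso.refl _)⟩, ⟨h1, fun N hN r => ?_, fun t ht => h3 t ?_⟩,
    distTriang_of_iso₁ hT e, eU⟩
  · obtain ⟨s, hs⟩ := h2 N hN (e.hom ≫ r)
    exact ⟨s, by rw [Category.assoc, hs, Iso.inv_hom_id_assoc]⟩
  · rwa [Category.assoc, cancel_epi] at ht

lemma IsRightMutation.of_iso {T X X' U : C} (e : X ≅ X') (h : IsRightMutation T X U) :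
    IsRightMutation T X' U := by
  obtain ⟨M, M', Y, g, f, h, ⟨eT⟩, ⟨h1, h2, h3⟩, hT, eU⟩ := h
  have hT' := distTriang_of_iso₂₃ hT (Iso.refl _) e
  rw [Iso.refl_hom, Iso.refl_inv, Category.comp_id, Category.id_comp] at hT'
  refine ⟨M, M', Y, g, f ≫ e.hom, e.inv ≫ h,
    ⟨eT ≪≫ biprod.mapIso e (Iso.refl _)⟩, ⟨h1, fun N hN r => ?_, fun t ht => h3 t ?_⟩, hT', eU⟩
  · obtain ⟨s, hs⟩ := h2 N hN (r ≫ e.inv)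
    exact ⟨s, by rw [← Category.assoc, hs, Category.assoc, Iso.inv_hom_id, Category.comp_id]⟩
  · rwa [← Category.assoc, cancel_mono] at ht

lemma IsMinimalRightApprox.shift {M M' X : C} {f : M' ⟶ X} (h : IsMinimalRightApprox M f) :
    IsMinimalRightApprox ((shiftFunctor C (1 : ℤ)).obj M) ((shiftFunctor C (1 : ℤ)).map f) := by
  obtain ⟨h1, h2, h3⟩ := h
  refine ⟨addHull_shift_iff.2 h1, fun N hN r => ?_, fun t ht => ?_⟩
  · obtain ⟨N', ⟨e⟩⟩ := exists_iso_shift N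
    obtain ⟨r', hr'⟩ := (shiftFunctor C (1 : ℤ)).map_surjective (e.inv ≫ r)
    obtain ⟨s, rfl⟩ := h2 N' (addHull_shift_iff.1 (hN.of_iso e.symm)) r'
    exact ⟨e.hom ≫ (shiftFunctor C (1 : ℤ)).map s, by
      rw [Category.assoc, ← Functor.map_comp, hr', Iso.hom_inv_id_assoc]⟩
  · obtain ⟨t, rfl⟩ := (shiftFunctor C (1 : ℤ)).map_surjective t
    rw [← Functor.map_comp] at ht
    have := h3 t ((shiftFunctor C (1 : ℤ)).map_injective ht)
    infer_instance

lemma addHull_shift_congr {X Y : C} (h : addHull X = addHull Y) :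
    addHull ((shiftFunctor C (1 : ℤ)).obj X) = addHull ((shiftFunctor C (1 : ℤ)).obj Y) := by
  ext Z
  obtain ⟨Z', ⟨e⟩⟩ := exists_iso_shift Z
  have h1 : addHull X Z' ↔ addHull Y Z' := by rw [h]
  constructor <;> intro hZ
  · exact (addHull_shift_iff.2 (h1.1 (addHull_shift_iff.1 (hZ.of_iso e.symm)))).of_iso e
  · exact (addHull_shift_iff.2 (h1.2 (addHull_shift_iff.1 (hZ.of_iso e.symm)))).of_iso e

lemma Geq.biprod_left {X Y Z : C} (h : Geq X Z) (h' : Geq Y Z) : Geq (X ⊞ Y) Z := fun _ hn =>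
  HomVanishes.left₂ (binaryBiproductTriangle_distinguished X Y) (h.homVanishes hn)
    (h'.homVanishes hn)

lemma Geq.biprod_right {X Y Z : C} (h : Geq Z X) (h' : Geq Z Y) : Geq Z (X ⊞ Y) := fun _ hn =>
  HomVanishes.right₂ (binaryBiproductTriangle_distinguished X Y) (h.homVanishes hn)
    (h'.homVanishes hn)

variable {K : Type*} [Field K] [Linear K C] [∀ X Y : C, Module.Finite K (X ⟶ Y)]
  {Λ : Type*} [Ring Λ] [Algebra K Λ] {R : C} (S : SymmetricGenerator K Λ R) [IsAlgClosed K]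

lemma addHull_of_sumObj {M : C} {I : Type} [Fintype I] {x : I → Ind R} (h : addHull M (sumObj x))
    (k : I) : addHull M (x k).obj :=
  h.of_retract ⟨biproduct.ι (fun k => (x k).obj) k, biproduct.π (fun k => (x k).obj) k, by simp⟩

namespace SymmetricGenerator

include S in
-- The essential vanishing is `Hom(Y, D.obj[1]) = 0`, which says that every map `i ⟶ D.obj` factors
-- through the approximation `f : i ⟶ M'`. That works if `i` is absent from degree `0`. If `i` is
-- present, its inclusion cannot factor, because `f` and the differential are both radical.
lemma exists_leftMutation_geq_iff (i : Ind R) (D : TwoTerm R) :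
    (∃ U, (∃ B, IsBasicVersion R B ∧ IsLeftMutation B i.obj U) ∧ Geq U D.obj) ↔
      ∀ l, D.x₀ l ≠ i := by
  have hv : ∀ {V W : C}, addHull R V → addHull R W → HomVanishes V W 1 := fun hV hW =>
    S.homVanishes_of_addHull hV hW one_ne_zero
  constructor
  · rintro ⟨U, ⟨B, ⟨hB, hBR⟩, M, M', Y, f, g, h, ⟨eB⟩, hf, hT, ⟨eU⟩⟩, hU⟩ l rfl
    have hM : addHull R M := hBR ▸ ((addHull_self B).of_retract
      ⟨biprod.inr ≫ eB.inv, eB.hom ≫ biprod.snd, by simp⟩)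
    have hM' := hf.1.trans hM
    have hnot := S.not_addHull_of_isBasic hM (hB.of_iso eB)
    have hY : Geq Y D.obj := (hU.of_iso eU (Iso.refl _)).addHull ((addHull_self _).of_retract
      ⟨biprod.inl, biprod.fst, by simp⟩) (addHull_self _)
    let ι := biproduct.ι (fun k => (D.x₀ k).obj) l
    obtain ⟨ψ, hψ⟩ := distTriang_desc₁ hT ((shiftFunctor C (1 : ℤ)).map (ι ≫ D.g))
      (hY.homVanishes one_pos _)
    obtain ⟨ψ, rfl⟩ := (shiftFunctor C (1 : ℤ)).map_surjective ψ
    rw [← Functor.map_comp] at hψ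
    replace hψ := (shiftFunctor C (1 : ℤ)).map_injective hψ
    obtain ⟨ψ', rfl⟩ := distTriang_lift₃ D.distinguished ψ (hv hM' (addHull_sumObj _) _)
    obtain ⟨c, hc⟩ := distTriang_lift₂ D.distinguished (ι - f ≫ ψ') (by
      rw [Preadditive.sub_comp, hψ, Category.assoc, sub_self])
    obtain ⟨J, _, z, ⟨e⟩⟩ := exists_iso_sumObj K hM'
    have hz : ∀ k, z k ≠ D.x₀ l := fun k hk => hnot (by
      rw [← hk]
      exact addHull_of_sumObj (hf.1.of_iso e.symm) k)
    have hfr : f ∈ S.rad _ _ := by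
      rw [← Category.comp_id f, ← e.hom_inv_id, ← Category.assoc]
      exact S.rad_comp (S.mem_rad_to_sumObj hz _) _
    refine S.id_not_mem_rad (D.x₀ l) ?_
    -- The inclusion of the summand agrees with `f ≫ ψ'` up to the differential, which would make
    -- the identity of an indecomposable radical.
    have h1 : 𝟙 (D.x₀ l).obj = (c ≫ D.a + f ≫ ψ') ≫ biproduct.π (fun k => (D.x₀ k).obj) l := by
      rw [← hc, sub_add_cancel, biproduct.ι_π_self]
    rw [h1]
    exact S.rad_comp (add_mem (S.comp_rad _ (S.mem_rad_differential D)) (S.rad_comp hfr _)) _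
  · intro hi
    obtain ⟨J, _, y, hB, hBR, hy⟩ := S.exists_complement i
    obtain ⟨I, _, z, f, hf⟩ := S.exists_minimalLeftApprox (addHull_sumObj y) i.obj
    obtain ⟨Y, g, h, hT⟩ := Pretriangulated.distinguished_cocone_triangle f
    refine ⟨Y ⊞ sumObj y, ⟨_, ⟨hB, hBR⟩, _, _, Y, f, g, h, ⟨Iso.refl _⟩, hf, hT, ⟨Iso.refl _⟩⟩,
      Geq.biprod_left (fun n hn => ?_)
        ((S.geq_obj D).addHull (addHull_sumObj y) (addHull_self _))⟩
    have hz : ∀ {n : ℤ}, 0 < n → HomVanishes (sumObj z) D.obj n := fun hn =>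
      ((S.geq_obj D).homVanishes hn).addHull_left (addHull_sumObj z)
    by_cases hn1 : n = 1
    · subst hn1
      intro φ
      obtain ⟨ξ, rfl⟩ := distTriang_desc₃ hT φ (hz one_pos _)
      obtain ⟨χ, rfl⟩ := (shiftFunctor C (1 : ℤ)).map_surjective ξ
      obtain ⟨χ, rfl⟩ := distTriang_lift₃ D.distinguished χ (hv i.addHull (addHull_sumObj _) _)
      obtain ⟨κ, rfl⟩ := hf.2.1 _ (addHull_biproduct fun l => hy _ (hi l)) χ
      rw [Category.assoc, Functor.map_comp, ← Category.assoc, distTriang_comp₃₁ hT, zero_comp]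
    · exact HomVanishes.left₃ hT (hz hn)
        (((S.geq_obj D).homVanishes (by omega)).addHull_left i.addHull)

include S in
-- The mirror image: every map `D.obj ⟶ i[1]` must factor through the shifted approximation `M' ⟶
-- i[1]`, and the projection of degree `-1` onto a summand `i` is the obstruction.
lemma exists_rightMutation_geq_iff (i : Ind R) (D : TwoTerm R) :
    (∃ U, (∃ B, IsBasicVersion ((shiftFunctor C (1 : ℤ)).obj R) B ∧
      IsRightMutation B ((shiftFunctor C (1 : ℤ)).obj i.obj) U) ∧ Geq D.obj U) ↔
      ∀ l, D.x₁ l ≠ i := by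
  have := preservesBinaryBiproducts_of_preservesBiproducts (shiftFunctor C (1 : ℤ))
  have hv : ∀ {V W : C}, addHull R V → addHull R W → HomVanishes V W 1 := fun hV hW =>
    S.homVanishes_of_addHull hV hW one_ne_zero
  constructor
  · rintro ⟨U, ⟨B, ⟨hB, hBR⟩, M, M', Y, g, f, h, ⟨eB⟩, hf, hT, ⟨eU⟩⟩, hU⟩ l rfl
    obtain ⟨M₀, ⟨eM⟩⟩ := exists_iso_shift M
    obtain ⟨M₀', ⟨eM'⟩⟩ := exists_iso_shift M'
    have hM : addHull R M₀ := by
      have h1 : addHull B M := (addHull_self B).of_retract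
        ⟨biprod.inr ≫ eB.inv, eB.hom ≫ biprod.snd, by simp⟩
      rw [hBR] at h1
      exact addHull_shift_iff.1 (h1.of_iso eM.symm)
    have hM₀' : addHull M₀ M₀' :=
      addHull_shift_iff.1 ((hf.1.of_iso eM'.symm).trans ((addHull_self _).of_iso eM))
    have hM' := hM₀'.trans hM
    have hnot := S.not_addHull_of_isBasic (i := D.x₁ l) hM (isBasic_shift_iff.1
      (hB.of_iso (eB ≪≫ biprod.mapIso (Iso.refl _) eM ≪≫
        ((shiftFunctor C (1 : ℤ)).mapBiprod _ _).symm)))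
    have hY : Geq D.obj Y := (hU.of_iso (Iso.refl _) eU).addHull (addHull_self _)
      ((addHull_self _).of_retract ⟨biprod.inl, biprod.fst, by simp⟩)
    obtain ⟨f₀, hf₀⟩ := (shiftFunctor C (1 : ℤ)).map_surjective (eM'.inv ≫ f)
    let p := biproduct.π (fun k => (D.x₁ k).obj) l
    obtain ⟨ψ, hψ⟩ := distTriang_lift₃ hT (D.h ≫ (shiftFunctor C (1 : ℤ)).map p)
      (hY.homVanishes one_pos _)
    obtain ⟨ξ, hξ⟩ := distTriang_desc₃ D.distinguished (ψ ≫ eM'.hom) (hv (addHull_sumObj _) hM' _)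
    obtain ⟨ξ, rfl⟩ := (shiftFunctor C (1 : ℤ)).map_surjective ξ
    have h1 : D.h ≫ (shiftFunctor C (1 : ℤ)).map (p - ξ ≫ f₀) = 0 := by
      rw [Functor.map_sub, Functor.map_comp, Preadditive.comp_sub, ← Category.assoc, ← hξ, hf₀, hψ]
      simp
    obtain ⟨c, hc⟩ := distTriang_desc₁ D.distinguished _ h1
    obtain ⟨c, rfl⟩ := (shiftFunctor C (1 : ℤ)).map_surjective c
    rw [← Functor.map_comp] at hc
    replace hc := (shiftFunctor C (1 : ℤ)).map_injective hc
    obtain ⟨J, _, z, ⟨e⟩⟩ := exists_iso_sumObj K hM'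
    have hz : ∀ k, z k ≠ D.x₁ l := fun k hk => hnot (by
      rw [← hk]
      exact addHull_of_sumObj (hM₀'.of_iso e.symm) k)
    have hfr : f₀ ∈ S.rad _ _ := by
      rw [← Category.id_comp f₀, ← e.hom_inv_id, Category.assoc]
      exact S.comp_rad _ (S.mem_rad_from_sumObj hz _)
    refine S.id_not_mem_rad (D.x₁ l) ?_
    have h2 : 𝟙 (D.x₁ l).obj = biproduct.ι (fun k => (D.x₁ k).obj) l ≫ (D.a ≫ c + ξ ≫ f₀) := by
      rw [← hc, sub_add_cancel, biproduct.ι_π_self]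
    rw [h2]
    exact S.comp_rad _ (add_mem (S.rad_comp (S.mem_rad_differential D) _) (S.comp_rad _ hfr))
  · intro hi
    obtain ⟨J, _, y, hB, hBR, hy⟩ := S.exists_complement i
    obtain ⟨I, _, z, f, hf⟩ := S.exists_minimalRightApprox (addHull_sumObj y) i.obj
    obtain ⟨Y, g, h, hT⟩ :=
      Pretriangulated.distinguished_cocone_triangle₁ ((shiftFunctor C (1 : ℤ)).map f)
    have hs : ∀ V : C, addHull R V → Geq D.obj ((shiftFunctor C (1 : ℤ)).obj V) := fun V hV =>
      (S.obj_geq_shift D).addHull (addHull_self _) (addHull_shift_iff.2 hV)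
    refine ⟨Y ⊞ (shiftFunctor C (1 : ℤ)).obj (sumObj y),
      ⟨_, ⟨isBasic_shift_iff.2 hB, addHull_shift_congr hBR⟩, _, _, Y, g, _, h,
        ⟨(shiftFunctor C (1 : ℤ)).mapBiprod _ _⟩, hf.shift, hT, ⟨Iso.refl _⟩⟩,
      Geq.biprod_right (fun n hn => ?_) (hs _ (addHull_sumObj y))⟩
    have hz : ∀ {n : ℤ}, 0 < n →
        HomVanishes D.obj ((shiftFunctor C (1 : ℤ)).obj (sumObj z)) n := fun hn =>
      (hs _ (addHull_sumObj z)).homVanishes hn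
    by_cases hn1 : n = 1
    · subst hn1
      intro φ
      obtain ⟨χ, rfl⟩ := distTriang_lift₁ hT φ (hz one_pos _)
      obtain ⟨ξ, rfl⟩ := distTriang_desc₃ D.distinguished χ (hv (addHull_sumObj _) i.addHull _)
      obtain ⟨χ, rfl⟩ := (shiftFunctor C (1 : ℤ)).map_surjective ξ
      obtain ⟨κ, rfl⟩ := hf.2.1 _ (addHull_biproduct fun l => hy _ (hi l)) χ
      rw [Functor.map_comp, Category.assoc, Category.assoc, distTriang_comp₂₃ hT, comp_zero,
        comp_zero]
    · exact HomVanishes.right₁ hT ((hs _ i.addHull).homVanishes (by omega)) (hz hn)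

end SymmetricGenerator

end MutationOrder

/-! ### Transposition on isomorphism classes. -/

section DualClass

variable {C : Type u} [Category.{v} C] [Preadditive C] [HasZeroObject C] [HasShift C ℤ]
  [∀ n : ℤ, (shiftFunctor C n).Additive] [Pretriangulated C]
  {K : Type*} [Field K] [Linear K C] [∀ X Y : C, Module.Finite K (X ⟶ Y)]
  {Λ : Type*} [Ring Λ] [Algebra K Λ] {R : C} (S : SymmetricGenerator K Λ R) [IsAlgClosed K]

lemma IsoClass.of_eq_iff {X Y : C} : IsoClass.of X = IsoClass.of Y ↔ Nonempty (X ≅ Y) :=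
  Quotient.eq (r := isIsomorphicSetoid C)

namespace SymmetricGenerator

open scoped Classical in
/-- The isomorphism class of the transposed two-term complex. -/
def dualClass (x : IsoClass C) : IsoClass C :=
  if h : ∃ D : TwoTerm R, IsoClass.of D.obj = x then IsoClass.of (S.dual h.choose).obj else x

/-- Independence of the chosen representative is `nonempty_iso_dual`, which requires `D.obj` to have
no positive self-extensions. -/
lemma dualClass_of {D : TwoTerm R} (hD : Geq D.obj D.obj) :
    S.dualClass (IsoClass.of D.obj) = IsoClass.of (S.dual D).obj := by
  have h : ∃ E : TwoTerm R, IsoClass.of E.obj = IsoClass.of D.obj := ⟨D, rfl⟩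
  rw [dualClass, dif_pos h]
  obtain ⟨e⟩ := IsoClass.of_eq_iff.1 h.choose_spec
  exact IsoClass.of_eq_iff.2 (S.nonempty_iso_dual (hD.of_iso e.symm e.symm) e)

end SymmetricGenerator

end DualClass

/-! ### The involution on two-term silting objects and the partition of the set. -/

section TwoTermSilting

variable {K : Type v} [Field K] {Λ : Type w} [Ring Λ] [Algebra K Λ] [FiniteDimensional K Λ]

/-- The generator `Λ` of the perfect derived category of a symmetric algebra `Λ` of radical cube
zero. -/
def regularGenerator {φ : Λ →ₗ[K] K} (hφ : ∀ a b : Λ, φ (a * b) = φ (b * a))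
    (hφ' : ∀ a : Λ, (∀ b : Λ, φ (a * b) = 0) → a = 0) (hrad : Ring.jacobson Λ ^ 3 = ⊥) :
    SymmetricGenerator K Λ (regular Λ) where
  homVanishes _ hn := homVanishes_regular hn
  thick := thickGenerates_regular
  splits _ hX _ he := splitsIdem_of_addHull hX he
  eval := regularEval K
  eval_injective := regularEval_injective K
  eval_surjective := regularEval_surjective K
  eval_comp := regularEval_comp K
  form := φ
  form_comm := hφ
  form_nondegenerate := hφ'
  jacobson_cube := hrad

variable [IsAlgClosed K] (S : SymmetricGenerator K Λ (regular Λ))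

namespace SymmetricGenerator

include S in
lemma mem_twoSilt_iff {x : IsoClass (KbProj Λ)} : x ∈ twoSilt Λ ↔
    ∃ D : TwoTerm (regular Λ), IsoClass.of D.obj = x ∧ IsBasic D.obj ∧ IsSilting D.obj := by
  constructor
  · rintro ⟨⟨T, rfl, hT, hT'⟩, h1, h2⟩
    obtain ⟨D, ⟨e⟩⟩ := S.exists_twoTerm (T := T) h1 h2 hT'.1
    refine ⟨D, IsoClass.of_eq_iff.2 ⟨e.symm⟩, hT.of_iso e, hT'.1.of_iso e e, fun Q hQ hQ' h => ?_⟩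
    exact hT'.2 Q hQ hQ' (ObjectProperty.prop_of_iso Q e.symm h)
  · rintro ⟨D, rfl, h1, h2⟩
    exact ⟨⟨D.obj, rfl, h1, h2⟩, S.geq_obj D, S.obj_geq_shift D⟩

lemma dualClass_mem_twoSilt {x : IsoClass (KbProj Λ)} (hx : x ∈ twoSilt Λ) :
    S.dualClass x ∈ twoSilt Λ := by
  obtain ⟨D, rfl, h1, h2⟩ := S.mem_twoSilt_iff.1 hx
  rw [S.dualClass_of h2.1]
  exact S.mem_twoSilt_iff.2 ⟨_, rfl, S.isBasic_dual h2.1 h1, S.isSilting_dual h2⟩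

lemma dualClass_dualClass {x : IsoClass (KbProj Λ)} (hx : x ∈ twoSilt Λ) :
    S.dualClass (S.dualClass x) = x := by
  obtain ⟨D, rfl, h1, h2⟩ := S.mem_twoSilt_iff.1 hx
  rw [S.dualClass_of h2.1, S.dualClass_of (S.geq_dual h2.1), dual_dual]

lemma geq_dualClass_iff {x y : IsoClass (KbProj Λ)} (hx : x ∈ twoSilt Λ) (hy : y ∈ twoSilt Λ) :
    x.Geq y ↔ (S.dualClass y).Geq (S.dualClass x) := by
  obtain ⟨D, rfl, -, h2⟩ := S.mem_twoSilt_iff.1 hx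
  obtain ⟨E, rfl, -, h4⟩ := S.mem_twoSilt_iff.1 hy
  rw [S.dualClass_of h2.1, S.dualClass_of h4.1]
  exact S.geq_dual_iff.symm

variable {P : ModuleCat.{w} Λ} [Module.Finite Λ P] [Module.Projective Λ P]
  {i : Ind (regular Λ)} (e : stalk P ≅ i.obj)

include S e

lemma mem_TMinus_iff {D : TwoTerm (regular Λ)} (hD : IsoClass.of D.obj ∈ twoSilt Λ) :
    IsoClass.of D.obj ∈ TMinus P ↔ ∀ l, D.x₀ l ≠ i := by
  rw [← S.exists_leftMutation_geq_iff]
  constructor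
  · rintro ⟨-, ⟨U, ⟨B, hB, hU⟩, h⟩, -⟩
    exact ⟨U, ⟨B, hB, hU.of_iso e⟩, h⟩
  · rintro ⟨U, ⟨B, hB, hU⟩, h⟩
    exact ⟨hD, ⟨U, ⟨B, hB, hU.of_iso e.symm⟩, h⟩, hD.2.2⟩

lemma mem_TPlus_iff {D : TwoTerm (regular Λ)} (hD : IsoClass.of D.obj ∈ twoSilt Λ) :
    IsoClass.of D.obj ∈ TPlus P ↔ ∀ l, D.x₁ l ≠ i := by
  rw [← S.exists_rightMutation_geq_iff]
  let e' := (shiftFunctor (KbProj Λ) (1 : ℤ)).mapIso e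
  constructor
  · rintro ⟨-, -, U, ⟨B, hB, hU⟩, h⟩
    exact ⟨U, ⟨B, hB, hU.of_iso e'⟩, h⟩
  · rintro ⟨U, ⟨B, hB, hU⟩, h⟩
    exact ⟨hD, hD.2.1, U, ⟨B, hB, hU.of_iso e'.symm⟩, h⟩

lemma dualClass_mem_TPlus {x : IsoClass (KbProj Λ)} (hx : x ∈ TMinus P) :
    S.dualClass x ∈ TPlus P := by
  obtain ⟨D, rfl, h1, h2⟩ := S.mem_twoSilt_iff.1 hx.1
  have h := S.dualClass_mem_twoSilt hx.1
  rw [S.dualClass_of h2.1] at h ⊢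
  exact (S.mem_TPlus_iff e h).2 ((S.mem_TMinus_iff e hx.1).1 hx)

lemma dualClass_mem_TMinus {x : IsoClass (KbProj Λ)} (hx : x ∈ TPlus P) :
    S.dualClass x ∈ TMinus P := by
  obtain ⟨D, rfl, h1, h2⟩ := S.mem_twoSilt_iff.1 hx.1
  have h := S.dualClass_mem_twoSilt hx.1
  rw [S.dualClass_of h2.1] at h ⊢
  exact (S.mem_TMinus_iff e h).2 ((S.mem_TPlus_iff e hx.1).1 hx)

lemma disjoint_TMinus_TPlus : Disjoint (TMinus P) (TPlus P) := by
  rw [Set.disjoint_left]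
  intro x hx hx'
  obtain ⟨D, rfl, h1, h2⟩ := S.mem_twoSilt_iff.1 hx.1
  rcases S.exists_eq_of_isSilting h2 i with ⟨l, hl⟩ | ⟨l, hl⟩
  · exact (S.mem_TMinus_iff e hx.1).1 hx l hl
  · exact (S.mem_TPlus_iff e hx.1).1 hx' l hl

/-- If `i` occurs in degree `0`, it cannot occur in degree `-1`, since the two terms have no common
summand. -/
lemma TMinus_union_TPlus : TMinus P ∪ TPlus P = twoSilt Λ := by
  refine Set.Subset.antisymm (Set.union_subset (fun x hx => hx.1) fun x hx => hx.1) fun x hx => ?_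
  obtain ⟨D, rfl, h1, h2⟩ := S.mem_twoSilt_iff.1 hx
  by_cases h : ∀ l, D.x₀ l ≠ i
  · exact Or.inl ((S.mem_TMinus_iff e hx).2 h)
  · push Not at h
    obtain ⟨l, hl⟩ := h
    exact Or.inr ((S.mem_TPlus_iff e hx).2 fun k hk => D.disjoint k l (hk.trans hl.symm))

end SymmetricGenerator

end TwoTermSilting

end Silting

end

theorem theorem2p7 {K : Type v} [Field K] [IsAlgClosed K] {Λ : Type w} [Ring Λ] [Algebra K Λ]
    [FiniteDimensional K Λ] (hsymm : Silting.IsSymmetricAlgebra K Λ)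
    (hrad : Ring.jacobson Λ ^ 3 = ⊥)
    (P : ModuleCat.{w} Λ) [Module.Finite Λ P] [Module.Projective Λ P] (hP : Indecomposable P) :
    (∃ e : Silting.TMinus P ≃ Silting.TPlus P,
      ∀ x y : Silting.TMinus P, x.1.Geq y.1 ↔ (e y).1.Geq (e x).1) ∧
    Cardinal.mk (Silting.twoSilt Λ) = 2 * Cardinal.mk (Silting.TMinus P) := by
  obtain ⟨φ, hφ, hφ'⟩ := hsymm
  let S := Silting.regularGenerator hφ hφ' hrad
  obtain ⟨i, ⟨e⟩⟩ := Silting.Ind.exists_iso (Silting.indecomposable_stalk hP)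
    (Silting.addHull_regular_stalk P)
  let E : Silting.TMinus P ≃ Silting.TPlus P :=
    { toFun := fun x => ⟨S.dualClass x.1, S.dualClass_mem_TPlus e x.2⟩
      invFun := fun x => ⟨S.dualClass x.1, S.dualClass_mem_TMinus e x.2⟩
      left_inv := fun x => Subtype.ext (S.dualClass_dualClass x.2.1)
      right_inv := fun x => Subtype.ext (S.dualClass_dualClass x.2.1) }
  refine ⟨⟨E, fun x y => S.geq_dualClass_iff x.2.1 y.2.1⟩, ?_⟩
  rw [← S.TMinus_union_TPlus e, Cardinal.mk_union_of_disjoint (S.disjoint_TMinus_TPlus e), two_mul,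
    Cardinal.mk_congr E]
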